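/- Conventions. For a group $\Gamma$, let $F_n(\Gamma)$ be the free abelian group on $\Gamma^{n+1}$ with the diagonal left translation action and $\partial(x_0,\dots,x_n)=\sum_i(-1)^i(x_0,\dots,\widehat{x_i},\dots,x_n)$ (the standard resolution of $\mathbb Z$ over $\mathbb Z\Gamma$). For left $\Gamma$-modules $X$, $A$ let $X\otimes_\Gamma A$ denote the coinvariants of $X\otimes_{\mathbb Z}A$ under the diagonal action. Put $H_n(\Gamma;A)=H_n(F_*(\Gamma)\otimes_\Gamma A)$ and, for a subgroup $S\le\Gamma$, $H_n(\Gamma,S;A)=H_n\bigl(F_*(\Gamma)\otimes_\Gamma A\,/\,F_*(S)\otimes_S A\bigr)$. **Theorem (Relative Lyndon/Hochschild–Serre).** Let $G$ be a group, $H\trianglelefteq G$ a normal subgroup, $G'\le G$ a subgroup, and $M$ a $G$-module. Put $H'=H\cap G'$ and $Q=G/H$, and assume that the homomorphism $G'/H'\to G/H=Q$ induced by the inclusion $G'\le G$ is an isomorphism. Then $Q\cong G'/H'$ acts on $H_q(H,H';M)$, the class of $g\in G'$ acting by the map induced by $x\mapsto gxg^{-1}$ on $H$ and $m\mapsto gm$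 on $M$, and there is a first quadrant homological spectral sequence (with differentials $d^r\colon L^r_{p,q}\to L^r_{p-r,q+r-1}$, $r\ge2$) $$L^2_{p,q}\cong H_p\bigl(Q;H_q(H,H';M)\bigr)\Rightarrow H_{p+q}(G,G';M),$$ that is, each $H_n(G,G';M)$ has a filtration $0=F_{-1}\le F_0\le\dots\le F_n=H_n(G,G';M)$ with $F_p/F_{p-1}\cong L^\infty_{p,n-p}$ for $0\le p\le n$. If moreover $H$ acts trivially on $M$ and $M$ is free as a $\mathbb Z$-module, then for the same spectral sequence $$L^2_{p,q}\cong H_p\bigl(Q;H_q(H,H';\mathbb Z)\otimes_{\mathbb Z}M\bigr),$$ where $Q$ acts on $H_q(H,H';\mathbb Z)$ as above with trivial coefficients $\mathbb Z$, on $M$ through the $G$-action, and diagonally on the tensor product. -/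

import Mathlib

open CategoryTheory
open scoped TensorProduct MonoidAlgebra

universe w u v v'

noncomputable section

namespace RelativeLHS

/-! ### The chain modules `F_n(Γ) ⊗_Γ A`

`Representation.diagonal k Γ (n + 1)` is the free `k`-module `F_n(Γ)` on the `(n+1)`-tuples of
elements of `Γ` with the diagonal left translation action.  For left modules `X`, `A`, the tensor
product `X ⊗_Γ A` (with `X` made into a right module by `x g = g⁻¹ x`) is the module of coinvariants
of `X ⊗ A` under the diagonal action. -/

section Chains

variable {k : Type w} [CommRing k] {Γ Δ Λ : Type u} [Group Γ] [Group Δ] [Group Λ]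

/-- The module `F_n(Γ) ⊗_Γ A`. -/
abbrev Chains (A : Rep.{v} k Γ) (n : ℕ) : Type (max w u v) :=
  ((Representation.diagonal k Γ (n + 1)).tprod A.ρ).Coinvariants

variable (A : Rep.{v} k Γ) {B : Rep.{v} k Δ} {C : Rep.{v} k Λ}

/-- The generator `(x₀, …, xₙ) ⊗ a` of `F_n(Γ) ⊗_Γ A`. -/
def Chains.mk {n : ℕ} (x : Fin (n + 1) → Γ) (a : A) : Chains A n :=
  Representation.Coinvariants.mk _ (MonoidAlgebra.single x (1 : k) ⊗ₜ[k] a)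

variable {A}

lemma Chains.mk_smul {n : ℕ} (g : Γ) (x : Fin (n + 1) → Γ) (a : A) :
    Chains.mk A (g • x) (A.ρ g a) = Chains.mk A x a := by
  unfold Chains.mk
  rw [← Representation.Coinvariants.mk_self_apply _ g (MonoidAlgebra.single x (1 : k) ⊗ₜ[k] a)]
  simp

lemma Chains.lhom_ext {n : ℕ} {N : Type*} [AddCommGroup N] [Module k N]
    {f g : Chains A n →ₗ[k] N} (h : ∀ x a, f (Chains.mk A x a) = g (Chains.mk A x a)) : f = g := by
  refine Representation.Coinvariants.hom_ext ?_
  refine TensorProduct.ext ?_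
  refine MonoidAlgebra.lhom_ext' fun x => ?_
  ext a
  exact h x a

/-- The map `(x ⊗ a) ↦ θ x ⊗ f a`, for a homomorphism `φ`, a `φ`-equivariant map `θ` of tuples and
a `φ`-equivariant map `f` of coefficients. -/
def Chains.map {m n : ℕ} (φ : Γ →* Δ) (θ : (Fin (m + 1) → Γ) → (Fin (n + 1) → Δ))
    (hθ : ∀ g x, θ (g • x) = φ g • θ x)
    (f : A →ₗ[k] B) (hf : ∀ g a, f (A.ρ g a) = B.ρ (φ g) (f a)) :
    Chains A m →ₗ[k] Chains B n :=
  Representation.Coinvariants.lift _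
    (Representation.Coinvariants.mk _ ∘ₗ
      TensorProduct.map (MonoidAlgebra.mapDomainLinearMap k k θ) f)
    fun g => by
      refine TensorProduct.ext (MonoidAlgebra.lhom_ext' fun x => ?_)
      ext a
      have := Chains.mk_smul (A := B) (φ g) (θ x) (f a)
      simpa [Chains.mk, hθ, hf] using this

lemma Chains.map_mk {m n : ℕ} (φ : Γ →* Δ) (θ : (Fin (m + 1) → Γ) → (Fin (n + 1) → Δ))
    (hθ : ∀ g x, θ (g • x) = φ g • θ x)
    (f : A →ₗ[k] B) (hf : ∀ g a, f (A.ρ g a) = B.ρ (φ g) (f a)) (x : Fin (m + 1) → Γ) (a : A) :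
    Chains.map φ θ hθ f hf (Chains.mk A x a) = Chains.mk B (θ x) (f a) := by
  simp [Chains.map, Chains.mk]

variable (A) in
/-- The map `(x ⊗ a) ↦ (x ∘ α) ⊗ a` for a map `α` of indices. -/
def Chains.reindex {m n : ℕ} (α : Fin (n + 1) → Fin (m + 1)) : Chains A m →ₗ[k] Chains A n :=
  Chains.map (MonoidHom.id Γ) (fun x => x ∘ α) (fun _ _ => rfl) LinearMap.id (fun _ _ => rfl)

lemma Chains.reindex_mk {m n : ℕ} (α : Fin (n + 1) → Fin (m + 1)) (x : Fin (m + 1) → Γ) (a : A) :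
    Chains.reindex A α (Chains.mk A x a) = Chains.mk A (x ∘ α) a :=
  Chains.map_mk (MonoidHom.id Γ) (fun x => x ∘ α) (fun _ _ => rfl)
    (LinearMap.id : A →ₗ[k] A) (fun _ _ => rfl) x a

lemma Chains.reindex_id (n : ℕ) : Chains.reindex A (id : Fin (n + 1) → Fin (n + 1)) = LinearMap.id :=
  Chains.lhom_ext fun x a => Chains.reindex_mk _ x a

lemma Chains.reindex_comp {l m n : ℕ} (α : Fin (m + 1) → Fin (l + 1))
    (β : Fin (n + 1) → Fin (m + 1)) :
    Chains.reindex A (α ∘ β) = Chains.reindex A β ∘ₗ Chains.reindex A α :=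
  Chains.lhom_ext fun x a => by
    rw [LinearMap.comp_apply, Chains.reindex_mk, Chains.reindex_mk, Chains.reindex_mk]
    rfl

/-! ### The complex `F_*(Γ) ⊗_Γ A` and group homology -/

variable (A)

/-- The simplicial module with `n`-simplices `F_n(Γ) ⊗_Γ A`; its `i`-th face map omits the `i`-th
entry of a tuple. -/
def chainsSimplicial : SimplicialObject (ModuleCat.{max w u v} k) where
  obj n := ModuleCat.of k (Chains A n.unop.len)
  map α := ModuleCat.ofHom <| Chains.reindex A α.unop.toOrderHom
  map_id n := ModuleCat.hom_ext <| Chains.reindex_id n.unop.len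
  map_comp α β := ModuleCat.hom_ext <|
    Chains.reindex_comp α.unop.toOrderHom β.unop.toOrderHom

/-- The chain complex `F_*(Γ) ⊗_Γ A`, with the differential given on generators by
`d ((x₀, …, xₙ) ⊗ a) = ∑ i, (-1) ^ i (x₀, …, x̂ᵢ, …, xₙ) ⊗ a`. -/
def chainsComplex : ChainComplex (ModuleCat.{max w u v} k) ℕ :=
  (AlgebraicTopology.alternatingFaceMapComplex _).obj (chainsSimplicial A)

lemma chainsComplex_d_mk (n : ℕ) (x : Fin (n + 2) → Γ) (a : A) :
    ((chainsComplex A).d (n + 1) n).hom (Chains.mk A x a) =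
      ∑ i : Fin (n + 2), (-1 : ℤ) ^ (i : ℕ) • Chains.mk A (x ∘ i.succAbove) a := by
  let D : Chains A (n + 1) →ₗ[k] Chains A n := ((chainsComplex A).d (n + 1) n).hom
  have h : D = ∑ i : Fin (n + 2), (-1 : ℤ) ^ (i : ℕ) • Chains.reindex A i.succAbove :=
    (congrArg ModuleCat.Hom.hom
      (AlgebraicTopology.alternatingFaceMapComplex_obj_d (chainsSimplicial A) n)).trans
      ((ModuleCat.hom_sum _ _).trans (Finset.sum_congr rfl fun i _ => ModuleCat.hom_zsmul _ _))
  change D (Chains.mk A x a) = _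
  rw [h, LinearMap.sum_apply]
  refine Finset.sum_congr rfl fun i _ => ?_
  rw [LinearMap.smul_apply, Chains.reindex_mk]

/-- The group homology `H_n(Γ; A)`. -/
def groupHomology (n : ℕ) : ModuleCat.{max w u v} k :=
  (chainsComplex A).homology n

/-! ### Relative chains and relative group homology -/

variable (S : Subgroup Γ) (T : Subgroup Δ) (U : Subgroup Λ)

/-- The image of `F_n(S) ⊗_S A` in `F_n(Γ) ⊗_Γ A`. -/
def subgroupChains (n : ℕ) : Submodule k (Chains A n) :=
  LinearMap.range (Chains.map (A := Rep.res S.subtype A) (B := A) S.subtype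
    (fun x : Fin (n + 1) → S => S.subtype ∘ x) (fun _ _ => rfl) LinearMap.id (fun _ _ => rfl))

variable {A S T U}

lemma mk_mem_subgroupChains {n : ℕ} {x : Fin (n + 1) → Γ} (hx : ∀ i, x i ∈ S) (a : A) :
    Chains.mk A x a ∈ subgroupChains A S n :=
  ⟨Chains.mk (Rep.res S.subtype A) (fun i => (⟨x i, hx i⟩ : S)) a, Chains.map_mk ..⟩

lemma subgroupChains_le_comap {m n : ℕ} (F : Chains A m →ₗ[k] Chains B n)
    (hF : ∀ (x : Fin (m + 1) → Γ) (a : A), (∀ i, x i ∈ S) →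
      F (Chains.mk A x a) ∈ subgroupChains B T n) :
    subgroupChains A S m ≤ (subgroupChains B T n).comap F := by
  let G : Chains (Rep.res S.subtype A) m →ₗ[k] Chains A m :=
    Chains.map (A := Rep.res S.subtype A) (B := A) S.subtype
      (fun x : Fin (m + 1) → S => S.subtype ∘ x) (fun _ _ => rfl) LinearMap.id (fun _ _ => rfl)
  have hG : ∀ x a, G (Chains.mk _ x a) = Chains.mk A (S.subtype ∘ x) a := fun x a =>
    Chains.map_mk (A := Rep.res S.subtype A) (B := A) S.subtype
      (fun x : Fin (m + 1) → S => S.subtype ∘ x) (fun _ _ => rfl) LinearMap.id (fun _ _ => rfl) x a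
  have key : ((subgroupChains B T n).mkQ ∘ₗ F) ∘ₗ G = 0 := by
    refine Chains.lhom_ext fun x a => ?_
    rw [LinearMap.comp_apply, LinearMap.comp_apply, hG]
    exact (Submodule.Quotient.mk_eq_zero _).2 (hF _ _ fun i => (x i).2)
  rintro _ ⟨y, rfl⟩
  exact (Submodule.Quotient.mk_eq_zero (subgroupChains B T n)).1 (LinearMap.congr_fun key y)

variable (A S)

/-- The quotient `(F_n(Γ) ⊗_Γ A) / (F_n(S) ⊗_S A)`. -/
abbrev RelChains (n : ℕ) : Type (max w u v) := Chains A n ⧸ subgroupChains A S n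

/-- The class of the generator `(x₀, …, xₙ) ⊗ a` in the relative chains. -/
def RelChains.mk {n : ℕ} (x : Fin (n + 1) → Γ) (a : A) : RelChains A S n :=
  Submodule.Quotient.mk (Chains.mk A x a)

variable {A S}

lemma RelChains.mk_smul {n : ℕ} (g : Γ) (x : Fin (n + 1) → Γ) (a : A) :
    RelChains.mk A S (g • x) (A.ρ g a) = RelChains.mk A S x a :=
  congrArg Submodule.Quotient.mk (Chains.mk_smul g x a)

lemma RelChains.lhom_ext {n : ℕ} {N : Type*} [AddCommGroup N] [Module k N]
    {f g : RelChains A S n →ₗ[k] N}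
    (h : ∀ x a, f (RelChains.mk A S x a) = g (RelChains.mk A S x a)) : f = g :=
  Submodule.linearMap_qext _ (Chains.lhom_ext h)

/-- The map induced by `Chains.map` on relative chains, when `θ` sends tuples in `S` to tuples in
`T`. -/
def RelChains.map {m n : ℕ} (φ : Γ →* Δ) (θ : (Fin (m + 1) → Γ) → (Fin (n + 1) → Δ))
    (hθ : ∀ g x, θ (g • x) = φ g • θ x)
    (f : A →ₗ[k] B) (hf : ∀ g a, f (A.ρ g a) = B.ρ (φ g) (f a))
    (hS : ∀ x, (∀ i, x i ∈ S) → ∀ i, θ x i ∈ T) :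
    RelChains A S m →ₗ[k] RelChains B T n :=
  Submodule.mapQ _ _ (Chains.map φ θ hθ f hf) <| subgroupChains_le_comap _ fun x a hx => by
    rw [Chains.map_mk]
    exact mk_mem_subgroupChains (hS x hx) _

lemma RelChains.map_mk {m n : ℕ} (φ : Γ →* Δ) (θ : (Fin (m + 1) → Γ) → (Fin (n + 1) → Δ))
    (hθ : ∀ g x, θ (g • x) = φ g • θ x)
    (f : A →ₗ[k] B) (hf : ∀ g a, f (A.ρ g a) = B.ρ (φ g) (f a))
    (hS : ∀ x, (∀ i, x i ∈ S) → ∀ i, θ x i ∈ T) (x : Fin (m + 1) → Γ) (a : A) :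
    RelChains.map φ θ hθ f hf hS (RelChains.mk A S x a) = RelChains.mk B T (θ x) (f a) :=
  congrArg Submodule.Quotient.mk (Chains.map_mk φ θ hθ f hf x a)

variable (A S) in
/-- The map `(x ⊗ a) ↦ (x ∘ α) ⊗ a` on relative chains for a map `α` of indices. -/
def RelChains.reindex {m n : ℕ} (α : Fin (n + 1) → Fin (m + 1)) :
    RelChains A S m →ₗ[k] RelChains A S n :=
  RelChains.map (MonoidHom.id Γ) (fun x => x ∘ α) (fun _ _ => rfl) LinearMap.id (fun _ _ => rfl)
    (fun _ hx _ => hx _)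

lemma RelChains.reindex_mk {m n : ℕ} (α : Fin (n + 1) → Fin (m + 1)) (x : Fin (m + 1) → Γ)
    (a : A) : RelChains.reindex A S α (RelChains.mk A S x a) = RelChains.mk A S (x ∘ α) a :=
  RelChains.map_mk (S := S) (T := S) (MonoidHom.id Γ) (fun x => x ∘ α) (fun _ _ => rfl)
    (LinearMap.id : A →ₗ[k] A) (fun _ _ => rfl) (fun _ hx _ => hx _) x a

lemma RelChains.reindex_id (n : ℕ) :
    RelChains.reindex A S (id : Fin (n + 1) → Fin (n + 1)) = LinearMap.id :=
  RelChains.lhom_ext fun x a => RelChains.reindex_mk _ x a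

lemma RelChains.reindex_comp {l m n : ℕ} (α : Fin (m + 1) → Fin (l + 1))
    (β : Fin (n + 1) → Fin (m + 1)) :
    RelChains.reindex A S (α ∘ β) = RelChains.reindex A S β ∘ₗ RelChains.reindex A S α :=
  RelChains.lhom_ext fun x a => by
    rw [LinearMap.comp_apply, RelChains.reindex_mk, RelChains.reindex_mk, RelChains.reindex_mk]
    rfl

variable (A S)

/-- The simplicial module with `n`-simplices `(F_n(Γ) ⊗_Γ A) / (F_n(S) ⊗_S A)`. -/
def relSimplicial : SimplicialObject (ModuleCat.{max w u v} k) where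
  obj n := ModuleCat.of k (RelChains A S n.unop.len)
  map α := ModuleCat.ofHom <| RelChains.reindex A S α.unop.toOrderHom
  map_id n := ModuleCat.hom_ext <| RelChains.reindex_id n.unop.len
  map_comp α β := ModuleCat.hom_ext <|
    RelChains.reindex_comp α.unop.toOrderHom β.unop.toOrderHom

/-- The quotient complex `(F_*(Γ) ⊗_Γ A) / (F_*(S) ⊗_S A)`. -/
def relComplex : ChainComplex (ModuleCat.{max w u v} k) ℕ :=
  (AlgebraicTopology.alternatingFaceMapComplex _).obj (relSimplicial A S)

/-- The differential of the quotient complex is induced by that of `F_*(Γ) ⊗_Γ A`. -/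
lemma relComplex_d_quotientMk (n : ℕ) (c : Chains A (n + 1)) :
    ((relComplex A S).d (n + 1) n).hom (Submodule.Quotient.mk c : RelChains A S (n + 1)) =
      (Submodule.Quotient.mk (((chainsComplex A).d (n + 1) n).hom c : Chains A n) :
        RelChains A S n) := by
  let D : RelChains A S (n + 1) →ₗ[k] RelChains A S n := ((relComplex A S).d (n + 1) n).hom
  have h₀ : D = ∑ i : Fin (n + 2), (-1 : ℤ) ^ (i : ℕ) • RelChains.reindex A S i.succAbove :=
    (congrArg ModuleCat.Hom.hom
      (AlgebraicTopology.alternatingFaceMapComplex_obj_d (relSimplicial A S) n)).trans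
      ((ModuleCat.hom_sum _ _).trans (Finset.sum_congr rfl fun i _ => ModuleCat.hom_zsmul _ _))
  let D' : Chains A (n + 1) →ₗ[k] Chains A n := ((chainsComplex A).d (n + 1) n).hom
  have h : D ∘ₗ (subgroupChains A S (n + 1)).mkQ = (subgroupChains A S n).mkQ ∘ₗ D' := by
    refine Chains.lhom_ext fun x a => ?_
    have hD' : D' (Chains.mk A x a) = ∑ i : Fin (n + 2), (-1 : ℤ) ^ (i : ℕ) •
        Chains.mk A (x ∘ i.succAbove) a := chainsComplex_d_mk A n x a
    rw [LinearMap.comp_apply, LinearMap.comp_apply, hD', map_sum, h₀, LinearMap.sum_apply]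
    refine Finset.sum_congr rfl fun i _ => ?_
    rw [LinearMap.smul_apply, map_zsmul]
    exact congrArg (((-1 : ℤ) ^ (i : ℕ)) • ·) (RelChains.reindex_mk i.succAbove x a)
  exact LinearMap.congr_fun h c

/-- The relative group homology `H_n(Γ, S; A)`. -/
def relHomology (n : ℕ) : ModuleCat.{max w u v} k :=
  (relComplex A S).homology n

variable {A S}

/-- The map `(x₀, …, xₙ) ⊗ a ↦ (φ x₀, …, φ xₙ) ⊗ f a` on relative chains, for a homomorphism `φ`
with `φ(S) ⊆ T` and a `φ`-equivariant map `f` of coefficients. -/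
def RelChains.push (φ : Γ →* Δ) (f : A →ₗ[k] B) (hf : ∀ g a, f (A.ρ g a) = B.ρ (φ g) (f a))
    (hS : ∀ x ∈ S, φ x ∈ T) (n : ℕ) : RelChains A S n →ₗ[k] RelChains B T n :=
  RelChains.map φ (fun x => φ ∘ x) (fun g x => funext fun i => map_mul φ g (x i)) f hf
    (fun _ hx i => hS _ (hx i))

lemma RelChains.push_mk (φ : Γ →* Δ) (f : A →ₗ[k] B) (hf : ∀ g a, f (A.ρ g a) = B.ρ (φ g) (f a))
    (hS : ∀ x ∈ S, φ x ∈ T) (n : ℕ) (x : Fin (n + 1) → Γ) (a : A) :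
    RelChains.push φ f hf hS n (RelChains.mk A S x a) = RelChains.mk B T (φ ∘ x) (f a) :=
  RelChains.map_mk φ (fun x => φ ∘ x) (fun g x => funext fun i => map_mul φ g (x i)) f hf
    (fun _ hx i => hS _ (hx i)) x a

lemma RelChains.push_comp_reindex (φ : Γ →* Δ) (f : A →ₗ[k] B)
    (hf : ∀ g a, f (A.ρ g a) = B.ρ (φ g) (f a)) (hS : ∀ x ∈ S, φ x ∈ T) {m n : ℕ}
    (α : Fin (n + 1) → Fin (m + 1)) :
    RelChains.push φ f hf hS n ∘ₗ RelChains.reindex A S α =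
      RelChains.reindex B T α ∘ₗ RelChains.push φ f hf hS m :=
  RelChains.lhom_ext fun x a => by
    rw [LinearMap.comp_apply, LinearMap.comp_apply, RelChains.reindex_mk, RelChains.push_mk,
      RelChains.push_mk, RelChains.reindex_mk]
    rfl

/-- The map of simplicial modules given by `RelChains.push`. -/
def relSimplicialMap (φ : Γ →* Δ) (f : A →ₗ[k] B) (hf : ∀ g a, f (A.ρ g a) = B.ρ (φ g) (f a))
    (hS : ∀ x ∈ S, φ x ∈ T) : relSimplicial A S ⟶ relSimplicial B T where
  app n := ModuleCat.ofHom <| RelChains.push φ f hf hS n.unop.len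
  naturality _ _ α := ModuleCat.hom_ext <|
    RelChains.push_comp_reindex φ f hf hS α.unop.toOrderHom

/-- The induced map `H_n(Γ, S; A) → H_n(Δ, T; B)` in relative group homology. -/
def relHomologyMap (φ : Γ →* Δ) (f : A →ₗ[k] B)
    (hf : ∀ g a, f (A.ρ g a) = B.ρ (φ g) (f a)) (hS : ∀ x ∈ S, φ x ∈ T) (n : ℕ) :
    relHomology A S n ⟶ relHomology B T n :=
  HomologicalComplex.homologyMap
    ((AlgebraicTopology.alternatingFaceMapComplex _).map (relSimplicialMap φ f hf hS)) n

lemma relHomologyMap_eq_id {φ : Γ →* Γ} {f : A →ₗ[k] A} (hφ : φ = MonoidHom.id Γ)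
    (hid : f = LinearMap.id) (hf : ∀ g a, f (A.ρ g a) = A.ρ (φ g) (f a))
    (hS : ∀ x ∈ S, φ x ∈ S) (n : ℕ) :
    relHomologyMap (S := S) (T := S) φ f hf hS n = 𝟙 _ := by
  subst hφ hid
  have : relSimplicialMap (S := S) (T := S) (MonoidHom.id Γ) LinearMap.id hf hS = 𝟙 _ := by
    have key (m : ℕ) : RelChains.push (S := S) (T := S) (MonoidHom.id Γ) LinearMap.id hf hS m =
        LinearMap.id :=
      RelChains.lhom_ext fun x a => RelChains.push_mk _ _ _ _ _ x a
    exact NatTrans.ext <| funext fun n => ModuleCat.hom_ext (key n.unop.len)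
  rw [relHomologyMap, this, CategoryTheory.Functor.map_id]
  exact HomologicalComplex.homologyMap_id _ _

lemma relHomologyMap_comp (φ : Γ →* Δ) (f : A →ₗ[k] B)
    (hf : ∀ g a, f (A.ρ g a) = B.ρ (φ g) (f a)) (hS : ∀ x ∈ S, φ x ∈ T)
    (ψ : Δ →* Λ) (f' : B →ₗ[k] C)
    (hf' : ∀ g a, f' (B.ρ g a) = C.ρ (ψ g) (f' a)) (hT : ∀ x ∈ T, ψ x ∈ U)
    {χ : Γ →* Λ} {f'' : A →ₗ[k] C} (hχ : χ = ψ.comp φ) (hc : f'' = f' ∘ₗ f)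
    (hf'' : ∀ g a, f'' (A.ρ g a) = C.ρ (χ g) (f'' a)) (hU : ∀ x ∈ S, χ x ∈ U) (n : ℕ) :
    relHomologyMap (S := S) (T := U) χ f'' hf'' hU n =
      relHomologyMap φ f hf hS n ≫ relHomologyMap ψ f' hf' hT n := by
  subst hχ hc
  have : relSimplicialMap (S := S) (T := U) (ψ.comp φ) (f' ∘ₗ f) hf'' hU =
      relSimplicialMap φ f hf hS ≫ relSimplicialMap ψ f' hf' hT := by
    have key (m : ℕ) : RelChains.push (S := S) (T := U) (ψ.comp φ) (f' ∘ₗ f) hf'' hU m =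
        RelChains.push ψ f' hf' hT m ∘ₗ RelChains.push φ f hf hS m :=
      RelChains.lhom_ext fun x a => by
        rw [LinearMap.comp_apply, RelChains.push_mk, RelChains.push_mk, RelChains.push_mk]
        rfl
    exact NatTrans.ext <| funext fun n => ModuleCat.hom_ext (key n.unop.len)
  rw [relHomologyMap, this, CategoryTheory.Functor.map_comp]
  exact HomologicalComplex.homologyMap_comp _ _ _

lemma val_predAbove {n : ℕ} (i : Fin n) (j : Fin (n + 1)) :
    (i.predAbove j : ℕ) = if (i : ℕ) < j then (j : ℕ) - 1 else j := by
  simp only [Fin.predAbove, Fin.lt_def, Fin.val_castSucc]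
  split_ifs <;> rfl

lemma val_succAbove {n : ℕ} (i : Fin (n + 1)) (j : Fin n) :
    (i.succAbove j : ℕ) = if (j : ℕ) < i then (j : ℕ) else j + 1 := by
  simp only [Fin.succAbove, Fin.lt_def, Fin.val_castSucc]
  split_ifs <;> rfl

/-- The tuple `(x₀, …, xᵢ, xᵢ c, …, xₙ c)`. -/
def prism {n : ℕ} (c : Γ) (i : Fin (n + 1)) (x : Fin (n + 1) → Γ) : Fin (n + 2) → Γ :=
  fun j => x (i.predAbove j) * if j ≤ i.castSucc then 1 else c

/-- The prism operator on relative chains. -/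
def prismMap (A : Rep.{v} k Γ) {c : Γ} (hc : c ∈ S) {n : ℕ} (i : Fin (n + 1)) :
    RelChains A S n →ₗ[k] RelChains A S (n + 1) :=
  RelChains.map (MonoidHom.id Γ) (prism c i) (fun _ _ => funext fun _ => mul_assoc _ _ _)
    LinearMap.id (fun _ _ => rfl) (fun x hx j => by
      unfold prism
      split_ifs
      · exact S.mul_mem (hx _) S.one_mem
      · exact S.mul_mem (hx _) hc)

lemma prismMap_mk {c : Γ} (hc : c ∈ S) {n : ℕ} (i : Fin (n + 1)) (x : Fin (n + 1) → Γ) (a : A) :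
    prismMap A hc i (RelChains.mk A S x a) = RelChains.mk A S (prism c i x) a :=
  RelChains.map_mk ..

lemma reindex_comp_prismMap {c : Γ} (hc : c ∈ S) {m n : ℕ} (i : Fin (m + 1)) (j : Fin (n + 1))
    (α : Fin (n + 2) → Fin (m + 2)) (β : Fin (n + 1) → Fin (m + 1))
    (h : ∀ t, i.predAbove (α t) = β (j.predAbove t) ∧ (α t ≤ i.castSucc ↔ t ≤ j.castSucc)) :
    RelChains.reindex A S α ∘ₗ prismMap A hc i = prismMap A hc j ∘ₗ RelChains.reindex A S β :=
  RelChains.lhom_ext fun x a => by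
    rw [LinearMap.comp_apply, LinearMap.comp_apply, RelChains.reindex_mk, prismMap_mk,
      RelChains.reindex_mk, prismMap_mk]
    congr 1
    funext t
    simp only [prism, Function.comp_apply, (h t).1, (h t).2]

/-- Conjugation by `c⁻¹`, for `c ∈ S`, induces on relative chains a map homotopic to the
identity. -/
def prismHomotopy (A : Rep.{v} k Γ) {c : Γ} (hc : c ∈ S)
    (hf : ∀ g a, A.ρ c⁻¹ (A.ρ g a) = A.ρ ((MulAut.conj c⁻¹).toMonoidHom g) (A.ρ c⁻¹ a))
    (hS : ∀ x ∈ S, (MulAut.conj c⁻¹).toMonoidHom x ∈ S) :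
    SimplicialObject.Homotopy (𝟙 (relSimplicial A S))
      (relSimplicialMap (MulAut.conj c⁻¹).toMonoidHom (A.ρ c⁻¹) hf hS) where
  h i := ModuleCat.ofHom (prismMap A hc i)
  h_zero_comp_δ_zero n := ModuleCat.hom_ext <| show
      RelChains.reindex A S (Fin.succAbove 0) ∘ₗ prismMap A hc (0 : Fin (n + 1)) =
        RelChains.push (MulAut.conj c⁻¹).toMonoidHom (A.ρ c⁻¹) hf hS n from
    RelChains.lhom_ext fun x a => by
      rw [LinearMap.comp_apply, prismMap_mk, RelChains.reindex_mk, RelChains.push_mk,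
        ← RelChains.mk_smul c⁻¹ _ a]
      congr 1
      funext t
      simp [prism, mul_assoc]
  h_last_comp_δ_last n := ModuleCat.hom_ext <| show
      RelChains.reindex A S (Fin.succAbove (Fin.last (n + 1))) ∘ₗ prismMap A hc (Fin.last n) =
        LinearMap.id from
    RelChains.lhom_ext fun x a => by
      rw [LinearMap.comp_apply, prismMap_mk, RelChains.reindex_mk, LinearMap.id_apply]
      congr 1
      funext t
      simp [prism, Fin.le_last]
  h_succ_comp_δ_castSucc_of_lt {n} i j hij := ModuleCat.hom_ext <| show
      RelChains.reindex A S (Fin.succAbove i.castSucc) ∘ₗ prismMap A hc j.succ =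
        prismMap A hc j ∘ₗ RelChains.reindex A S (Fin.succAbove i) from
    reindex_comp_prismMap hc _ _ _ _ fun t => by
      simp only [Fin.le_def, Fin.val_castSucc] at hij
      simp only [Fin.ext_iff, Fin.le_def, val_predAbove, val_succAbove, Fin.val_castSucc,
        Fin.val_succ]
      constructor <;> split_ifs <;> omega
  h_succ_comp_δ_castSucc_succ {n} j := ModuleCat.hom_ext <| show
      RelChains.reindex A S (Fin.succAbove j.castSucc.succ) ∘ₗ prismMap A hc j.succ =
        RelChains.reindex A S (Fin.succAbove j.castSucc.succ) ∘ₗ prismMap A hc j.castSucc from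
    RelChains.lhom_ext fun x a => by
      rw [LinearMap.comp_apply, LinearMap.comp_apply, prismMap_mk, RelChains.reindex_mk,
        prismMap_mk, RelChains.reindex_mk]
      congr 1
      funext t
      have h : j.succ.predAbove (j.castSucc.succ.succAbove t) =
            j.castSucc.predAbove (j.castSucc.succ.succAbove t) ∧
          (j.castSucc.succ.succAbove t ≤ j.succ.castSucc ↔
            j.castSucc.succ.succAbove t ≤ j.castSucc.castSucc) := by
        simp only [Fin.ext_iff, Fin.le_def, val_predAbove, val_succAbove, Fin.val_castSucc,
          Fin.val_succ]
        constructor <;> split_ifs <;> omega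
      simp only [prism, Function.comp_apply, h.1, h.2]
  h_castSucc_comp_δ_succ_of_lt {n} i j hji := ModuleCat.hom_ext <| show
      RelChains.reindex A S (Fin.succAbove i.succ) ∘ₗ prismMap A hc j.castSucc =
        prismMap A hc j ∘ₗ RelChains.reindex A S (Fin.succAbove i) from
    reindex_comp_prismMap hc _ _ _ _ fun t => by
      simp only [Fin.lt_def, Fin.val_castSucc] at hji
      simp only [Fin.ext_iff, Fin.le_def, val_predAbove, val_succAbove, Fin.val_castSucc,
        Fin.val_succ]
      constructor <;> split_ifs <;> omega
  h_comp_σ_castSucc_of_le {n} i j hij := ModuleCat.hom_ext <| show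
      RelChains.reindex A S (Fin.predAbove i.castSucc) ∘ₗ prismMap A hc j =
        prismMap A hc j.succ ∘ₗ RelChains.reindex A S (Fin.predAbove i) from
    reindex_comp_prismMap hc _ _ _ _ fun t => by
      simp only [Fin.le_def] at hij
      simp only [Fin.ext_iff, Fin.le_def, val_predAbove, Fin.val_castSucc, Fin.val_succ]
      constructor <;> split_ifs <;> omega
  h_comp_σ_succ_of_lt {n} i j hji := ModuleCat.hom_ext <| show
      RelChains.reindex A S (Fin.predAbove i.succ) ∘ₗ prismMap A hc j =
        prismMap A hc j.castSucc ∘ₗ RelChains.reindex A S (Fin.predAbove i) from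
    reindex_comp_prismMap hc _ _ _ _ fun t => by
      simp only [Fin.le_def] at hji
      simp only [Fin.ext_iff, Fin.le_def, val_predAbove, Fin.val_castSucc, Fin.val_succ]
      constructor <;> split_ifs <;> omega

lemma relHomologyMap_conj_eq_id (A : Rep.{v} k Γ) {s : Γ} (hs : s ∈ S)
    {φ : Γ →* Γ} (hφ : φ = (MulAut.conj s).toMonoidHom) {f : A →ₗ[k] A} (hs' : f = A.ρ s)
    (hf : ∀ g a, f (A.ρ g a) = A.ρ (φ g) (f a)) (hS : ∀ x ∈ S, φ x ∈ S) (n : ℕ) :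
    relHomologyMap (S := S) (T := S) φ f hf hS n = 𝟙 _ := by
  obtain ⟨c, rfl⟩ : ∃ c, s = c⁻¹ := ⟨s⁻¹, (inv_inv s).symm⟩
  subst hφ hs'
  have h := (prismHomotopy A (inv_mem_iff.1 hs) hf hS).map_homology_eq n
  rw [CategoryTheory.Functor.map_id, CategoryTheory.Functor.map_id] at h
  exact h.symm

end Chains

/-! ### The action of `G / H` on `H_n(H, H'; M)` -/

section QuotientAction

variable {k : Type w} [CommRing k] {G : Type u} [Group G] (H G' : Subgroup G) [H.Normal]

/-- The homomorphism `G' / H' → G / H`, where `H' = H ∩ G'`, induced by the inclusion of `G'` into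
`G`. -/
def quotientComparison : G' ⧸ H.subgroupOf G' →* G ⧸ H :=
  QuotientGroup.map (H.subgroupOf G') H G'.subtype le_rfl

variable (M : Rep.{v} k G)

/-- `H_n(H, H'; M)`, where `H' = H ∩ G'`. -/
abbrev relHomologyOfNormal (n : ℕ) : ModuleCat.{max w u v} k :=
  relHomology (Rep.res H.subtype M) (G'.subgroupOf H) n

/-- The endomorphism of `H_n(H, H'; M)` induced by `x ↦ g x g⁻¹` on `H` and `m ↦ g m` on `M`, for
`g ∈ G'`. -/
def conjMap (n : ℕ) (g : G') : relHomologyOfNormal H G' M n ⟶ relHomologyOfNormal H G' M n :=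
  relHomologyMap (MulAut.conjNormal (g : G)).toMonoidHom (M.ρ g)
    (fun h m => by
      change M.ρ g (M.ρ h m) = M.ρ (MulAut.conjNormal (g : G) h : H) (M.ρ g m)
      rw [MulAut.conjNormal_apply, ← Module.End.mul_apply, ← Module.End.mul_apply, ← map_mul,
        ← map_mul]
      congr 2
      group)
    (fun x hx => by
      rw [Subgroup.mem_subgroupOf] at hx ⊢
      exact G'.mul_mem (G'.mul_mem g.2 hx) (G'.inv_mem g.2)) n

/-- The conjugation action of `G'` on `H_n(H, H'; M)`. -/
def conjRepresentation (n : ℕ) : Representation k G' (relHomologyOfNormal H G' M n) where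
  toFun g := (conjMap H G' M n g).hom
  map_one' := congrArg ModuleCat.Hom.hom <|
    relHomologyMap_eq_id (by ext; simp) (by ext; simp) _ _ n
  map_mul' g g' := congrArg ModuleCat.Hom.hom <|
    relHomologyMap_comp _ _ _ _ _ _ _ _ (by ext; simp) (by ext; simp) _ _ n

instance (n : ℕ) : Representation.IsTrivial
    ((conjRepresentation H G' M n).comp (H.subgroupOf G').subtype) where
  out h := congrArg ModuleCat.Hom.hom <|
    relHomologyMap_conj_eq_id (Rep.res H.subtype M) (S := G'.subgroupOf H)
      (s := ⟨(h : G'), h.2⟩) (h : G').2 (by ext; simp) rfl _ _ n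

variable {H G'} in
/-- `H_n(H, H'; M)` as a module over `Q = G / H`, when `G' / H' → G / H` is an isomorphism: the
class of `g ∈ G'` acts by conjugation by `g`. -/
def relHomologyRep (hQ : Function.Bijective (quotientComparison H G')) (n : ℕ) :
    Rep.{max w u v} k (G ⧸ H) :=
  Rep.res (MulEquiv.ofBijective _ hQ).symm.toMonoidHom
    (Rep.of ((conjRepresentation H G' M n).ofQuotient (H.subgroupOf G')))

lemma relHomologyRep_apply (hQ : Function.Bijective (quotientComparison H G')) (n : ℕ) (g : G')
    (x : relHomologyOfNormal H G' M n) :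
    (relHomologyRep M hQ n).ρ ((g : G) : G ⧸ H) x = (conjMap H G' M n g).hom x := by
  have : (MulEquiv.ofBijective _ hQ).symm ((g : G) : G ⧸ H) = (g : G' ⧸ H.subgroupOf G') := by
    rw [MulEquiv.symm_apply_eq]
    rfl
  change (conjRepresentation H G' M n).ofQuotient (H.subgroupOf G')
    ((MulEquiv.ofBijective _ hQ).symm ((g : G) : G ⧸ H)) x = _
  rw [this]
  rfl

end QuotientAction

/-- The tensor product over `k` of two `k`-linear representations, with the diagonal action. -/
def tensorRep {k : Type w} [CommRing k] {Q : Type u} [Group Q] (N : Rep.{v} k Q)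
    (M : Rep.{v'} k Q) : Rep.{max v v'} k Q :=
  Rep.of (N.ρ.tprod M.ρ)

/-- The `G / H`-module structure on a `G`-module on which `H` acts trivially: the class of `g` acts
as `g`. -/
def quotientRep {k : Type w} [CommRing k] {G : Type u} [Group G] {H : Subgroup G} [H.Normal]
    (M : Rep.{v} k G) (hM : ∀ h ∈ H, ∀ m : M, M.ρ h m = m) : Rep.{v} k (G ⧸ H) :=
  have : Representation.IsTrivial (M.ρ.comp H.subtype) := ⟨fun h => LinearMap.ext (hM h h.2)⟩
  Rep.of (M.ρ.ofQuotient H)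

/-! ### Convergence of first quadrant homological spectral sequences -/

/-- A first quadrant homological spectral sequence starting with the second page: the differential
of the `r`-th page goes from `E^r_{p,q}` to `E^r_{p-r,q+r-1}`. -/
abbrev E₂HomologicalSpectralSequence (k : Type w) [CommRing k] :=
  SpectralSequence (ModuleCat.{v} k)
    (fun r : ℤ => ComplexShape.spectralSequenceNat (⟨-r, r - 1⟩ : ℤ × ℤ)) 2

section Convergence

variable {k : Type w} [CommRing k]

/-- The term `E^∞_{p,q}`: for `r > p` and `r > q + 1` no differential of the `r`-th page enters or
leaves the position `(p, q)`, hence `E^∞_{p,q} = E^r_{p,q}` for all these `r`. We take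
`r = p + q + 2`. -/
def pageInfinity (E : E₂HomologicalSpectralSequence.{w, v} k) (p q : ℕ) : ModuleCat.{v} k :=
  (E.page ((p : ℤ) + q + 2) (by omega)).X (p, q)

/-- `E^2_{p,q} ⇒ A_{p+q}`: every `A_n` has a filtration `0 = F₋₁ ≤ F₀ ≤ … ≤ F_n = A_n`
such that `F_p / F_{p-1}` is isomorphic to `E^∞_{p,q}` whenever `p + q = n`. Below, `F i` stands for
`F_{i-1}`. -/
def ConvergesTo (E : E₂HomologicalSpectralSequence.{w, v} k) (A : ℕ → ModuleCat.{v} k) : Prop :=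
  ∀ n : ℕ, ∃ F : ℕ → Submodule k (A n), Monotone F ∧ F 0 = ⊥ ∧ F (n + 1) = ⊤ ∧
    ∀ p q : ℕ, p + q = n →
      Nonempty ((F (p + 1) ⧸ (F p).submoduleOf (F (p + 1))) ≃ₗ[k] pageInfinity E p q)

end Convergence

end RelativeLHS
end

/-!
The spectral sequence is that of a first quadrant double complex `F_p(Q) ⊗_Q D_q`, where `Q = G / H`
and `D` is a complex of `Q`-modules with homology `H_q(H, H'; M)`.

*The complex.* `D_q` (`NormalChains`) is the quotient of the coinvariants `F_q(G) ⊗_H M` by the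
generators `(x₀, …, x_q) ⊗ m` whose tuple lies in a left coset of `G'`. In contrast to the relative
chains of `(H, H')`, it carries an action of all of `G`, trivial on `H`. The coinvariants of `D_q`
under `Q` are the relative chains of `(G, G')`.

*The rows.* The coset `[x₀] ∈ Q` of a generator `x ⊗ m` is unchanged by the relations in `D_q` and
compatible with the actions of `Q`, so that `y ⊗ (x ⊗ m) ↦ ([x₀], y) ⊗ (x ⊗ m)` is a
contraction of the row `F_*(Q) ⊗_Q D_q` augmented to the relative chains of `(G, G')`
(`normalContraction`). Hence the rows are resolutions, and the total complex computes
`H_*(G, G'; M)`.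

*The columns.* The surjectivity of `G' → G / H` provides representatives `t x ∈ G'` of the cosets
`H x`, and `x ↦ x (t x)⁻¹` defines a retraction of `D` onto the relative chains of `(H, H')`.
Translating each entry of a tuple from the right by an element of `G'` depending only on its
coset modulo `H` is well defined on `D`, and a prism operator shows that it is homotopic to the
identity (`twistHomotopy`). With the elements `(t x)⁻¹` this says that the retraction is an
isomorphism in homology (`CosetTransversal.homologyIso`); with the constant element `g⁻¹ ∈ G'` it
turns the translation `x ↦ g x` into the conjugation `x ↦ g x g⁻¹`, so that this isomorphism is
`Q`-equivariant (`CosetTransversal.act_comp_homologyIso`). Since `F_p(Q) ⊗_Q -` is exact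
(`Chains.equivFinsupp`), the vertical homology of the double complex is `F_p(Q) ⊗_Q H_q(H, H'; M)`.

*The spectral sequence.* The total complex is filtered by the canonical truncations in the vertical
direction instead of by rows: then `H_p` of the row complex of vertical homologies is already the
homology of the associated graded complex, so that it appears as the first page of the spectral
sequence of the spectral object of the filtration, whose pages are numbered from `2`. The double
complexes here are handled as families of elements of all bidegrees (`Bicomplex.total`).

*Free coefficients.* If `H` acts trivially on `M` and `M` is free, a basis of `M` splits the
relative chains of `(H, H')` with coefficients in `M` into copies of those with coefficients in `k`,
which shows that `ζ ⊗ m ↦ (a ↦ a m)_* ζ` is an isomorphism `H_q(H, H'; k) ⊗ M ≅ H_q(H, H'; M)`. This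
map does not involve the choice of a basis, and is `Q`-equivariant (`normalTensor_rho`).
-/

noncomputable section

namespace RelativeLHS

/-! ### The spectral object of a filtered differential module -/

section

open Abelian ComposableArrows

section FilteredModule

/-- A differential module `T` over `k` with a filtration `Fil i m`, indexed by a preorder `ι` and
compatible with a cohomological grading `m`. -/
structure FilteredDifferentialModule (k : Type w) [CommRing k] (ι : Type*) [Preorder ι] where
  /-- The underlying module. -/
  T : Type v
  [addCommGroup : AddCommGroup T]
  [module : Module k T]
  /-- The differential. -/
  d : T →ₗ[k] T
  d_d : ∀ x, d (d x) = 0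
  /-- The elements of degree `m` in the `i`-th step of the filtration. -/
  Fil : ι → ℤ → Submodule k T
  mono : ∀ {i j} (m : ℤ), i ≤ j → Fil i m ≤ Fil j m
  d_mem : ∀ {i m n x}, m + 1 = n → x ∈ Fil i m → d x ∈ Fil i n

attribute [instance] FilteredDifferentialModule.addCommGroup FilteredDifferentialModule.module

namespace FilteredDifferentialModule

variable {k : Type w} [CommRing k] {ι : Type*} [Preorder ι]
  (𝒯 : FilteredDifferentialModule.{w, v} k ι)

/-- The relative cycles of degree `m`: the elements of `Fil j` with boundary in `Fil i`. -/
def cycles (i j : ι) (m : ℤ) : Submodule k 𝒯.T :=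
  𝒯.Fil j m ⊓ (𝒯.Fil i (m + 1)).comap 𝒯.d

/-- The relative boundaries `Fil i + d (Fil j)` of degree `m`. -/
def boundaries (i j : ι) (m : ℤ) : Submodule k 𝒯.T :=
  𝒯.Fil i m ⊔ (𝒯.Fil j (m - 1)).map 𝒯.d

variable {𝒯} in
lemma mem_boundaries {i j : ι} {m : ℤ} {x : 𝒯.T} :
    x ∈ 𝒯.boundaries i j m ↔ ∃ y ∈ 𝒯.Fil j (m - 1), x - 𝒯.d y ∈ 𝒯.Fil i m := by
  rw [boundaries, Submodule.mem_sup]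
  constructor
  · rintro ⟨a, ha, _, ⟨y, hy, rfl⟩, rfl⟩
    exact ⟨y, hy, by simpa using ha⟩
  · rintro ⟨y, hy, h⟩
    exact ⟨_, h, _, ⟨y, hy, rfl⟩, by simp⟩

variable {𝒯} in
lemma Fil_le_boundaries {i j : ι} {m : ℤ} : 𝒯.Fil i m ≤ 𝒯.boundaries i j m := le_sup_left

variable {𝒯} in
lemma d_mem_boundaries {i j : ι} {m n : ℤ} (h : m + 1 = n) {x : 𝒯.T} (hx : x ∈ 𝒯.Fil j m) :
    𝒯.d x ∈ 𝒯.boundaries i j n :=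
  Submodule.mem_sup_right ⟨x, by rwa [← h, add_sub_cancel_right], rfl⟩

/-- The cohomology in degree `m` of the quotient `Fil j / Fil i`. -/
abbrev H (i j : ι) (m : ℤ) : Type v :=
  𝒯.cycles i j m ⧸ (𝒯.boundaries i j m).comap (𝒯.cycles i j m).subtype

/-- The class of a relative cycle. -/
def H.mk {i j : ι} {m : ℤ} (x : 𝒯.T) (hx : x ∈ 𝒯.cycles i j m) : 𝒯.H i j m :=
  Submodule.Quotient.mk ⟨x, hx⟩

variable {𝒯}

lemma H.mk_surjective {i j : ι} {m : ℤ} (y : 𝒯.H i j m) : ∃ x hx, H.mk 𝒯 x hx = y := by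
  obtain ⟨⟨x, hx⟩, rfl⟩ := Submodule.Quotient.mk_surjective _ y
  exact ⟨x, hx, rfl⟩

lemma H.mk_eq_zero {i j : ι} {m : ℤ} {x : 𝒯.T} {hx : x ∈ 𝒯.cycles i j m} :
    H.mk 𝒯 x hx = 0 ↔ x ∈ 𝒯.boundaries i j m :=
  Submodule.Quotient.mk_eq_zero _

lemma H.mk_eq_mk {i j : ι} {m : ℤ} {x y : 𝒯.T} {hx : x ∈ 𝒯.cycles i j m}
    {hy : y ∈ 𝒯.cycles i j m} (h : x - y ∈ 𝒯.boundaries i j m) : H.mk 𝒯 x hx = H.mk 𝒯 y hy :=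
  (Submodule.Quotient.eq _).2 h

lemma cycles_mono {i i' j j' : ι} (hi : i ≤ i') (hj : j ≤ j') (m : ℤ) :
    𝒯.cycles i j m ≤ 𝒯.cycles i' j' m :=
  inf_le_inf (𝒯.mono m hj) (Submodule.comap_mono (𝒯.mono _ hi))

lemma boundaries_mono {i i' j j' : ι} (hi : i ≤ i') (hj : j ≤ j') (m : ℤ) :
    𝒯.boundaries i j m ≤ 𝒯.boundaries i' j' m :=
  sup_le_sup (𝒯.mono m hi) (Submodule.map_mono (𝒯.mono _ hj))

variable (𝒯)

/-- The map induced by the inclusions `Fil i ⊆ Fil i'` and `Fil j ⊆ Fil j'`. -/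
def Hmap {i i' j j' : ι} (hi : i ≤ i') (hj : j ≤ j') (m : ℤ) : 𝒯.H i j m →ₗ[k] 𝒯.H i' j' m :=
  Submodule.mapQ _ _ (Submodule.inclusion (cycles_mono hi hj m))
    fun _ hx => boundaries_mono hi hj m hx

variable {𝒯} in
lemma d_mem_cycles {i j l : ι} {m n : ℤ} (h : m + 1 = n) {x : 𝒯.T} (hx : x ∈ 𝒯.cycles j l m) :
    𝒯.d x ∈ 𝒯.cycles i j n := by
  subst h
  exact ⟨hx.2, by simp [𝒯.d_d]⟩

/-- The connecting homomorphism `H (Fil l / Fil j) → H (Fil j / Fil i)`, given by `x ↦ d x`. -/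
def δ {i j l : ι} (m n : ℤ) (h : m + 1 = n) : 𝒯.H j l m →ₗ[k] 𝒯.H i j n :=
  Submodule.mapQ _ _ (𝒯.d.restrict fun _ hx => d_mem_cycles h hx) <| by
    rintro ⟨x, _⟩ hx
    obtain ⟨y, hy, hxy⟩ := mem_boundaries.1 hx
    subst h
    refine mem_boundaries.2 ⟨x - 𝒯.d y, by simpa using hxy, ?_⟩
    simp [𝒯.d_d]

/-- The functor `(i ≤ j) ↦ H (Fil j / Fil i)`. -/
def HFunctor (m : ℤ) : ComposableArrows ι 1 ⥤ ModuleCat.{v} k where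
  obj f := ModuleCat.of k (𝒯.H (f.obj 0) (f.obj 1) m)
  map α := ModuleCat.ofHom (𝒯.Hmap (leOfHom (α.app 0)) (leOfHom (α.app 1)) m)
  map_id f := ModuleCat.hom_ext <| LinearMap.ext fun y => by
    obtain ⟨x, hx, rfl⟩ := H.mk_surjective y
    rfl
  map_comp _ _ := ModuleCat.hom_ext <| LinearMap.ext fun y => by
    obtain ⟨x, hx, rfl⟩ := H.mk_surjective y
    rfl

variable {𝒯} in
lemma exact_δ_Hmap {i j l : ι} (hij : i ≤ j) (hjl : j ≤ l) (m n : ℤ) (h : m + 1 = n) :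
    Function.Exact (𝒯.δ (i := i) (j := j) (l := l) m n h) (𝒯.Hmap (le_refl i) hjl n) := by
  intro y
  constructor
  · obtain ⟨x, hx, rfl⟩ := H.mk_surjective y
    intro hy
    obtain ⟨z, hz, hxz⟩ := mem_boundaries.1 (H.mk_eq_zero.1 hy)
    subst h
    rw [add_sub_cancel_right] at hz
    refine ⟨H.mk 𝒯 z ⟨hz, ?_⟩, H.mk_eq_mk ?_⟩
    · simpa using Submodule.sub_mem _ hx.1 (𝒯.mono _ hij hxz)
    · rw [← neg_sub]
      exact neg_mem (Fil_le_boundaries hxz)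
  · rintro ⟨y, rfl⟩
    obtain ⟨x, hx, rfl⟩ := H.mk_surjective y
    subst h
    exact H.mk_eq_zero.2 (d_mem_boundaries rfl hx.1)

variable {𝒯} in
lemma exact_Hmap_Hmap {i j l : ι} (hij : i ≤ j) (hjl : j ≤ l) (m : ℤ) :
    Function.Exact (𝒯.Hmap (le_refl i) hjl m) (𝒯.Hmap hij (le_refl l) m) := by
  intro y
  constructor
  · obtain ⟨x, hx, rfl⟩ := H.mk_surjective y
    intro hy
    obtain ⟨z, hz, hxz⟩ := mem_boundaries.1 (H.mk_eq_zero.1 hy)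
    refine ⟨H.mk 𝒯 (x - 𝒯.d z) ⟨hxz, ?_⟩, H.mk_eq_mk ?_⟩
    · simpa [𝒯.d_d] using hx.2
    · change x - 𝒯.d z - x ∈ _
      rw [sub_sub_cancel_left]
      exact neg_mem (d_mem_boundaries (sub_add_cancel m 1) hz)
  · rintro ⟨y, rfl⟩
    obtain ⟨x, hx, rfl⟩ := H.mk_surjective y
    exact H.mk_eq_zero.2 (Fil_le_boundaries hx.1)

variable {𝒯} in
lemma exact_Hmap_δ {i j l : ι} (hij : i ≤ j) (hjl : j ≤ l) (m n : ℤ) (h : m + 1 = n) :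
    Function.Exact (𝒯.Hmap hij (le_refl l) m) (𝒯.δ (i := i) (j := j) (l := l) m n h) := by
  intro y
  constructor
  · obtain ⟨x, hx, rfl⟩ := H.mk_surjective y
    intro hy
    obtain ⟨z, hz, hxz⟩ := mem_boundaries.1 (H.mk_eq_zero.1 hy)
    subst h
    rw [add_sub_cancel_right] at hz
    refine ⟨H.mk 𝒯 (x - z) ⟨Submodule.sub_mem _ hx.1 (𝒯.mono _ hjl hz), ?_⟩, H.mk_eq_mk ?_⟩
    · simpa using hxz
    · change x - z - x ∈ _
      rw [sub_sub_cancel_left]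
      exact neg_mem (Fil_le_boundaries hz)
  · rintro ⟨y, rfl⟩
    obtain ⟨x, hx, rfl⟩ := H.mk_surjective y
    subst h
    exact H.mk_eq_zero.2 (Fil_le_boundaries hx.2)

/-- The spectral object given by the long exact sequences of the triples
`Fil i ⊆ Fil j ⊆ Fil l`. -/
def spectralObject : SpectralObject (ModuleCat.{v} k) ι where
  H := 𝒯.HFunctor
  δ' n₀ n₁ h :=
    { app D := ModuleCat.ofHom (𝒯.δ (i := D.obj 0) (j := D.obj 1) (l := D.obj 2) n₀ n₁ h)
      naturality _ _ _ := ModuleCat.hom_ext <| LinearMap.ext fun y => by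
        obtain ⟨x, hx, rfl⟩ := H.mk_surjective y
        rfl }
  exact₁' n₀ n₁ h D :=
    have h := exact_δ_Hmap (𝒯 := 𝒯) (leOfHom (D.map' 0 1)) (leOfHom (D.map' 1 2)) n₀ n₁ h
    ((ShortComplex.ShortExact.moduleCat_exact_iff_function_exact
      (ShortComplex.moduleCatMk _ _ h.linearMap_comp_eq_zero)).2 h).exact_toComposableArrows
  exact₂' n D :=
    have h := exact_Hmap_Hmap (𝒯 := 𝒯) (leOfHom (D.map' 0 1)) (leOfHom (D.map' 1 2)) n
    ((ShortComplex.ShortExact.moduleCat_exact_iff_function_exact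
      (ShortComplex.moduleCatMk _ _ h.linearMap_comp_eq_zero)).2 h).exact_toComposableArrows
  exact₃' n₀ n₁ h D :=
    have h := exact_Hmap_δ (𝒯 := 𝒯) (leOfHom (D.map' 0 1)) (leOfHom (D.map' 1 2)) n₀ n₁ h
    ((ShortComplex.ShortExact.moduleCat_exact_iff_function_exact
      (ShortComplex.moduleCatMk _ _ h.linearMap_comp_eq_zero)).2 h).exact_toComposableArrows

end FilteredDifferentialModule

end FilteredModule

end

/-! ### Convergence of third quadrant spectral objects -/

section

open Abelian ComposableArrows Limits SpectralObject

section Convergence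

variable {k : Type w} [CommRing k]

/-- If `g : W → E` is onto and `g x = 0` exactly when `φ x` lies in the image of `φ ∘ α`, then `E`
is the quotient of the image of `φ` by the image of `φ ∘ α`. -/
lemma nonempty_quotient_submoduleOf_equiv {W W' V E : Type*} [AddCommGroup W] [AddCommGroup W']
    [AddCommGroup V] [AddCommGroup E] [Module k W] [Module k W'] [Module k V] [Module k E]
    (φ : W →ₗ[k] V) (α : W' →ₗ[k] W) (g : W →ₗ[k] E) (hg : Function.Surjective g)
    (hker : ∀ x, g x = 0 ↔ ∃ y, φ (α y) = φ x) {P P' : Submodule k V}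
    (hP : LinearMap.range φ = P) (hP' : LinearMap.range (φ ∘ₗ α) = P') :
    Nonempty ((P ⧸ P'.submoduleOf P) ≃ₗ[k] E) := by
  subst hP hP'
  let N := (LinearMap.range (φ ∘ₗ α)).submoduleOf (LinearMap.range φ)
  let ψ := N.mkQ ∘ₗ φ.rangeRestrict
  have hψ : Function.Surjective ψ := N.mkQ_surjective.comp φ.surjective_rangeRestrict
  have h : LinearMap.ker ψ = LinearMap.ker g := by
    ext x
    rw [LinearMap.mem_ker, LinearMap.mem_ker, hker]
    exact Submodule.Quotient.mk_eq_zero N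
  exact ⟨(LinearMap.quotKerEquivOfSurjective ψ hψ).symm ≪≫ₗ Submodule.quotEquivOfEq _ _ h ≪≫ₗ
    LinearMap.quotKerEquivOfSurjective g hg⟩

/-- The image of `H^n(i → j) → H^n(i → l)`. -/
def imageH {ι : Type*} [Preorder ι] (X : SpectralObject (ModuleCat.{v} k) ι) {i j l : ι}
    (hij : i ≤ j) (hjl : j ≤ l) (n : ℤ) :
    Submodule k ((X.H n).obj (mk₁ (homOfLE (hij.trans hjl)))) :=
  LinearMap.range ((X.H n).map (twoδ₂Toδ₁' i j l hij hjl)).hom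

section

variable {ι : Type*} [Preorder ι] (X : SpectralObject (ModuleCat.{v} k) ι)

lemma H_map_map_apply {i j j' l : ι} (hij : i ≤ j) (hjj' : j ≤ j') (hjl : j' ≤ l) (n : ℤ)
    (x : (X.H n).obj (mk₁ (homOfLE hij))) :
    ((X.H n).map (twoδ₂Toδ₁' i j' l (hij.trans hjj') hjl)).hom
      (((X.H n).map (twoδ₂Toδ₁' i j j' hij hjj')).hom x) =
    ((X.H n).map (twoδ₂Toδ₁' i j l hij (hjj'.trans hjl))).hom x := by
  rw [← LinearMap.comp_apply, ← ModuleCat.hom_comp, ← Functor.map_comp]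
  rfl

lemma imageH_le {i j j' l : ι} (hij : i ≤ j) (hjj' : j ≤ j') (hjl : j' ≤ l) (n : ℤ) :
    imageH X hij (hjj'.trans hjl) n ≤ imageH X (hij.trans hjj') hjl n := by
  rintro _ ⟨x, rfl⟩
  exact ⟨_, H_map_map_apply X hij hjj' hjl n x⟩

/-- `E^n(i → j → j' → l)` is the quotient of the images of `H^n(i → j')` and `H^n(i → j)` in
`H^n(i → l)`: both are quotients of `H^n(i → j')`, with the same kernel. -/
lemma nonempty_map_imageH_quotient_equiv {i j j' l : ι} (hij : i ≤ j) (hjj' : j ≤ j')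
    (hjl : j' ≤ l) (n₀ n n₁ : ℤ) (h₀ : n₀ + 1 = n) (h₁ : n + 1 = n₁)
    {A : Type v} [AddCommGroup A] [Module k A]
    (e : (X.H n).obj (mk₁ (homOfLE (hij.trans (hjj'.trans hjl)))) ≃ₗ[k] A) :
    Nonempty (((imageH X (hij.trans hjj') hjl n).map e.toLinearMap ⧸
      ((imageH X hij (hjj'.trans hjl) n).map e.toLinearMap).submoduleOf
        ((imageH X (hij.trans hjj') hjl n).map e.toLinearMap)) ≃ₗ[k]
      X.E (homOfLE hij) (homOfLE hjj') (homOfLE hjl) n₀ n n₁ h₀ h₁) := by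
  let S := X.cokernelSequenceE (homOfLE hij) (homOfLE hjj') (homOfLE hjl)
    (homOfLE (hij.trans hjj')) rfl n₀ n n₁ h₀ h₁
  have hS : S.Exact := X.cokernelSequenceE_exact ..
  let α := ((X.H n).map (twoδ₂Toδ₁' i j j' hij hjj')).hom
  let δ := (X.δ (homOfLE (hij.trans hjj')) (homOfLE hjl) n₀ n h₀).hom
  let φ := ((X.H n).map (twoδ₂Toδ₁' i j' l (hij.trans hjj') hjl)).hom
  let g : (X.H n).obj (mk₁ (homOfLE (hij.trans hjj'))) →ₗ[k]
    X.E (homOfLE hij) (homOfLE hjj') (homOfLE hjl) n₀ n n₁ h₀ h₁ := S.g.hom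
  have hg : Function.Surjective g := (ModuleCat.epi_iff_surjective S.g).1 inferInstance
  have hδφ : Function.Exact δ φ := (ShortComplex.ShortExact.moduleCat_exact_iff_function_exact _).1
    (X.exact₁ (homOfLE (hij.trans hjj')) (homOfLE hjl) _ rfl n₀ n h₀)
  let b : (X.H n).obj (mk₁ (homOfLE hij)) ⊞ (X.H n₀).obj (mk₁ (homOfLE hjl)) ⟶
      (X.H n).obj (mk₁ (homOfLE (hij.trans hjj'))) :=
    biprod.desc ((X.H n).map (twoδ₂Toδ₁' i j j' hij hjj')) (X.δ _ _ n₀ n h₀)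
  have hb : ∀ z, b.hom z = α ((biprod.fst : _ ⟶ (X.H n).obj (mk₁ (homOfLE hij))).hom z) +
      δ ((biprod.snd : _ ⟶ (X.H n₀).obj (mk₁ (homOfLE hjl))).hom z) := fun z => by
    have h : b = biprod.fst ≫ ModuleCat.ofHom α + biprod.snd ≫ ModuleCat.ofHom δ := biprod.desc_eq
    rw [h]
    rfl
  have hgb : ∀ z, g (b.hom z) = 0 := S.moduleCat_zero_apply
  have hgα : ∀ y, g (α y) = 0 := fun y => by
    have h : biprod.inl ≫ b = ModuleCat.ofHom α := biprod.inl_desc _ _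
    rw [← ModuleCat.hom_ofHom α, ← h]
    exact hgb _
  have hgδ : ∀ y, g (δ y) = 0 := fun y => by
    have h : biprod.inr ≫ b = ModuleCat.ofHom δ := biprod.inr_desc _ _
    rw [← ModuleCat.hom_ofHom δ, ← h]
    exact hgb _
  refine nonempty_quotient_submoduleOf_equiv (e.toLinearMap ∘ₗ φ) α g hg (fun x => ?_)
    (LinearMap.range_comp _ _) ?_
  · constructor
    · intro hx
      obtain ⟨z, rfl⟩ : ∃ z, b.hom z = x := S.moduleCat_exact_iff.1 hS x hx
      refine ⟨(biprod.fst : _ ⟶ (X.H n).obj (mk₁ (homOfLE hij))).hom z, congrArg e ?_⟩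
      rw [hb, map_add, hδφ.apply_apply_eq_zero, add_zero]
    · rintro ⟨y, hy⟩
      obtain ⟨z, hz⟩ := (hδφ (x - α y)).1 (by rw [map_sub, sub_eq_zero]; exact e.injective hy.symm)
      rw [← sub_add_cancel x (α y), map_add, hgα, ← hz, hgδ, add_zero]
  · rw [LinearMap.comp_assoc, LinearMap.range_comp]
    congr 1
    exact congrArg LinearMap.range (LinearMap.ext (H_map_map_apply X hij hjj' hjl n))

end

/-- The spectral sequence of a third quadrant spectral object converges to `H (⊥ → ⊤)`. -/
theorem convergesTo_of_isThirdQuadrant (X : SpectralObject (ModuleCat.{v} k) EInt)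
    [X.IsThirdQuadrant] (A : ℕ → ModuleCat.{v} k)
    (e : ∀ n : ℕ, (X.H (-n)).obj (mk₁ (homOfLE (bot_le : (⊥ : EInt) ≤ ⊤))) ≃ₗ[k] A n) :
    ConvergesTo (X.spectralSequence coreE₂HomologicalNat) A := by
  intro n
  let f (s : ℕ) : EInt := ((s - n : ℤ) :)
  have hf : ∀ {s t}, s ≤ t → f s ≤ f t := by
    intro s t h
    simp only [f, WithBotTop.coe_le_coe]
    omega
  refine ⟨fun s => (imageH X (bot_le : ⊥ ≤ f s) le_top (-n)).map (e n).toLinearMap, ?_, ?_, ?_, ?_⟩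
  · intro s t hst
    exact Submodule.map_mono (imageH_le X bot_le (hf hst) le_top _)
  · have : imageH X (bot_le : ⊥ ≤ f 0) le_top (-n) = ⊥ := by
      have h := X.isZero₂_of_isThirdQuadrant ⊥ (f 0) bot_le (-n) (by simp [f])
      refine (LinearMap.range_eq_bot).2 ?_
      rw [h.eq_of_src ((X.H (-n)).map (twoδ₂Toδ₁' ⊥ (f 0) ⊤ bot_le le_top)) 0]
      rfl
    simp only [this, Submodule.map_bot]
  · have : imageH X (bot_le : ⊥ ≤ f (n + 1)) le_top (-n) = ⊤ := by
      have h := X.isZero₁_of_isThirdQuadrant (f (n + 1)) ⊤ le_top (by simp [f]) (-n)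
      have := (X.exact₂ (homOfLE (bot_le : ⊥ ≤ f (n + 1))) (homOfLE le_top) _ rfl (-n)).epi_f
        (h.eq_of_tgt _ _)
      exact LinearMap.range_eq_top.2 ((ModuleCat.epi_iff_surjective _).1 this)
    simp only [this, Submodule.map_top, LinearEquiv.range]
  · intro p q hpq
    have h₁ : f p ≤ f (p + 1) := hf (Nat.le_succ p)
    obtain ⟨e₁⟩ := nonempty_map_imageH_quotient_equiv X (bot_le : ⊥ ≤ f p) h₁ le_top (-n - 1) (-n)
      (-n + 1) (by omega) (by omega) (e n)
    let i₀ : EInt := ((-p - 2 * q : ℤ) :)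
    let i₃ : EInt := ((p + 1 : ℤ) :)
    have h₀ : i₀ ≤ f p := by simp only [i₀, f, WithBotTop.coe_le_coe]; omega
    have h₃ : f (p + 1) ≤ i₃ := by simp only [i₃, f, WithBotTop.coe_le_coe]; omega
    refine ⟨e₁ ≪≫ₗ (?_ : _ ≅ _).toLinearEquiv⟩
    refine (X.isoMapFourδ₄Toδ₃' ⊥ (f p) (f (p + 1)) i₃ ⊤ bot_le h₁ h₃ le_top (-n - 1) (-n) (-n + 1)
      (X.isZero₁_of_isThirdQuadrant i₃ ⊤ le_top ?_ _) (by omega) (by omega)).symm ≪≫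
      X.isoMapFourδ₁Toδ₀' ⊥ i₀ (f p) (f (p + 1)) i₃ bot_le h₀ h₁ h₃ (-n - 1) (-n) (-n + 1)
      (X.isZero₂_of_isThirdQuadrant ⊥ i₀ bot_le _ ?_) (by omega) (by omega) ≪≫
      (X.spectralSequencePageXIso coreE₂HomologicalNat ((p : ℤ) + q + 2) (by omega) (p, q) _ _ _ _
        ?_ ?_ ?_ ?_ _ _ _ ?_ (by omega) (by omega)).symm
    · simp only [i₃, WithBotTop.coe_lt_coe]; omega
    · simp only [i₀, WithBotTop.coe_le_coe]; omega
    · simp only [i₀, coreE₂HomologicalNat_i₀, WithBotTop.coe_injective.eq_iff]; omega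
    · simp only [f, coreE₂HomologicalNat_i₁, WithBotTop.coe_injective.eq_iff]; omega
    · simp only [f, coreE₂HomologicalNat_i₂, WithBotTop.coe_injective.eq_iff]; omega
    · simp only [i₃, coreE₂HomologicalNat_i₃, WithBotTop.coe_injective.eq_iff]; omega
    · simp only [coreE₂HomologicalNat_deg]; omega

end Convergence

end

/-! ### Cycles and homology classes -/

section HomologyClass

variable {k : Type w} [CommRing k] (C C' : ChainComplex (ModuleCat.{v} k) ℕ)

/-- The cycles of degree `n` of a chain complex, as a submodule. -/
def cycleModule (n : ℕ) : Submodule k (C.X n) := LinearMap.ker (C.sc n).g.hom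

variable {C} in
lemma mem_cycleModule {n : ℕ} {z : C.X n} :
    z ∈ cycleModule C n ↔ ∀ m, m + 1 = n → (C.d n m).hom z = 0 := by
  constructor
  · intro hz m hm
    have h : (ComplexShape.down ℕ).next n = m := (ComplexShape.down ℕ).next_eq' hm
    subst h
    exact hz
  · intro h
    by_cases hn : (ComplexShape.down ℕ).Rel n ((ComplexShape.down ℕ).next n)
    · exact h _ hn
    · have h0 : (C.sc n).g = 0 := C.shape _ _ hn
      change (C.sc n).g.hom z = 0
      rw [h0]
      rfl

variable {C} in
lemma d_mem_cycleModule {n : ℕ} (b : C.X (n + 1)) : (C.d (n + 1) n).hom b ∈ cycleModule C n :=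
  mem_cycleModule.2 fun m _ => LinearMap.congr_fun
    (congrArg ModuleCat.Hom.hom (C.d_comp_d (n + 1) n m)) b

/-- The homology class of a cycle. -/
def homologyClass (n : ℕ) : cycleModule C n →ₗ[k] C.homology n :=
  ((C.sc n).moduleCatLeftHomologyData.π ≫ (C.sc n).moduleCatHomologyIso.inv).hom

lemma homologyClass_surjective (n : ℕ) : Function.Surjective (homologyClass C n) :=
  (ModuleCat.epi_iff_surjective ((C.sc n).moduleCatLeftHomologyData.π ≫
    (C.sc n).moduleCatHomologyIso.inv)).1 inferInstance

variable {C} in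
lemma homologyClass_eq_zero_iff {n : ℕ} {z : cycleModule C n} :
    homologyClass C n z = 0 ↔ ∃ b : C.X (n + 1), (C.d (n + 1) n).hom b = z := by
  have hp : (ComplexShape.down ℕ).prev n = n + 1 := (ComplexShape.down ℕ).prev_eq' rfl
  have h1 : homologyClass C n z = 0 ↔ (LinearMap.range (C.sc n).moduleCatToCycles).mkQ z = 0 :=
    (C.sc n).moduleCatHomologyIso.symm.toLinearEquiv.map_eq_zero_iff
  rw [h1, ← hp]
  exact (Submodule.Quotient.mk_eq_zero _).trans (exists_congr fun b => Subtype.ext_iff)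

variable {C} in
lemma homologyπ_eq_homologyClass {n : ℕ} (y : C.cycles n) (z : C.X n) (hz : z ∈ cycleModule C n)
    (h : (C.iCycles n).hom y = z) : (C.homologyπ n).hom y = homologyClass C n ⟨z, hz⟩ := by
  have h₁ : homologyClass C n =
      ((C.sc n).moduleCatCyclesIso.inv ≫ (C.sc n).homologyπ).hom :=
    congrArg ModuleCat.Hom.hom (C.sc n).moduleCatCyclesIso_inv_π.symm
  have h₂ : (⟨z, hz⟩ : cycleModule C n) = (C.sc n).moduleCatCyclesIso.hom.hom y :=
    Subtype.ext (h.symm.trans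
      (congrArg (fun f => f.hom y) (C.sc n).moduleCatCyclesIso_hom_i).symm)
  rw [h₁, h₂]
  exact (congrArg (fun f : (C.sc n).cycles ⟶ (C.sc n).homology => f.hom y)
    ((C.sc n).moduleCatCyclesIso.hom_inv_id_assoc (C.sc n).homologyπ)).symm

variable {C C'} in
lemma homologyMap_homologyClass (φ : C ⟶ C') {n : ℕ} (z : C.X n) (hz : z ∈ cycleModule C n)
    (hz' : (φ.f n).hom z ∈ cycleModule C' n) :
    (HomologicalComplex.homologyMap φ n).hom (homologyClass C n ⟨z, hz⟩) =
      homologyClass C' n ⟨(φ.f n).hom z, hz'⟩ := by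
  let y : C.cycles n := (C.sc n).moduleCatCyclesIso.inv.hom ⟨z, hz⟩
  have hy : (C.iCycles n).hom y = z :=
    congrArg (fun f => f.hom (⟨z, hz⟩ : cycleModule C n)) (C.sc n).moduleCatCyclesIso_inv_iCycles
  rw [← homologyπ_eq_homologyClass y z hz hy,
    ← homologyπ_eq_homologyClass ((HomologicalComplex.cyclesMap φ n).hom y) _ hz' ?_]
  · exact congrArg (fun f => f.hom y) (HomologicalComplex.homologyπ_naturality φ n)
  · rw [← hy]
    exact congrArg (fun f => f.hom y) (HomologicalComplex.cyclesMap_i φ n)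

variable {C C'} in
lemma map_mem_cycleModule (φ : C ⟶ C') {n : ℕ} {z : C.X n} (hz : z ∈ cycleModule C n) :
    (φ.f n).hom z ∈ cycleModule C' n := by
  refine mem_cycleModule.2 fun m hm => ?_
  have h := congrArg (fun f => f.hom z) (φ.comm n m)
  refine h.trans ?_
  change (φ.f m).hom ((C.d n m).hom z) = 0
  rw [mem_cycleModule.1 hz m hm, map_zero]

end HomologyClass

/-! ### Double complexes -/

/-- A first quadrant double complex of modules, with commuting differentials. -/
structure Bicomplex (k : Type w) [CommRing k] where
  /-- The module in position `(p, q)`. -/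
  X : ℕ → ℕ → Type v
  [addCommGroup : ∀ p q, AddCommGroup (X p q)]
  [module : ∀ p q, Module k (X p q)]
  /-- The differential lowering the first degree. -/
  dh : ∀ p q, X (p + 1) q →ₗ[k] X p q
  /-- The differential lowering the second degree. -/
  dv : ∀ p q, X p (q + 1) →ₗ[k] X p q
  dh_dh : ∀ p q x, dh p q (dh (p + 1) q x) = 0
  dv_dv : ∀ p q x, dv p q (dv p (q + 1) x) = 0
  dh_dv : ∀ p q x, dh p q (dv (p + 1) q x) = dv p q (dh p (q + 1) x)

attribute [instance] Bicomplex.addCommGroup Bicomplex.module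

namespace Bicomplex

variable {k : Type w} [CommRing k] (K : Bicomplex.{w, v} k)

/-- The total differential on families of elements of all degrees. -/
def totalD : (∀ p q, K.X p q) →ₗ[k] (∀ p q, K.X p q) where
  toFun x p q := K.dh p q (x (p + 1) q) + (-1 : k) ^ p • K.dv p q (x p (q + 1))
  map_add' x y := by
    funext p q
    simp only [Pi.add_apply, map_add, smul_add]
    abel
  map_smul' c x := by
    funext p q
    simp only [Pi.smul_apply, map_smul, smul_add, RingHom.id_apply, smul_comm c]

lemma totalD_apply (x : ∀ p q, K.X p q) (p q : ℕ) :
    K.totalD x p q = K.dh p q (x (p + 1) q) + (-1 : k) ^ p • K.dv p q (x p (q + 1)) := rfl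

lemma totalD_totalD (x : ∀ p q, K.X p q) : K.totalD (K.totalD x) = 0 := by
  funext p q
  simp only [totalD_apply, map_add, map_smul, K.dh_dh, K.dv_dv, K.dh_dv, pow_succ, Pi.zero_apply]
  simp

/-- The elements of `K p q` killed by the vertical differential. -/
def vcycles (p : ℕ) : ∀ q, Submodule k (K.X p q)
  | 0 => ⊤
  | q + 1 => LinearMap.ker (K.dv p q)

variable {K} in
lemma mem_vcycles_succ {p q : ℕ} {x : K.X p (q + 1)} :
    x ∈ K.vcycles p (q + 1) ↔ K.dv p q x = 0 := Iff.rfl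

variable {K} in
lemma dv_mem_vcycles {p : ℕ} (q : ℕ) (x : K.X p (q + 1)) : K.dv p q x ∈ K.vcycles p q := by
  cases q with
  | zero => trivial
  | succ q => exact K.dv_dv p q x

variable {K} in
lemma dh_mem_vcycles {p q : ℕ} {x : K.X (p + 1) q} (hx : x ∈ K.vcycles (p + 1) q) :
    K.dh p q x ∈ K.vcycles p q := by
  cases q with
  | zero => trivial
  | succ q => rw [mem_vcycles_succ, ← K.dh_dv, mem_vcycles_succ.1 hx, map_zero]

/-- The total complex filtered by the canonical truncations in the vertical direction. The `i`-th
step consists of the families which vanish in the rows `q < 1 - i`, and are vertical cycles in the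
row `q = 1 - i`. -/
def total : FilteredDifferentialModule.{w, v} k EInt where
  T := ∀ p q, K.X p q
  d := K.totalD
  d_d := K.totalD_totalD
  Fil i m :=
    { carrier := {x | ∀ p q : ℕ, ((p + q : ℤ) ≠ -m → x p q = 0) ∧
        (¬ ((1 - q : ℤ) : EInt) ≤ i → x p q = 0) ∧
        (¬ ((1 - q : ℤ) : EInt) < i → x p q ∈ K.vcycles p q)}
      add_mem' := by
        intro x y hx hy p q
        refine ⟨fun h => ?_, fun h => ?_, fun h => ?_⟩
        · rw [Pi.add_apply, Pi.add_apply, (hx p q).1 h, (hy p q).1 h, add_zero]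
        · rw [Pi.add_apply, Pi.add_apply, (hx p q).2.1 h, (hy p q).2.1 h, add_zero]
        · exact add_mem ((hx p q).2.2 h) ((hy p q).2.2 h)
      zero_mem' := fun p q => ⟨fun _ => rfl, fun _ => rfl, fun _ => zero_mem _⟩
      smul_mem' := by
        intro c x hx p q
        refine ⟨fun h => ?_, fun h => ?_, fun h => ?_⟩
        · rw [Pi.smul_apply, Pi.smul_apply, (hx p q).1 h, smul_zero]
        · rw [Pi.smul_apply, Pi.smul_apply, (hx p q).2.1 h, smul_zero]
        · exact Submodule.smul_mem _ _ ((hx p q).2.2 h) }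
  mono m hij x hx p q := ⟨(hx p q).1, fun h => (hx p q).2.1 fun h' => h (h'.trans hij),
    fun h => (hx p q).2.2 fun h' => h (h'.trans_le hij)⟩
  d_mem := by
    rintro i m _ x rfl hx p q
    have hvert : ¬ ((1 - q : ℤ) : EInt) ≤ i → x p (q + 1) ∈ K.vcycles p (q + 1) := by
      refine fun h => (hx p (q + 1)).2.2 fun h' => h ?_
      induction i using WithBotTop.rec with
      | bot => exact absurd h' not_lt_bot
      | top => exact le_top
      | coe a =>
        rw [WithBotTop.coe_lt_coe] at h'
        rw [WithBotTop.coe_le_coe]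
        push_cast at h'
        omega
    refine ⟨fun h => ?_, fun h => ?_, fun h => ?_⟩
    · rw [totalD_apply, (hx (p + 1) q).1 (by push_cast; omega),
        (hx p (q + 1)).1 (by push_cast; omega), map_zero, map_zero, smul_zero, add_zero]
    · rw [totalD_apply, (hx (p + 1) q).2.1 h, mem_vcycles_succ.1 (hvert h), map_zero, smul_zero,
        add_zero]
    · exact add_mem (dh_mem_vcycles ((hx (p + 1) q).2.2 h))
        (Submodule.smul_mem _ _ (dv_mem_vcycles q _))

variable {K}

lemma mem_total_Fil {i : EInt} {m : ℤ} {x : ∀ p q, K.X p q} :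
    x ∈ K.total.Fil i m ↔ ∀ p q : ℕ, ((p + q : ℤ) ≠ -m → x p q = 0) ∧
      (¬ ((1 - q : ℤ) : EInt) ≤ i → x p q = 0) ∧
      (¬ ((1 - q : ℤ) : EInt) < i → x p q ∈ K.vcycles p q) := Iff.rfl

lemma mem_total_Fil_coe {a m : ℤ} {x : ∀ p q, K.X p q} :
    x ∈ K.total.Fil (a : EInt) m ↔ ∀ p q : ℕ, ((p + q : ℤ) ≠ -m → x p q = 0) ∧
      ((q : ℤ) < 1 - a → x p q = 0) ∧ ((q : ℤ) ≤ 1 - a → x p q ∈ K.vcycles p q) := by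
  rw [mem_total_Fil]
  have h₁ (q : ℕ) : ¬ ((1 - q : ℤ) : EInt) ≤ a ↔ (q : ℤ) < 1 - a := by
    rw [WithBotTop.coe_le_coe]
    omega
  have h₂ (q : ℕ) : ¬ ((1 - q : ℤ) : EInt) < a ↔ (q : ℤ) ≤ 1 - a := by
    rw [WithBotTop.coe_lt_coe]
    omega
  simp only [h₁, h₂]

lemma mem_total_Fil_top {m : ℤ} {x : ∀ p q, K.X p q} :
    x ∈ K.total.Fil ⊤ m ↔ ∀ p q : ℕ, (p + q : ℤ) ≠ -m → x p q = 0 := by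
  rw [mem_total_Fil]
  refine forall₂_congr fun p q => ?_
  simp

/-- The truncation filtration is exhausted at `i = 1`. -/
lemma total_Fil_eq_top {i : EInt} (hi : (0 : ℤ) < i) (m : ℤ) :
    K.total.Fil i m = K.total.Fil ⊤ m := by
  refine le_antisymm (K.total.mono m le_top) ?_
  have h₁ : K.total.Fil ⊤ m ≤ K.total.Fil (1 : ℤ) m := fun x hx => by
    refine mem_total_Fil_coe.2 fun p q => ⟨(hx p q).1, fun h => by omega, fun h => ?_⟩
    obtain rfl : q = 0 := by omega
    trivial
  refine h₁.trans (K.total.mono m ?_)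
  induction i using WithBotTop.rec with
  | bot => exact absurd hi not_lt_bot
  | top => exact le_top
  | coe a =>
    rw [WithBotTop.coe_lt_coe] at hi
    rw [WithBotTop.coe_le_coe]
    omega

lemma total_Fil_eq_bot {i : EInt} {m : ℤ} (hi : i ≤ m) : K.total.Fil i m = ⊥ := by
  refine (Submodule.eq_bot_iff _).2 fun x hx => funext fun p => funext fun q => ?_
  by_cases h : (p + q : ℤ) = -m
  · refine (hx p q).2.1 fun h' => ?_
    have := h'.trans hi
    rw [WithBotTop.coe_le_coe] at this
    omega
  · exact (hx p q).1 h

lemma total_Fil_bot (m : ℤ) : K.total.Fil ⊥ m = ⊥ := total_Fil_eq_bot bot_le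

instance : K.total.spectralObject.IsThirdQuadrant where
  isZero₁ i j hij hi n := by
    have : Subsingleton (K.total.H i j n) := by
      refine subsingleton_of_forall_eq 0 fun y => ?_
      obtain ⟨x, hx, rfl⟩ := FilteredDifferentialModule.H.mk_surjective y
      refine FilteredDifferentialModule.H.mk_eq_zero.2
        (FilteredDifferentialModule.Fil_le_boundaries ?_)
      rw [total_Fil_eq_top hi]
      exact K.total.mono n le_top hx.1
    exact ModuleCat.isZero_of_subsingleton (ModuleCat.of k (K.total.H i j n))
  isZero₂ i j hij n hj := by
    have : Subsingleton (K.total.H i j n) := by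
      refine subsingleton_of_forall_eq 0 fun y => ?_
      obtain ⟨x, hx, rfl⟩ := FilteredDifferentialModule.H.mk_surjective y
      have h : x = 0 := by simpa [total_Fil_eq_bot hj] using hx.1
      exact FilteredDifferentialModule.H.mk_eq_zero.2 (h ▸ zero_mem _)
    exact ModuleCat.isZero_of_subsingleton (ModuleCat.of k (K.total.H i j n))

end Bicomplex

/-! ### The spectral sequence of a bicomplex with exact rows -/

section

open FilteredDifferentialModule

namespace Bicomplex

variable {k : Type w} [CommRing k] {K : Bicomplex.{w, v} k}

variable (K) in
/-- The extension by zero of a row. -/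
lemma exists_row (r : ℕ) (w : ∀ p, K.X p r) :
    ∃ y : ∀ p q, K.X p q, (∀ p, y p r = w p) ∧ ∀ p q, q ≠ r → y p q = 0 := by
  refine ⟨fun p => Pi.single r (w p), fun p => Pi.single_eq_same _ _, fun p q h =>
    Pi.single_eq_of_ne h _⟩

variable (K) in
lemma exists_two_rows (r : ℕ) (w : ∀ p, K.X p r) (w' : ∀ p, K.X p (r + 1)) :
    ∃ y : ∀ p q, K.X p q, (∀ p, y p r = w p) ∧ (∀ p, y p (r + 1) = w' p) ∧
      ∀ p q, q ≠ r → q ≠ r + 1 → y p q = 0 := by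
  obtain ⟨y, hy, hy'⟩ := exists_row K r w
  obtain ⟨z, hz, hz'⟩ := exists_row K (r + 1) w'
  refine ⟨y + z, fun p => ?_, fun p => ?_, fun p q h h' => ?_⟩
  · simp [hy, hz' p r (by omega)]
  · simp [hz, hy' p (r + 1) (by omega)]
  · simp [hy' p q h, hz' p q h']

/-- An element of the truncation at the row `q` which vanishes on this row and whose boundary lies
in the next truncation lies itself in the next truncation. -/
lemma mem_total_Fil_of_row_eq_zero {q : ℕ} {m : ℤ} {x : ∀ p q, K.X p q}
    (hx : x ∈ K.total.cycles ((-q : ℤ) : EInt) ((1 - q : ℤ) : EInt) m) (h : ∀ p, x p q = 0) :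
    x ∈ K.total.Fil ((-q : ℤ) : EInt) m := by
  have h₁ := mem_total_Fil_coe.1 hx.1
  refine mem_total_Fil_coe.2 fun p q' => ⟨(h₁ p q').1, fun hq => ?_, fun hq => ?_⟩
  · rcases (show q' ≤ q by omega).eq_or_lt with rfl | hq
    · exact h p
    · exact (h₁ p q').2.1 (by omega)
  · rcases (show q' ≤ q + 1 by omega).eq_or_lt with rfl | hq
    · have h₂ := (mem_total_Fil_coe.1 hx.2 p q).2.1 (by omega)
      rw [show K.total.d x p q = _ from K.totalD_apply x p q, h, map_zero, zero_add] at h₂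
      rw [mem_vcycles_succ]
      have := congrArg ((-1 : k) ^ p • ·) h₂
      simpa [smul_smul, ← mul_pow] using this
    · rcases (show q' ≤ q by omega).eq_or_lt with rfl | hq
      · rw [h p]
        exact zero_mem _
      · rw [(h₁ p q').2.1 (by omega)]
        exact zero_mem _

/-- The associated graded pieces of the truncation filtration compute the horizontal homology of
the vertical homology of the double complex. The vertical homology in the row `q` is given by a
complex `A` and surjections `π p` from the vertical cycles, with the vertical boundaries as
kernels. -/
theorem nonempty_H_equiv_homology (p q : ℕ) (A : ChainComplex (ModuleCat.{v} k) ℕ)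
    (π : ∀ p, K.vcycles p q →ₗ[k] A.X p) (hπ : ∀ p, Function.Surjective (π p))
    (hker : ∀ p z, π p z = 0 ↔ ∃ w, K.dv p q w = z)
    (hd : ∀ p (z : K.vcycles (p + 1) q),
      (A.d (p + 1) p).hom (π (p + 1) z) = π p ⟨K.dh p q z, dh_mem_vcycles z.2⟩) :
    Nonempty (K.total.H ((-q : ℤ) : EInt) ((1 - q : ℤ) : EInt) (-(p + q : ℤ)) ≃ₗ[k]
      A.homology p) := by
  set i : EInt := ((-q : ℤ) : EInt)
  set j : EInt := ((1 - q : ℤ) : EInt)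
  have hij : i ≤ j := by
    simp only [i, j, WithBotTop.coe_le_coe]
    omega
  set m : ℤ := -(p + q : ℤ) with hm
  have hsign : ∀ (a : ℕ) {V : Type v} [AddCommGroup V] [Module k V] (x : V),
      (-1 : k) ^ a • (-1 : k) ^ a • x = x := by
    intro a V _ _ x
    rw [smul_smul, ← mul_pow]
    simp
  -- the component in position `(p, q)` of a relative cycle is a vertical cycle
  have hcyc : ∀ x ∈ K.total.Fil j m, ∀ p', x p' q ∈ K.vcycles p' q := fun x hx p' =>
    (mem_total_Fil_coe.1 hx p' q).2.2 (by omega)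
  let α : K.total.cycles i j m →ₗ[k] K.vcycles p q :=
    LinearMap.restrict (LinearMap.proj (R := k) (φ := fun q => K.X p q) q ∘ₗ
      LinearMap.proj (φ := fun p => ∀ q, K.X p q) p)
      fun x hx => hcyc x hx.1 p
  have hα : ∀ x, π p (α x) ∈ cycleModule A p := fun ⟨x, hx⟩ => by
    refine mem_cycleModule.2 ?_
    rintro p' rfl
    rw [hd, hker]
    have h := (mem_total_Fil_coe.1 hx.2 p' q).2.1 (by omega)
    rw [show K.total.d x p' q = _ from K.totalD_apply x p' q] at h
    exact ⟨-((-1 : k) ^ p' • x p' (q + 1)), by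
      rw [map_neg, map_smul]; exact (eq_neg_of_add_eq_zero_left h).symm⟩
  let F : K.total.cycles i j m →ₗ[k] A.homology p :=
    homologyClass A p ∘ₗ (π p ∘ₗ α).codRestrict _ hα
  have hF : Function.Surjective F := by
    intro c
    obtain ⟨⟨a, ha⟩, rfl⟩ := homologyClass_surjective A p c
    obtain ⟨z, rfl⟩ := hπ p a
    let x₀ : ∀ p', K.X p' q := Pi.single p (z : K.X p q)
    have hw : ∀ p', ∃ w : K.X p' (q + 1),
        K.dh p' q (x₀ (p' + 1)) + (-1 : k) ^ p' • K.dv p' q w = 0 ∧ (p' + 1 ≠ p → w = 0) := by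
      intro p'
      by_cases hp : p' + 1 = p
      · subst hp
        have h := mem_cycleModule.1 ha p' rfl
        rw [hd, hker] at h
        obtain ⟨w, hw⟩ := h
        refine ⟨-((-1 : k) ^ p' • w), ?_, fun h => absurd rfl h⟩
        simp only [x₀, Pi.single_eq_same]
        rw [map_neg, map_smul, smul_neg, hsign, hw, add_neg_cancel]
      · exact ⟨0, by simp [x₀, Pi.single_eq_of_ne hp], fun _ => rfl⟩
    choose w hw hw' using hw
    obtain ⟨x, hx₁, hx₂, hx₃⟩ := exists_two_rows K q x₀ w
    have hxd : ∀ p', K.totalD x p' q = 0 := fun p' => by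
      rw [totalD_apply, hx₁, hx₂, hw]
    have hxF : x ∈ K.total.Fil j m := by
      refine mem_total_Fil_coe.2 fun p' q' => ⟨fun h => ?_, fun h => ?_, fun h => ?_⟩
      · rcases eq_or_ne q' q with rfl | h₁
        · rw [hx₁]
          exact Pi.single_eq_of_ne (by omega) _
        · rcases eq_or_ne q' (q + 1) with rfl | h₂
          · rw [hx₂]
            exact hw' p' (by omega)
          · exact hx₃ _ _ h₁ h₂
      · exact hx₃ _ _ (by omega) (by omega)
      · rcases eq_or_ne q' q with rfl | h₁
        · rw [hx₁]
          rcases eq_or_ne p' p with rfl | h₂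
          · simp [x₀]
          · simp only [x₀, Pi.single_eq_of_ne h₂]
            exact zero_mem _
        · rw [hx₃ _ _ h₁ (by omega)]
          exact zero_mem _
    have hdxF : K.total.d x ∈ K.total.Fil j (m + 1) := K.total.d_mem rfl hxF
    have hx : x ∈ K.total.cycles i j m := by
      refine ⟨hxF, mem_total_Fil_of_row_eq_zero ⟨hdxF, ?_⟩ hxd⟩
      exact (congrArg (· ∈ K.total.Fil i (m + 1 + 1)) (K.total.d_d x)).mpr (zero_mem _)
    refine ⟨⟨x, hx⟩, congrArg (homologyClass A p) (Subtype.ext (congrArg (π p) (Subtype.ext ?_)))⟩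
    change x p q = z
    rw [hx₁]
    exact Pi.single_eq_same _ _
  have hFker : LinearMap.ker F =
      (K.total.boundaries i j m).comap (K.total.cycles i j m).subtype := by
    ext ⟨x, hx⟩
    rw [LinearMap.mem_ker, Submodule.mem_comap]
    refine homologyClass_eq_zero_iff.trans ?_
    change (∃ b, (A.d (p + 1) p).hom b = π p ⟨x p q, _⟩) ↔ x ∈ _
    rw [mem_boundaries]
    constructor
    · rintro ⟨b, hb⟩
      obtain ⟨z, rfl⟩ := hπ _ b
      rw [hd, ← sub_eq_zero, ← map_sub, hker] at hb
      obtain ⟨w, hw⟩ := hb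
      replace hw : K.dv p q w = K.dh p q z - x p q := hw
      obtain ⟨y, hy₁, hy₂, hy₃⟩ := exists_two_rows K q (Pi.single (p + 1) (z : K.X (p + 1) q))
        (Pi.single p (-((-1 : k) ^ p • w)))
      have hyF : y ∈ K.total.Fil j (m - 1) := by
        refine mem_total_Fil_coe.2 fun p' q' => ⟨fun h => ?_, fun h => ?_, fun h => ?_⟩
        · rcases eq_or_ne q' q with rfl | h₁
          · rw [hy₁]
            exact Pi.single_eq_of_ne (by omega) _
          · rcases eq_or_ne q' (q + 1) with rfl | h₂
            · rw [hy₂]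
              exact Pi.single_eq_of_ne (by omega) _
            · exact hy₃ _ _ h₁ h₂
        · exact hy₃ _ _ (by omega) (by omega)
        · rcases eq_or_ne q' q with rfl | h₁
          · rw [hy₁]
            rcases eq_or_ne p' (p + 1) with rfl | h₂
            · simp
            · simp only [Pi.single_eq_of_ne h₂]
              exact zero_mem _
          · rw [hy₃ _ _ h₁ (by omega)]
            exact zero_mem _
      have hxy : x - K.total.d y ∈ K.total.Fil j m :=
        sub_mem hx.1 (K.total.d_mem (by omega) hyF)
      refine ⟨y, hyF, mem_total_Fil_of_row_eq_zero ⟨hxy, ?_⟩ fun p' => ?_⟩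
      · have h : K.total.d (x - K.total.d y) = K.total.d x :=
          (map_sub _ _ _).trans ((congrArg (K.total.d x - ·) (K.total.d_d y)).trans (sub_zero _))
        exact (congrArg (· ∈ K.total.Fil i (m + 1)) h).mpr hx.2
      · rcases eq_or_ne p' p with rfl | h
        · change x p' q - K.totalD y p' q = 0
          rw [totalD_apply, hy₁, hy₂, Pi.single_eq_same, Pi.single_eq_same, map_neg, map_smul,
            smul_neg, hsign, hw]
          abel
        · exact (mem_total_Fil_coe.1 hxy p' q).1 (by omega)
    · rintro ⟨y, hy, hxy⟩
      have hyc : y (p + 1) q ∈ K.vcycles (p + 1) q :=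
        (mem_total_Fil_coe.1 hy (p + 1) q).2.2 (by omega)
      refine ⟨π (p + 1) ⟨y (p + 1) q, hyc⟩, ?_⟩
      have h : x p q - (K.dh p q (y (p + 1) q) + (-1 : k) ^ p • K.dv p q (y p (q + 1))) = 0 :=
        (mem_total_Fil_coe.1 hxy p q).2.1 (by omega)
      rw [hd, ← sub_eq_zero, ← map_sub, hker]
      refine ⟨-((-1 : k) ^ p • y p (q + 1)), ?_⟩
      change _ = K.dh p q (y (p + 1) q) - x p q
      rw [map_neg, map_smul, sub_eq_zero.1 h]
      abel
  exact ⟨Submodule.quotEquivOfEq _ _ hFker.symm ≪≫ₗ LinearMap.quotKerEquivOfSurjective F hF⟩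

/-- If the rows are exact away from the column `0`, a cycle of the total complex which dies in the
cokernel of the first horizontal differential is a boundary, of an element which vanishes in the
column `0`. -/
lemma exists_totalD_eq (hrow : ∀ p q (x : K.X (p + 1) q), K.dh p q x = 0 →
      ∃ w, K.dh (p + 1) q w = x) {y : ∀ p q, K.X p q} (hy : K.totalD y = 0)
    (hy₀ : ∀ q, ∃ w, K.dh 0 q w = y 0 q) :
    ∃ x : ∀ p q, K.X p q, (∀ q, x 0 q = 0) ∧ K.totalD x = y := by
  -- `S p` consists of the candidates for the column `p` for which the next column can be found
  let S (p : ℕ) := {x : ∀ q, K.X p q //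
    ∀ q, ∃ w, K.dh p q w = y p q - (-1 : k) ^ p • K.dv p q (x (q + 1))}
  have step : ∀ p (x : S p), ∃ x' : S (p + 1), ∀ q,
      K.dh p q (x'.1 q) = y p q - (-1 : k) ^ p • K.dv p q (x.1 (q + 1)) := by
    rintro p ⟨x, hx⟩
    have hx' := hx
    choose w hw using hx'
    refine ⟨⟨w, fun q => hrow _ _ _ ?_⟩, hw⟩
    have h : K.dh p q (y (p + 1) q) + (-1 : k) ^ p • K.dv p q (y p (q + 1)) = 0 :=
      congrFun (congrFun hy p) q
    rw [map_sub, map_smul, K.dh_dv, hw, map_sub, map_smul, K.dv_dv, smul_zero, sub_zero, pow_succ,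
      mul_neg_one, neg_smul, sub_neg_eq_add, h]
  choose next hnext using step
  let s : ∀ p, S p := fun p => Nat.rec ⟨0, fun q => by simpa using hy₀ q⟩ next p
  refine ⟨fun p => (s p).1, fun q => rfl, funext fun p => funext fun q => ?_⟩
  have h : K.dh p q ((s (p + 1)).1 q) = _ := hnext p (s p) q
  rw [totalD_apply, h, sub_add_cancel]

/-- If the rows of a double complex are resolutions of the terms of a complex `B`, then the total
complex has the homology of `B`. -/
theorem nonempty_H_total_equiv_homology (B : ChainComplex (ModuleCat.{v} k) ℕ)
    (ε : ∀ q, K.X 0 q →ₗ[k] B.X q) (hε : ∀ q, Function.Surjective (ε q))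
    (hker : ∀ q x, ε q x = 0 ↔ ∃ w, K.dh 0 q w = x)
    (hd : ∀ q x, (B.d (q + 1) q).hom (ε (q + 1) x) = ε q (K.dv 0 q x))
    (hrow : ∀ p q (x : K.X (p + 1) q), K.dh p q x = 0 → ∃ w, K.dh (p + 1) q w = x) (n : ℕ) :
    Nonempty (K.total.H ⊥ ⊤ (-n : ℤ) ≃ₗ[k] B.homology n) := by
  -- restriction of a family of elements to the total degree `n`
  have hpart : ∀ (n : ℕ) (x : ∀ p q, K.X p q), ∃ x' : ∀ p q, K.X p q,
      x' ∈ K.total.Fil ⊤ (-n : ℤ) ∧ ∀ p q, p + q = n → x' p q = x p q := fun n x =>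
    ⟨fun p q => if p + q = n then x p q else 0, mem_total_Fil_top.2 fun p q h =>
      if_neg (by omega), fun p q h => if_pos h⟩
  have hεd : ∀ x : ∀ p q, K.X p q, ∀ q,
      ε q (K.totalD x 0 q) = (B.d (q + 1) q).hom (ε (q + 1) (x 0 (q + 1))) := by
    intro x q
    rw [hd, totalD_apply, map_add, (hker _ _).2 ⟨_, rfl⟩, pow_zero, one_smul, zero_add]
  have hcyc : ∀ x : ∀ p q, K.X p q, x ∈ K.total.cycles ⊥ ⊤ (-n : ℤ) → K.totalD x = 0 := by
    intro x hx
    have h : K.total.d x ∈ K.total.Fil ⊥ (-n + 1 : ℤ) := hx.2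
    rwa [total_Fil_bot] at h
  let α : K.total.cycles ⊥ ⊤ (-n : ℤ) →ₗ[k] B.X n :=
    ε n ∘ₗ LinearMap.proj (R := k) (φ := fun q => K.X 0 q) n ∘ₗ
      LinearMap.proj (φ := fun p => ∀ q, K.X p q) 0 ∘ₗ Submodule.subtype _
  have hα : ∀ x, α x ∈ cycleModule B n := fun ⟨x, hx⟩ => by
    refine mem_cycleModule.2 ?_
    rintro m rfl
    change (B.d (m + 1) m).hom (ε (m + 1) (x 0 (m + 1))) = 0
    exact (hεd x m).symm.trans
      ((congrArg (fun y => ε m (y 0 m)) (hcyc x hx)).trans (map_zero (ε m)))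
  let F : K.total.cycles ⊥ ⊤ (-n : ℤ) →ₗ[k] B.homology n :=
    homologyClass B n ∘ₗ α.codRestrict _ hα
  have hF : Function.Surjective F := by
    intro c
    obtain ⟨⟨b, hb⟩, rfl⟩ := homologyClass_surjective B n c
    obtain ⟨a, rfl⟩ := hε n b
    -- start with `a` in position `(0, n)` and correct it by columns of positive degree
    obtain ⟨x₀, hx₀, hx₀'⟩ := exists_row K n (Pi.single 0 a)
    have hy₀ : ∀ q, ε q (K.totalD x₀ 0 q) = 0 := fun q => by
      rw [hεd]
      by_cases hq : q + 1 = n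
      · subst hq
        rw [hx₀, Pi.single_eq_same]
        exact mem_cycleModule.1 hb q rfl
      · rw [hx₀' _ _ hq, map_zero, map_zero]
    obtain ⟨x₁, hx₁, hx₁'⟩ := exists_totalD_eq hrow (K.totalD_totalD x₀)
      fun q => (hker _ _).1 (hy₀ q)
    obtain ⟨x, hx, hx'⟩ := hpart n (x₀ - x₁)
    have hxd : K.totalD x = 0 := by
      funext p q
      by_cases hpq : p + q + 1 = n
      · rw [totalD_apply, hx' _ _ (by omega), hx' _ _ (by omega), ← totalD_apply, map_sub, hx₁',
          sub_self]
      · have h := mem_total_Fil_top.1 hx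
        rw [totalD_apply, h _ _ (by push_cast; omega), h _ _ (by push_cast; omega), map_zero,
          map_zero, smul_zero, add_zero]
        rfl
    refine ⟨⟨x, hx, ?_⟩, congrArg (homologyClass B n) (Subtype.ext (congrArg (ε n) ?_))⟩
    · change K.totalD x ∈ K.total.Fil ⊥ (-n + 1 : ℤ)
      rw [hxd]
      exact zero_mem _
    · change x 0 n = a
      rw [hx' _ _ (by omega), Pi.sub_apply, Pi.sub_apply, hx₁, sub_zero, hx₀, Pi.single_eq_same]
  have key : ∀ x : ∀ p q, K.X p q, x ∈ K.total.cycles ⊥ ⊤ (-n : ℤ) →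
      ((∃ b, (B.d (n + 1) n).hom b = ε n (x 0 n)) ↔
        ∃ y : ∀ p q, K.X p q, y ∈ K.total.Fil ⊤ (-n - 1 : ℤ) ∧ x - K.totalD y = 0) := by
    intro x hx
    have hx₀ := mem_total_Fil_top.1 hx.1
    constructor
    · rintro ⟨b, hb⟩
      obtain ⟨a, rfl⟩ := hε _ b
      obtain ⟨y₀, hy₀, hy₀'⟩ := exists_row K (n + 1) (Pi.single 0 a)
      obtain ⟨y₁, hy₁, hy₁'⟩ := exists_totalD_eq hrow (y := x - K.totalD y₀)
        (by rw [map_sub, totalD_totalD, hcyc x hx, sub_zero]) fun q => (hker _ _).1 <| by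
          change ε q (x 0 q - K.totalD y₀ 0 q) = 0
          rw [map_sub, hεd]
          by_cases hq : q = n
          · subst hq
            rw [hy₀, Pi.single_eq_same, hb, sub_self]
          · rw [hy₀' _ _ (by omega), hx₀ _ _ (by omega), map_zero, map_zero, map_zero, sub_zero]
      obtain ⟨y, hy, hy'⟩ := hpart (n + 1) (y₀ + y₁)
      refine ⟨y, ?_, funext fun p => funext fun q => ?_⟩
      · rwa [show (-n - 1 : ℤ) = -((n + 1 : ℕ) : ℤ) by push_cast; ring]
      · change x p q - K.totalD y p q = 0
        by_cases hpq : p + q = n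
        · rw [totalD_apply, hy' _ _ (by omega), hy' _ _ (by omega), ← totalD_apply, map_add,
            hy₁']
          simp
        · have h := mem_total_Fil_top.1 hy
          rw [hx₀ _ _ (by omega), totalD_apply, h _ _ (by push_cast; omega),
            h _ _ (by push_cast; omega), map_zero, map_zero, smul_zero, add_zero, sub_zero]
    · rintro ⟨y, -, hxy⟩
      exact ⟨ε (n + 1) (y 0 (n + 1)), by rw [sub_eq_zero.1 hxy, hεd]⟩
  have hFker : LinearMap.ker F =
      (K.total.boundaries ⊥ ⊤ (-n : ℤ)).comap (K.total.cycles ⊥ ⊤ (-n : ℤ)).subtype := by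
    ext ⟨x, hx⟩
    rw [LinearMap.mem_ker, Submodule.mem_comap]
    refine (homologyClass_eq_zero_iff.trans (key x hx)).trans ?_
    change _ ↔ x ∈ _
    rw [mem_boundaries, total_Fil_bot]
    exact Iff.rfl
  exact ⟨Submodule.quotEquivOfEq _ _ hFker.symm ≪≫ₗ LinearMap.quotKerEquivOfSurjective F hF⟩

/-- The spectral sequence of a first quadrant double complex whose rows are resolutions: its second
page is the horizontal homology of the vertical homology `A q`, and it converges to the homology of
the complex `B` which is resolved. -/
theorem exists_spectralSequence (K : Bicomplex.{w, v} k)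
    (A : ℕ → ChainComplex (ModuleCat.{v} k) ℕ)
    (π : ∀ p q, K.vcycles p q →ₗ[k] (A q).X p) (hπ : ∀ p q, Function.Surjective (π p q))
    (hπker : ∀ p q z, π p q z = 0 ↔ ∃ w, K.dv p q w = z)
    (hπd : ∀ p q (z : K.vcycles (p + 1) q),
      ((A q).d (p + 1) p).hom (π (p + 1) q z) = π p q ⟨K.dh p q z, dh_mem_vcycles z.2⟩)
    (B : ChainComplex (ModuleCat.{v} k) ℕ)
    (ε : ∀ q, K.X 0 q →ₗ[k] B.X q) (hε : ∀ q, Function.Surjective (ε q))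
    (hεker : ∀ q x, ε q x = 0 ↔ ∃ w, K.dh 0 q w = x)
    (hεd : ∀ q x, (B.d (q + 1) q).hom (ε (q + 1) x) = ε q (K.dv 0 q x))
    (hrow : ∀ p q (x : K.X (p + 1) q), K.dh p q x = 0 → ∃ w, K.dh (p + 1) q w = x) :
    ∃ E : E₂HomologicalSpectralSequence.{w, v} k,
      (∀ (h₂ : (2 : ℤ) ≤ 2) (p q : ℕ), Nonempty ((E.page 2 h₂).X (p, q) ≅ (A q).homology p)) ∧
      ConvergesTo E fun n => B.homology n := by
  refine ⟨K.total.spectralObject.spectralSequence Abelian.SpectralObject.coreE₂HomologicalNat,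
    fun _ p q => ?_, convergesTo_of_isThirdQuadrant _ _ fun n =>
      (nonempty_H_total_equiv_homology B ε hε hεker hεd hrow n).some⟩
  obtain ⟨e⟩ := nonempty_H_equiv_homology p q (A q) (fun p => π p q) (fun p => hπ p q)
    (fun p => hπker p q) (fun p => hπd p q)
  refine ⟨K.total.spectralObject.spectralSequenceFirstPageXIso
    Abelian.SpectralObject.coreE₂HomologicalNat (p, q) ((-q : ℤ) : EInt) ((1 - q : ℤ) : EInt)
    rfl (congrArg WithBotTop.coe (by ring)) (-(p + q : ℤ)) (neg_add' _ _) ≪≫ e.toModuleIso⟩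

end Bicomplex

end

/-! ### Functoriality and exactness of `F_n(Γ) ⊗_Γ A` in `A` -/

section Exactness

variable {k : Type w} [CommRing k] {Γ : Type u} [Group Γ] {A B C : Rep.{v} k Γ}

/-- The map on `F_n(Γ) ⊗_Γ A` defined by an invariant function of a tuple and a coefficient. -/
def Chains.lift {n : ℕ} {N : Type*} [AddCommGroup N] [Module k N]
    (φ : (Fin (n + 1) → Γ) → A →ₗ[k] N) (hφ : ∀ g x a, φ (g • x) (A.ρ g a) = φ x a) :
    Chains A n →ₗ[k] N :=
  Representation.Coinvariants.lift _
    (TensorProduct.lift (Finsupp.lift _ k _ φ ∘ₗ (MonoidAlgebra.coeffLinearEquiv k).toLinearMap))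
    fun g => by
      refine TensorProduct.ext (MonoidAlgebra.lhom_ext' fun x => ?_)
      ext a
      simpa using hφ g x a

lemma Chains.lift_mk {n : ℕ} {N : Type*} [AddCommGroup N] [Module k N]
    (φ : (Fin (n + 1) → Γ) → A →ₗ[k] N) (hφ : ∀ g x a, φ (g • x) (A.ρ g a) = φ x a)
    (x : Fin (n + 1) → Γ) (a : A) : Chains.lift φ hφ (Chains.mk A x a) = φ x a := by
  simp [Chains.lift, Chains.mk]

/-- `(x, a) ↦ x ⊗ a` as a linear map in `a`. -/
def Chains.lmk (A : Rep.{v} k Γ) {n : ℕ} (x : Fin (n + 1) → Γ) : A →ₗ[k] Chains A n :=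
  Representation.Coinvariants.mk _ ∘ₗ TensorProduct.mk k _ _ (MonoidAlgebra.single x (1 : k))

lemma Chains.lmk_apply {n : ℕ} (x : Fin (n + 1) → Γ) (a : A) :
    Chains.lmk A x a = Chains.mk A x a := rfl

/-- The map `x ⊗ a ↦ (x₀⁻¹ x₁, …, x₀⁻¹ xₙ) ⊗ x₀⁻¹ a`. -/
def Chains.toFinsupp (A : Rep.{v} k Γ) (n : ℕ) : Chains A n →ₗ[k] ((Fin n → Γ) →₀ A) :=
  Chains.lift (fun x => Finsupp.lsingle (fun i : Fin n => (x 0)⁻¹ * x i.succ) ∘ₗ A.ρ (x 0)⁻¹)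
    fun g x a => by
      have h (i : Fin n) : ((g • x) 0)⁻¹ * (g • x) i.succ = (x 0)⁻¹ * x i.succ := by
        simp [mul_assoc]
      have h' : A.ρ ((g • x) 0)⁻¹ (A.ρ g a) = A.ρ (x 0)⁻¹ a := by
        rw [← Module.End.mul_apply, ← map_mul]
        simp
      rw [LinearMap.comp_apply, LinearMap.comp_apply, h']
      simp only [h]

lemma Chains.toFinsupp_mk {n : ℕ} (x : Fin (n + 1) → Γ) (a : A) :
    Chains.toFinsupp A n (Chains.mk A x a) =
      Finsupp.single (fun i : Fin n => (x 0)⁻¹ * x i.succ) (A.ρ (x 0)⁻¹ a) :=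
  Chains.lift_mk ..

/-- Each orbit of `(n + 1)`-tuples has a unique element with first entry `1`, so that
`F_n(Γ) ⊗_Γ A` is a direct sum of copies of `A`. -/
def Chains.equivFinsupp (A : Rep.{v} k Γ) (n : ℕ) : Chains A n ≃ₗ[k] ((Fin n → Γ) →₀ A) :=
  LinearEquiv.ofLinearMap (Chains.toFinsupp A n)
    (Finsupp.lsum k fun y => Chains.lmk A (Fin.cons 1 y : Fin (n + 1) → Γ))
    (by
      refine Finsupp.lhom_ext fun y a => ?_
      rw [LinearMap.comp_apply, Finsupp.lsum_single, Chains.lmk_apply, Chains.toFinsupp_mk]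
      simp)
    (Chains.lhom_ext fun x a => by
      rw [LinearMap.comp_apply, Chains.toFinsupp_mk, LinearMap.id_apply,
        ← Chains.mk_smul (x 0)⁻¹ x a, Finsupp.lsum_single, Chains.lmk_apply]
      congr 1
      funext i
      refine Fin.cases ?_ (fun i => ?_) i
      · simp
      · simp)

/-- The map `x ⊗ a ↦ x ⊗ f a` for an equivariant map `f`. -/
def Chains.coeff (f : A →ₗ[k] B) (hf : ∀ g a, f (A.ρ g a) = B.ρ g (f a)) (n : ℕ) :
    Chains A n →ₗ[k] Chains B n :=
  Chains.map (MonoidHom.id Γ) id (fun _ _ => rfl) f hf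

lemma Chains.coeff_mk (f : A →ₗ[k] B) (hf : ∀ g a, f (A.ρ g a) = B.ρ g (f a)) {n : ℕ}
    (x : Fin (n + 1) → Γ) (a : A) :
    Chains.coeff f hf n (Chains.mk A x a) = Chains.mk B x (f a) :=
  Chains.map_mk (MonoidHom.id Γ) id (fun _ _ => rfl) f hf x a

lemma Chains.coeff_coeff (f : A →ₗ[k] B) (hf : ∀ g a, f (A.ρ g a) = B.ρ g (f a))
    (f' : B →ₗ[k] C) (hf' : ∀ g a, f' (B.ρ g a) = C.ρ g (f' a)) (f'' : A →ₗ[k] C)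
    (hf'' : ∀ g a, f'' (A.ρ g a) = C.ρ g (f'' a)) (h : ∀ a, f' (f a) = f'' a) {n : ℕ}
    (c : Chains A n) :
    Chains.coeff f' hf' n (Chains.coeff f hf n c) = Chains.coeff f'' hf'' n c := by
  have : Chains.coeff f' hf' n ∘ₗ Chains.coeff f hf n = Chains.coeff f'' hf'' n :=
    Chains.lhom_ext fun x a => by
      rw [LinearMap.comp_apply, Chains.coeff_mk, Chains.coeff_mk, Chains.coeff_mk, h]
  exact LinearMap.congr_fun this c

lemma Chains.equivFinsupp_coeff (f : A →ₗ[k] B) (hf : ∀ g a, f (A.ρ g a) = B.ρ g (f a)) {n : ℕ}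
    (c : Chains A n) : Chains.equivFinsupp B n (Chains.coeff f hf n c) =
      Finsupp.mapRange f (map_zero f) (Chains.equivFinsupp A n c) := by
  have : (Chains.equivFinsupp B n).toLinearMap ∘ₗ Chains.coeff f hf n =
      Finsupp.mapRange.linearMap f ∘ₗ (Chains.equivFinsupp A n).toLinearMap := by
    refine Chains.lhom_ext fun x a => ?_
    rw [LinearMap.comp_apply, LinearMap.comp_apply, Chains.coeff_mk]
    refine (Chains.toFinsupp_mk x (f a)).trans ?_
    refine Eq.trans ?_ (congrArg (Finsupp.mapRange f (map_zero f)) (Chains.toFinsupp_mk x a).symm)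
    rw [Finsupp.mapRange_single, hf]
  exact LinearMap.congr_fun this c

lemma Chains.coeff_injective (f : A →ₗ[k] B) (hf : ∀ g a, f (A.ρ g a) = B.ρ g (f a))
    (h : Function.Injective f) (n : ℕ) : Function.Injective (Chains.coeff f hf n) := by
  intro c c' hc
  apply (Chains.equivFinsupp A n).injective
  apply Finsupp.mapRange_injective f (map_zero f) h
  rw [← Chains.equivFinsupp_coeff f hf, ← Chains.equivFinsupp_coeff f hf, hc]

lemma Chains.coeff_surjective (f : A →ₗ[k] B) (hf : ∀ g a, f (A.ρ g a) = B.ρ g (f a))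
    (h : Function.Surjective f) (n : ℕ) : Function.Surjective (Chains.coeff f hf n) := by
  intro c
  obtain ⟨s, hs⟩ := Finsupp.mapRange_surjective f (map_zero f) h (Chains.equivFinsupp B n c)
  refine ⟨(Chains.equivFinsupp A n).symm s, (Chains.equivFinsupp B n).injective ?_⟩
  rw [Chains.equivFinsupp_coeff, LinearEquiv.apply_symm_apply, hs]

/-- The functor `F_n(Γ) ⊗_Γ -` is exact. -/
lemma Chains.coeff_eq_zero_iff (f : A →ₗ[k] B) (hf : ∀ g a, f (A.ρ g a) = B.ρ g (f a))
    (f' : B →ₗ[k] C) (hf' : ∀ g a, f' (B.ρ g a) = C.ρ g (f' a))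
    (h : ∀ b, f' b = 0 ↔ ∃ a, f a = b) {n : ℕ} (c : Chains B n) :
    Chains.coeff f' hf' n c = 0 ↔ ∃ c', Chains.coeff f hf n c' = c := by
  constructor
  · intro hc
    have hs (y) : f' (Chains.equivFinsupp B n c y) = 0 := by
      have := congrArg (Chains.equivFinsupp C n) hc
      rw [Chains.equivFinsupp_coeff, map_zero] at this
      exact DFunLike.congr_fun this y
    -- a section of `f` over its range, sending `0` to `0`
    choose! σ hσ using fun b : B => (h b).1
    let s := (Chains.equivFinsupp B n c).mapRange (fun b => σ b - σ 0) (sub_self _)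
    refine ⟨(Chains.equivFinsupp A n).symm s, (Chains.equivFinsupp B n).injective ?_⟩
    rw [Chains.equivFinsupp_coeff, LinearEquiv.apply_symm_apply]
    ext y
    simp only [s, Finsupp.mapRange_apply, map_sub, hσ _ (hs y), hσ 0 (map_zero f'), sub_zero]
  · rintro ⟨c', rfl⟩
    have : Chains.coeff f' hf' n ∘ₗ Chains.coeff f hf n = 0 := Chains.lhom_ext fun x a => by
      rw [LinearMap.comp_apply, Chains.coeff_mk, Chains.coeff_mk, (h _).2 ⟨a, rfl⟩]
      exact map_zero (Chains.lmk C x)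
    exact LinearMap.congr_fun this c'

lemma chainsComplex_d_coeff (f : A →ₗ[k] B) (hf : ∀ g a, f (A.ρ g a) = B.ρ g (f a)) {n : ℕ}
    (c : Chains A (n + 1)) :
    ((chainsComplex B).d (n + 1) n).hom (Chains.coeff f hf (n + 1) c) =
      Chains.coeff f hf n (((chainsComplex A).d (n + 1) n).hom c : Chains A n) := by
  let D₁ : Chains A (n + 1) →ₗ[k] Chains A n := ((chainsComplex A).d (n + 1) n).hom
  let D₂ : Chains B (n + 1) →ₗ[k] Chains B n := ((chainsComplex B).d (n + 1) n).hom
  have : D₂ ∘ₗ Chains.coeff f hf (n + 1) = Chains.coeff f hf n ∘ₗ D₁ :=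
    Chains.lhom_ext fun x a => by
      have h₁ : D₁ (Chains.mk A x a) = ∑ i : Fin (n + 2), (-1 : ℤ) ^ (i : ℕ) •
        Chains.mk A (x ∘ i.succAbove) a := chainsComplex_d_mk A n x a
      have h₂ : D₂ (Chains.mk B x (f a)) = ∑ i : Fin (n + 2), (-1 : ℤ) ^ (i : ℕ) •
        Chains.mk B (x ∘ i.succAbove) (f a) := chainsComplex_d_mk B n x (f a)
      rw [LinearMap.comp_apply, LinearMap.comp_apply, Chains.coeff_mk, h₁, h₂, map_sum]
      exact Finset.sum_congr rfl fun i _ => by rw [map_zsmul, Chains.coeff_mk]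
  exact LinearMap.congr_fun this c

/-- Isomorphic coefficient modules have isomorphic homology. -/
theorem nonempty_groupHomology_iso (f : A →ₗ[k] B) (hf : ∀ g a, f (A.ρ g a) = B.ρ g (f a))
    (h : Function.Bijective f) (n : ℕ) : Nonempty (groupHomology A n ≅ groupHomology B n) := by
  let e : chainsComplex A ≅ chainsComplex B := HomologicalComplex.Hom.isoOfComponents
    (fun n => (LinearEquiv.ofBijective (Chains.coeff f hf n)
      ⟨Chains.coeff_injective f hf h.1 n, Chains.coeff_surjective f hf h.2 n⟩).toModuleIso) (by
      rintro i j rfl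
      exact ModuleCat.hom_ext (LinearMap.ext fun c => chainsComplex_d_coeff f hf c))
  exact ⟨(HomologicalComplex.homologyFunctor _ _ n).mapIso e⟩

end Exactness

/-! ### The hyperhomology spectral sequence -/

section Hyperhomology

variable {k : Type w} [CommRing k] {Q : Type u} [Group Q] (C : ChainComplex (ModuleCat.{v} k) ℕ)
  (ρ : ∀ q, Representation k Q (C.X q))
  (hρ : ∀ q g x, (C.d (q + 1) q).hom (ρ (q + 1) g x) = ρ q g ((C.d (q + 1) q).hom x))

/-- The double complex `F_p(Q) ⊗_Q C_q` for a complex `C` of `Q`-modules. -/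
def chainsBicomplex : Bicomplex.{w, max w u v} k where
  X p q := Chains (Rep.of (ρ q)) p
  dh p q := ((chainsComplex (Rep.of (ρ q))).d (p + 1) p).hom
  dv p q := Chains.coeff (A := Rep.of (ρ (q + 1))) (B := Rep.of (ρ q)) (C.d (q + 1) q).hom (hρ q) p
  dh_dh p q x := LinearMap.congr_fun (congrArg ModuleCat.Hom.hom
    ((chainsComplex (Rep.of (ρ q))).d_comp_d (p + 1 + 1) (p + 1) p)) x
  dv_dv p q x := by
    have := LinearMap.congr_fun
      (f := Chains.coeff (A := Rep.of (ρ (q + 1))) (B := Rep.of (ρ q)) (C.d (q + 1) q).hom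
          (hρ q) p ∘ₗ
        Chains.coeff (A := Rep.of (ρ (q + 2))) (B := Rep.of (ρ (q + 1)))
          (C.d (q + 2) (q + 1)).hom (hρ (q + 1)) p) (g := 0) ?_ x
    · exact this
    · refine Chains.lhom_ext fun y a => ?_
      rw [LinearMap.comp_apply, Chains.coeff_mk, Chains.coeff_mk]
      have h : (C.d (q + 1) q).hom ((C.d (q + 2) (q + 1)).hom a) = 0 :=
        LinearMap.congr_fun (congrArg ModuleCat.Hom.hom (C.d_comp_d (q + 2) (q + 1) q)) a
      rw [h]
      exact map_zero (Chains.lmk (Rep.of (ρ q)) y)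
  dh_dv p q x := chainsComplex_d_coeff (A := Rep.of (ρ (q + 1))) (B := Rep.of (ρ q)) _ (hρ q) x

variable {C ρ} in
lemma rho_mem_cycleModule
    (hρ : ∀ q g x, (C.d (q + 1) q).hom (ρ (q + 1) g x) = ρ q g ((C.d (q + 1) q).hom x)) {q : ℕ}
    (g : Q) {z : C.X q} (hz : z ∈ cycleModule C q) : ρ q g z ∈ cycleModule C q := by
  refine mem_cycleModule.2 ?_
  rintro m rfl
  rw [hρ, mem_cycleModule.1 hz m rfl, map_zero]

/-- The `Q`-module of cycles of degree `q`. -/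
def cycleRep (q : ℕ) : Rep.{v} k Q :=
  Rep.of (X := cycleModule C q)
    { toFun g := (ρ q g).restrict fun _ hz => rho_mem_cycleModule hρ g hz
      map_one' := by ext; simp
      map_mul' g g' := by ext; simp }

/-- The double complex `F_p(Q) ⊗_Q C_q` gives a spectral sequence from the homology of `Q` with
coefficients in the homology of `C`. Here the homology of `C` is given by `Q`-modules `N q` and
equivariant surjections `ψ q` from the cycles, with the boundaries as kernels; the rows are assumed
to be resolutions of the terms of a complex `B`. -/
theorem exists_hyperhomology_spectralSequence (N : ℕ → Rep.{v} k Q)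
    (ψ : ∀ q, cycleModule C q →ₗ[k] N q) (hψ : ∀ q, Function.Surjective (ψ q))
    (hψker : ∀ q z, ψ q z = 0 ↔ ∃ b, (C.d (q + 1) q).hom b = z)
    (hψρ : ∀ q g z, ψ q ((cycleRep C ρ hρ q).ρ g z) = (N q).ρ g (ψ q z))
    (B : ChainComplex (ModuleCat.{max w u v} k) ℕ)
    (ε : ∀ q, Chains (Rep.of (ρ q)) 0 →ₗ[k] B.X q) (hε : ∀ q, Function.Surjective (ε q))
    (hεker : ∀ q x, ε q x = 0 ↔
      ∃ w, ((chainsComplex (Rep.of (ρ q))).d 1 0).hom w = x)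
    (hεd : ∀ q x, (B.d (q + 1) q).hom (ε (q + 1) x) =
      ε q (Chains.coeff (A := Rep.of (ρ (q + 1))) (B := Rep.of (ρ q)) (C.d (q + 1) q).hom
        (hρ q) 0 x))
    (hrow : ∀ p q (x : Chains (Rep.of (ρ q)) (p + 1)),
      ((chainsComplex (Rep.of (ρ q))).d (p + 1) p).hom x = 0 →
        ∃ w, ((chainsComplex (Rep.of (ρ q))).d (p + 2) (p + 1)).hom w = x) :
    ∃ E : E₂HomologicalSpectralSequence.{w, max w u v} k,
      (∀ (h₂ : (2 : ℤ) ≤ 2) (p q : ℕ),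
        Nonempty ((E.page 2 h₂).X (p, q) ≅ groupHomology (N q) p)) ∧
      ConvergesTo E fun n => B.homology n := by
  let K := chainsBicomplex C ρ hρ
  let ι (q : ℕ) : cycleRep C ρ hρ q →ₗ[k] Rep.of (ρ q) := (cycleModule C q).subtype
  have hι (q : ℕ) : ∀ g a, ι q ((cycleRep C ρ hρ q).ρ g a) = (Rep.of (ρ q)).ρ g (ι q a) :=
    fun _ _ => rfl
  let Z (p q : ℕ) : Chains (cycleRep C ρ hρ q) p →ₗ[k] K.X p q := Chains.coeff (ι q) (hι q) p
  have hZ (p q : ℕ) : Function.Injective (Z p q) :=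
    Chains.coeff_injective (ι q) (hι q) Subtype.val_injective p
  have hrange (p q : ℕ) : LinearMap.range (Z p q) = K.vcycles p q := by
    cases q with
    | zero =>
      refine LinearMap.range_eq_top.2 (Chains.coeff_surjective (ι 0) (hι 0) (fun z => ?_) p)
      exact ⟨⟨z, mem_cycleModule.2 fun m hm => by omega⟩, rfl⟩
    | succ q =>
      ext x
      exact (Chains.coeff_eq_zero_iff (ι (q + 1)) (hι (q + 1)) (C := Rep.of (ρ q))
        (C.d (q + 1) q).hom (hρ q) (fun b => ⟨fun hb => ⟨⟨b, mem_cycleModule.2 fun m hm => by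
          obtain rfl : m = q := by omega
          exact hb⟩, rfl⟩, by rintro ⟨z, rfl⟩; exact mem_cycleModule.1 z.2 q rfl⟩) x).symm
  let e (p q : ℕ) : Chains (cycleRep C ρ hρ q) p ≃ₗ[k] K.vcycles p q :=
    LinearEquiv.ofInjective (Z p q) (hZ p q) ≪≫ₗ LinearEquiv.ofEq _ _ (hrange p q)
  let π (p q : ℕ) : K.vcycles p q →ₗ[k] Chains (N q) p :=
    Chains.coeff (A := cycleRep C ρ hρ q) (ψ q) (hψρ q) p ∘ₗ (e p q).symm.toLinearMap
  have hπe (p q : ℕ) (z) :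
      π p q (e p q z) = Chains.coeff (A := cycleRep C ρ hρ q) (ψ q) (hψρ q) p z :=
    congrArg (Chains.coeff (A := cycleRep C ρ hρ q) (ψ q) (hψρ q) p) ((e p q).symm_apply_apply z)
  let b (q : ℕ) : Rep.of (ρ (q + 1)) →ₗ[k] cycleRep C ρ hρ q :=
    (C.d (q + 1) q).hom.codRestrict (cycleModule C q) d_mem_cycleModule
  have hb (q : ℕ) : ∀ g a, b q ((Rep.of (ρ (q + 1))).ρ g a) = (cycleRep C ρ hρ q).ρ g (b q a) :=
    fun g a => Subtype.ext (hρ q g a)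
  refine K.exists_spectralSequence (fun q => chainsComplex (N q)) π (fun p q => ?_)
    (fun p q z => ?_) (fun p q z => ?_) B ε hε hεker hεd hrow
  · exact (Chains.coeff_surjective (A := cycleRep C ρ hρ q) (ψ q) (hψρ q) (hψ q) p).comp
      (e p q).symm.surjective
  · obtain ⟨z, rfl⟩ := (e p q).surjective z
    refine Iff.trans (Eq.congr_left (hπe p q z)) ?_
    refine (Chains.coeff_eq_zero_iff (b q) (hb q) (B := cycleRep C ρ hρ q) (ψ q) (hψρ q)
      (fun z => (hψker q z).trans
        (exists_congr fun a => ⟨fun h => Subtype.ext h, congrArg Subtype.val⟩)) z).trans ?_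
    refine exists_congr fun c => (hZ p q).eq_iff.symm.trans ?_
    have : Z p q (Chains.coeff (b q) (hb q) p c) = K.dv p q c :=
      Chains.coeff_coeff (b q) (hb q) (ι q) (hι q) (C.d (q + 1) q).hom (hρ q) (fun _ => rfl) c
    exact Eq.congr_left this
  · obtain ⟨z, rfl⟩ := (e (p + 1) q).surjective z
    refine (congrArg ((chainsComplex (N q)).d (p + 1) p).hom (hπe (p + 1) q z)).trans ?_
    refine (chainsComplex_d_coeff (A := cycleRep C ρ hρ q) (ψ q) (hψρ q) z).trans ?_
    refine (hπe p q _).symm.trans (congrArg (π p q) (Subtype.ext ?_))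
    exact (chainsComplex_d_coeff (ι q) (hι q) z).symm

end Hyperhomology

/-! ### The complex of `G / H`-modules computing `H_n(H, H'; M)` -/

section RelChains

variable {k : Type w} [CommRing k] {Γ : Type u} [Group Γ] {A : Rep.{v} k Γ} {S : Subgroup Γ}

/-- The map on relative chains defined by an invariant function of a tuple and a coefficient which
vanishes on the tuples in `S`. -/
def RelChains.lift {n : ℕ} {N : Type*} [AddCommGroup N] [Module k N]
    (φ : (Fin (n + 1) → Γ) → A →ₗ[k] N) (hφ : ∀ g x a, φ (g • x) (A.ρ g a) = φ x a)
    (hS : ∀ x a, (∀ i, x i ∈ S) → φ x a = 0) : RelChains A S n →ₗ[k] N :=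
  Submodule.liftQ _ (Chains.lift φ hφ) <| by
    let G : Chains (Rep.res S.subtype A) n →ₗ[k] Chains A n :=
      Chains.map (A := Rep.res S.subtype A) (B := A) S.subtype
        (fun x : Fin (n + 1) → S => S.subtype ∘ x) (fun _ _ => rfl) LinearMap.id (fun _ _ => rfl)
    have key : Chains.lift φ hφ ∘ₗ G = 0 := by
      refine Chains.lhom_ext fun x a => ?_
      have hG : G (Chains.mk _ x a) = Chains.mk A (S.subtype ∘ x) a :=
        Chains.map_mk (A := Rep.res S.subtype A) (B := A) S.subtype
          (fun x : Fin (n + 1) → S => S.subtype ∘ x) (fun _ _ => rfl) LinearMap.id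
          (fun _ _ => rfl) x a
      rw [LinearMap.comp_apply, hG, Chains.lift_mk]
      exact hS _ _ fun i => (x i).2
    rintro _ ⟨y, rfl⟩
    exact LinearMap.congr_fun key y

lemma RelChains.lift_mk {n : ℕ} {N : Type*} [AddCommGroup N] [Module k N]
    (φ : (Fin (n + 1) → Γ) → A →ₗ[k] N) (hφ : ∀ g x a, φ (g • x) (A.ρ g a) = φ x a)
    (hS : ∀ x a, (∀ i, x i ∈ S) → φ x a = 0) (x : Fin (n + 1) → Γ) (a : A) :
    RelChains.lift φ hφ hS (RelChains.mk A S x a) = φ x a :=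
  Chains.lift_mk φ hφ x a

variable (A S) in
/-- `(x, a) ↦ x ⊗ a` as a linear map in `a`. -/
def RelChains.lmk {n : ℕ} (x : Fin (n + 1) → Γ) : A →ₗ[k] RelChains A S n :=
  (subgroupChains A S n).mkQ ∘ₗ Chains.lmk A x

lemma RelChains.lmk_apply {n : ℕ} (x : Fin (n + 1) → Γ) (a : A) :
    RelChains.lmk A S x a = RelChains.mk A S x a := rfl

/-- The tuple `x` is contained in a left coset of `S`. -/
def InLeftCoset (S : Subgroup Γ) {n : ℕ} (x : Fin (n + 1) → Γ) : Prop := ∀ i j, (x i)⁻¹ * x j ∈ S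

lemma RelChains.mk_eq_zero {n : ℕ} {x : Fin (n + 1) → Γ} (hx : InLeftCoset S x) (a : A) :
    RelChains.mk A S x a = 0 := by
  rw [← RelChains.mk_smul (x 0)⁻¹]
  exact (Submodule.Quotient.mk_eq_zero _).2 (mk_mem_subgroupChains (hx 0) _)

lemma relComplex_d_mk (n : ℕ) (x : Fin (n + 2) → Γ) (a : A) :
    ((relComplex A S).d (n + 1) n).hom (RelChains.mk A S x a) =
      ∑ i : Fin (n + 2), (-1 : ℤ) ^ (i : ℕ) • RelChains.mk A S (x ∘ i.succAbove) a := by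
  refine (relComplex_d_quotientMk A S n (Chains.mk A x a)).trans ?_
  refine (congrArg (subgroupChains A S n).mkQ (chainsComplex_d_mk A n x a)).trans ?_
  rw [map_sum]
  exact Finset.sum_congr rfl fun i _ => map_zsmul _ _ _

end RelChains

section NormalChains

variable {k : Type w} [CommRing k] {G : Type u} [Group G] (H G' : Subgroup G) (M : Rep.{v} k G)

/-- The quotient of the `H`-coinvariants of `F_n(G) ⊗ M` by the generators `x ⊗ m` for which the
tuple `x` is contained in a left coset of `G'`. All left cosets have to be allowed, and not just
`G'`, for `G` to act on the quotient. -/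
abbrev NormalChains (n : ℕ) : Type (max w u v) :=
  Representation.Coinvariants
      (((Representation.diagonal k G (n + 1)).tprod M.ρ).comp H.subtype) ⧸
    Submodule.span k {c | ∃ (x : Fin (n + 1) → G) (m : M), InLeftCoset G' x ∧
      c = Representation.Coinvariants.mk _ (MonoidAlgebra.single x (1 : k) ⊗ₜ[k] m)}

namespace NormalChains

variable {n : ℕ}

/-- `(x, m) ↦ x ⊗ m` as a linear map in `m`. -/
def lmk (x : Fin (n + 1) → G) : M →ₗ[k] NormalChains H G' M n :=
  Submodule.mkQ _ ∘ₗ Representation.Coinvariants.mk _ ∘ₗ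
    TensorProduct.mk k _ _ (MonoidAlgebra.single x (1 : k))

/-- The class of the generator `(x₀, …, xₙ) ⊗ m`. -/
def mk (x : Fin (n + 1) → G) (m : M) : NormalChains H G' M n := lmk H G' M x m

variable {H G' M}

lemma mk_smul {h : G} (hh : h ∈ H) (x : Fin (n + 1) → G) (m : M) :
    mk H G' M (h • x) (M.ρ h m) = mk H G' M x m := by
  have := Representation.Coinvariants.mk_self_apply
    (((Representation.diagonal k G (n + 1)).tprod M.ρ).comp H.subtype) ⟨h, hh⟩
    (MonoidAlgebra.single x (1 : k) ⊗ₜ[k] m)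
  refine (congrArg (Submodule.mkQ _) (Eq.trans ?_ this))
  simp

lemma mk_eq_zero {x : Fin (n + 1) → G} (hx : InLeftCoset G' x) (m : M) : mk H G' M x m = 0 :=
  (Submodule.Quotient.mk_eq_zero _).2 (Submodule.subset_span ⟨x, m, hx, rfl⟩)

lemma lhom_ext {N : Type*} [AddCommGroup N] [Module k N] {f g : NormalChains H G' M n →ₗ[k] N}
    (h : ∀ x m, f (mk H G' M x m) = g (mk H G' M x m)) : f = g := by
  refine Submodule.linearMap_qext _ (Representation.Coinvariants.hom_ext ?_)
  refine TensorProduct.ext (MonoidAlgebra.lhom_ext' fun x => ?_)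
  ext m
  exact h x m

/-- The map defined by an `H`-invariant function of a tuple and a coefficient which vanishes on the
tuples in left cosets of `G'`. -/
def lift {N : Type*} [AddCommGroup N] [Module k N] (φ : (Fin (n + 1) → G) → M →ₗ[k] N)
    (hφ : ∀ h ∈ H, ∀ x m, φ (h • x) (M.ρ h m) = φ x m)
    (hG' : ∀ x, InLeftCoset G' x → ∀ m, φ x m = 0) : NormalChains H G' M n →ₗ[k] N :=
  Submodule.liftQ _ (Representation.Coinvariants.lift _
    (TensorProduct.lift (Finsupp.lift _ k _ φ ∘ₗ (MonoidAlgebra.coeffLinearEquiv k).toLinearMap))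
    fun h => by
      refine TensorProduct.ext (MonoidAlgebra.lhom_ext' fun x => ?_)
      ext m
      simpa using hφ h h.2 x m) <| Submodule.span_le.2 <| by
    rintro _ ⟨x, m, hx, rfl⟩
    simpa using hG' x hx m

lemma lift_mk {N : Type*} [AddCommGroup N] [Module k N] (φ : (Fin (n + 1) → G) → M →ₗ[k] N)
    (hφ : ∀ h ∈ H, ∀ x m, φ (h • x) (M.ρ h m) = φ x m)
    (hG' : ∀ x, InLeftCoset G' x → ∀ m, φ x m = 0) (x : Fin (n + 1) → G) (m : M) :
    lift φ hφ hG' (mk H G' M x m) = φ x m := by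
  simp [lift, mk, lmk]

/-- The map `x ⊗ m ↦ θ x ⊗ f m`. -/
def map {l : ℕ} (θ : (Fin (n + 1) → G) → (Fin (l + 1) → G)) (f : M →ₗ[k] M)
    (hθ : ∀ h ∈ H, ∀ x m, mk H G' M (θ (h • x)) (f (M.ρ h m)) = mk H G' M (θ x) (f m))
    (hG' : ∀ x, InLeftCoset G' x → InLeftCoset G' (θ x)) :
    NormalChains H G' M n →ₗ[k] NormalChains H G' M l :=
  lift (fun x => lmk H G' M (θ x) ∘ₗ f) hθ fun x hx m => mk_eq_zero (hG' x hx) (f m)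

lemma map_mk {l : ℕ} (θ : (Fin (n + 1) → G) → (Fin (l + 1) → G)) (f : M →ₗ[k] M)
    (hθ : ∀ h ∈ H, ∀ x m, mk H G' M (θ (h • x)) (f (M.ρ h m)) = mk H G' M (θ x) (f m))
    (hG' : ∀ x, InLeftCoset G' x → InLeftCoset G' (θ x)) (x : Fin (n + 1) → G) (m : M) :
    map θ f hθ hG' (mk H G' M x m) = mk H G' M (θ x) (f m) :=
  lift_mk ..

variable (H G' M) in
/-- The map `x ⊗ m ↦ (x ∘ α) ⊗ m` for a map `α` of indices. -/
def reindex {l : ℕ} (α : Fin (l + 1) → Fin (n + 1)) :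
    NormalChains H G' M n →ₗ[k] NormalChains H G' M l :=
  map (fun x => x ∘ α) LinearMap.id (fun _ hh x m => mk_smul hh (x ∘ α) m)
    fun _ hx i j => hx (α i) (α j)

lemma reindex_mk {l : ℕ} (α : Fin (l + 1) → Fin (n + 1)) (x : Fin (n + 1) → G) (m : M) :
    reindex H G' M α (mk H G' M x m) = mk H G' M (x ∘ α) m :=
  map_mk ..

variable (H G' M) in
/-- The action of `g` on tuples by left translation and on `M`. -/
def act [H.Normal] (n : ℕ) (g : G) : NormalChains H G' M n →ₗ[k] NormalChains H G' M n :=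
  map (fun x => g • x) (M.ρ g)
    (fun h hh x m => by
      have h₁ : g • h • x = (g * h * g⁻¹) • g • x := by simp [smul_smul]
      have h₂ : M.ρ g (M.ρ h m) = M.ρ (g * h * g⁻¹) (M.ρ g m) := by
        rw [← Module.End.mul_apply, ← Module.End.mul_apply, ← map_mul, ← map_mul]
        simp
      rw [h₁, h₂, mk_smul (Subgroup.Normal.conj_mem ‹_› h hh g)])
    fun x hx i j => by simpa [mul_assoc] using hx i j

lemma act_mk [H.Normal] (g : G) (x : Fin (n + 1) → G) (m : M) :
    act H G' M n g (mk H G' M x m) = mk H G' M (g • x) (M.ρ g m) :=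
  map_mk ..

end NormalChains

open NormalChains

/-- The simplicial module with `n`-simplices `NormalChains H G' M n`. -/
def normalSimplicial : SimplicialObject (ModuleCat.{max w u v} k) where
  obj n := ModuleCat.of k (NormalChains H G' M n.unop.len)
  map α := ModuleCat.ofHom <| reindex H G' M α.unop.toOrderHom
  map_id n := ModuleCat.hom_ext <| lhom_ext fun x m => reindex_mk _ x m
  map_comp α β := ModuleCat.hom_ext <| lhom_ext fun x m => by
    refine (reindex_mk _ x m).trans (Eq.symm ?_)
    exact (congrArg (reindex H G' M β.unop.toOrderHom) (reindex_mk _ x m)).trans (reindex_mk _ _ m)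

/-- The alternating face map complex of `normalSimplicial`. -/
def normalComplex : ChainComplex (ModuleCat.{max w u v} k) ℕ :=
  (AlgebraicTopology.alternatingFaceMapComplex _).obj (normalSimplicial H G' M)

lemma normalComplex_d_mk (n : ℕ) (x : Fin (n + 2) → G) (m : M) :
    ((normalComplex H G' M).d (n + 1) n).hom (mk H G' M x m) =
      ∑ i : Fin (n + 2), (-1 : ℤ) ^ (i : ℕ) • mk H G' M (x ∘ i.succAbove) m := by
  let D : NormalChains H G' M (n + 1) →ₗ[k] NormalChains H G' M n :=
    ((normalComplex H G' M).d (n + 1) n).hom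
  have h : D = ∑ i : Fin (n + 2), (-1 : ℤ) ^ (i : ℕ) • reindex H G' M i.succAbove :=
    (congrArg ModuleCat.Hom.hom
      (AlgebraicTopology.alternatingFaceMapComplex_obj_d (normalSimplicial H G' M) n)).trans
      ((ModuleCat.hom_sum _ _).trans (Finset.sum_congr rfl fun i _ => ModuleCat.hom_zsmul _ _))
  change D (mk H G' M x m) = _
  rw [h, LinearMap.sum_apply]
  refine Finset.sum_congr rfl fun i _ => ?_
  rw [LinearMap.smul_apply, reindex_mk]

variable {H G' M} in
/-- The projection `x ⊗ m ↦ x ⊗ m` onto the relative chains of `G` modulo `G'`. -/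
def normalToRel (q : ℕ) : NormalChains H G' M q →ₗ[k] RelChains M G' q :=
  lift (fun x => RelChains.lmk M G' x) (fun h _ x m => RelChains.mk_smul h x m)
    fun _ hx m => RelChains.mk_eq_zero hx m

variable {H G' M} in
lemma normalToRel_mk {q : ℕ} (x : Fin (q + 1) → G) (m : M) :
    normalToRel q (mk H G' M x m) = RelChains.mk M G' x m :=
  lift_mk ..

variable [H.Normal]

/-- The action of `G` on `NormalChains H G' M n`. -/
def normalRepresentation (n : ℕ) : Representation k G (NormalChains H G' M n) where
  toFun g := act H G' M n g
  map_one' := lhom_ext fun x m => by simp [act_mk]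
  map_mul' g g' := lhom_ext fun x m => by
    rw [Module.End.mul_apply, act_mk, act_mk, act_mk, smul_smul, map_mul, Module.End.mul_apply]

instance (n : ℕ) : Representation.IsTrivial ((normalRepresentation H G' M n).comp H.subtype) where
  out h := lhom_ext fun x m => (act_mk (h : G) x m).trans (mk_smul h.2 x m)

/-- The action of `g` as a map of simplicial modules. -/
def normalSimplicialAct (g : G) : normalSimplicial H G' M ⟶ normalSimplicial H G' M where
  app n := ModuleCat.ofHom <| act H G' M n.unop.len g
  naturality _ _ α := ModuleCat.hom_ext <| lhom_ext fun x m =>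
    (congrArg (act H G' M _ g) (reindex_mk α.unop.toOrderHom x m)).trans <| (act_mk g _ m).trans <|
      ((congrArg (reindex H G' M α.unop.toOrderHom) (act_mk g x m)).trans (reindex_mk _ _ _)).symm

/-- The action of `G / H` on the terms of `normalComplex`. -/
def normalQuotientRepresentation (n : ℕ) :
    Representation k (G ⧸ H) (NormalChains H G' M n) :=
  (normalRepresentation H G' M n).ofQuotient H

lemma normalQuotientRepresentation_mk (n : ℕ) (g : G) (x : Fin (n + 1) → G) (m : M) :
    normalQuotientRepresentation H G' M n (g : G ⧸ H) (mk H G' M x m) =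
      mk H G' M (g • x) (M.ρ g m) :=
  act_mk g x m

lemma normalComplex_d_rho (n : ℕ) (g : G ⧸ H) (c : NormalChains H G' M (n + 1)) :
    ((normalComplex H G' M).d (n + 1) n).hom (normalQuotientRepresentation H G' M (n + 1) g c) =
      normalQuotientRepresentation H G' M n g (((normalComplex H G' M).d (n + 1) n).hom c) := by
  induction g using QuotientGroup.induction_on with
  | H g =>
    exact LinearMap.congr_fun (congrArg ModuleCat.Hom.hom
      (((AlgebraicTopology.alternatingFaceMapComplex _).map
        (normalSimplicialAct H G' M g)).comm (n + 1) n)) c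

/-- The `G / H`-module of `n`-chains. -/
abbrev normalRep (n : ℕ) : Rep.{max w u v} k (G ⧸ H) :=
  Rep.of (normalQuotientRepresentation H G' M n)

/-- Chains on `G / H` with coefficients in `NormalChains` are determined by their values on the
generators `y ⊗ (x ⊗ m)`. -/
lemma normalRep_chains_ext {p q : ℕ} {N : Type*} [AddCommGroup N] [Module k N]
    {f g : Chains (normalRep H G' M q) p →ₗ[k] N}
    (h : ∀ y x m, f (Chains.mk (normalRep H G' M q) y (mk H G' M x m)) =
      g (Chains.mk (normalRep H G' M q) y (mk H G' M x m))) : f = g := by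
  refine Chains.lhom_ext fun y c => ?_
  have : f ∘ₗ Chains.lmk (normalRep H G' M q) y = g ∘ₗ Chains.lmk (normalRep H G' M q) y :=
    lhom_ext fun x m => h y x m
  exact LinearMap.congr_fun this c

/-- The augmentation `y ⊗ (x ⊗ m) ↦ x ⊗ m`. -/
def normalAugmentation (q : ℕ) : Chains (normalRep H G' M q) 0 →ₗ[k] RelChains M G' q :=
  Chains.lift (fun _ => normalToRel q) fun g y c => by
    induction g using QuotientGroup.induction_on with
    | H g =>
      refine LinearMap.congr_fun (f := normalToRel q ∘ₗ normalQuotientRepresentation H G' M q g)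
        (g := normalToRel q) (lhom_ext fun x m => ?_) c
      rw [LinearMap.comp_apply, normalQuotientRepresentation_mk, normalToRel_mk, normalToRel_mk,
        RelChains.mk_smul]

lemma normalAugmentation_mk {q : ℕ} (y : Fin 1 → G ⧸ H) (x : Fin (q + 1) → G) (m : M) :
    normalAugmentation H G' M q (Chains.mk (normalRep H G' M q) y (mk H G' M x m)) =
      RelChains.mk M G' x m :=
  (Chains.lift_mk ..).trans (normalToRel_mk x m)

/-- The section `x ⊗ m ↦ [x₀] ⊗ (x ⊗ m)` of the augmentation. -/
def normalSection (q : ℕ) : RelChains M G' q →ₗ[k] Chains (normalRep H G' M q) 0 :=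
  RelChains.lift
    (fun x => Chains.lmk (normalRep H G' M q) (fun _ => (x 0 : G ⧸ H)) ∘ₗ lmk H G' M x)
    (fun g x m => by
      have := Chains.mk_smul (A := normalRep H G' M q) (n := 0) (g : G ⧸ H)
        (fun _ => (x 0 : G ⧸ H)) (mk H G' M x m)
      refine Eq.trans (congrArg (Chains.mk (normalRep H G' M q) _) ?_) this
      exact (normalQuotientRepresentation_mk H G' M q g x m).symm)
    (fun x m hx => by
      have h : mk H G' M x m = 0 := mk_eq_zero (fun i j => G'.mul_mem (G'.inv_mem (hx i)) (hx j)) m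
      exact (congrArg (Chains.lmk (normalRep H G' M q) _) h).trans (map_zero _))

lemma normalSection_mk {q : ℕ} (x : Fin (q + 1) → G) (m : M) :
    normalSection H G' M q (RelChains.mk M G' x m) =
      Chains.mk (normalRep H G' M q) (fun _ => (x 0 : G ⧸ H)) (mk H G' M x m) :=
  RelChains.lift_mk ..

variable {H G' M} in
/-- The map `x ⊗ m ↦ ([x₀], y) ⊗ (x ⊗ m)` for a tuple `y`. -/
def normalCone {p : ℕ} (q : ℕ) (y : Fin (p + 1) → G ⧸ H) :
    NormalChains H G' M q →ₗ[k] Chains (normalRep H G' M q) (p + 1) :=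
  lift (fun x => Chains.lmk (normalRep H G' M q)
      (Fin.cons (x 0 : G ⧸ H) y : Fin (p + 2) → G ⧸ H) ∘ₗ lmk H G' M x)
    (fun h hh x m => by
      have h₁ : (((h • x) 0 : G) : G ⧸ H) = (x 0 : G ⧸ H) := by
        simp [(QuotientGroup.eq_one_iff h).2 hh]
      rw [LinearMap.comp_apply, LinearMap.comp_apply, h₁]
      exact congrArg (Chains.lmk (normalRep H G' M q) _) (mk_smul hh x m))
    (fun x hx m => (congrArg (Chains.lmk (normalRep H G' M q) _) (mk_eq_zero hx m)).trans
      (map_zero _))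

variable {H G' M} in
lemma normalCone_mk {p q : ℕ} (y : Fin (p + 1) → G ⧸ H) (x : Fin (q + 1) → G) (m : M) :
    normalCone q y (mk H G' M x m) = Chains.mk (normalRep H G' M q)
      (Fin.cons (x 0 : G ⧸ H) y : Fin (p + 2) → G ⧸ H) (mk H G' M x m) :=
  lift_mk ..

/-- The contraction `y ⊗ (x ⊗ m) ↦ ([x₀], y) ⊗ (x ⊗ m)`. -/
def normalContraction (p q : ℕ) :
    Chains (normalRep H G' M q) p →ₗ[k] Chains (normalRep H G' M q) (p + 1) :=
  Chains.lift (normalCone q) fun g y c => by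
    induction g using QuotientGroup.induction_on with
    | H g =>
      refine LinearMap.congr_fun
        (f := normalCone q ((g : G ⧸ H) • y) ∘ₗ normalQuotientRepresentation H G' M q g)
        (g := normalCone q y) (lhom_ext fun x m => ?_) c
      rw [LinearMap.comp_apply, normalQuotientRepresentation_mk, normalCone_mk, normalCone_mk]
      refine Eq.trans (congrArg₂ (Chains.mk (normalRep H G' M q)) ?_
          (normalQuotientRepresentation_mk H G' M q g x m).symm)
        (Chains.mk_smul (A := normalRep H G' M q) (g : G ⧸ H)
          (Fin.cons (x 0 : G ⧸ H) y : Fin (p + 2) → G ⧸ H) (mk H G' M x m))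
      funext i
      refine Fin.cases ?_ (fun i => ?_) i <;> simp

lemma normalContraction_mk {p q : ℕ} (y : Fin (p + 1) → G ⧸ H) (x : Fin (q + 1) → G) (m : M) :
    normalContraction H G' M p q (Chains.mk (normalRep H G' M q) y (mk H G' M x m)) =
      Chains.mk (normalRep H G' M q) (Fin.cons (x 0 : G ⧸ H) y : Fin (p + 2) → G ⧸ H)
        (mk H G' M x m) :=
  (Chains.lift_mk ..).trans (normalCone_mk y x m)

/-- The horizontal differential. -/
abbrev normalD (p q : ℕ) :
    Chains (normalRep H G' M q) (p + 1) →ₗ[k] Chains (normalRep H G' M q) p :=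
  ((chainsComplex (normalRep H G' M q)).d (p + 1) p).hom

lemma normalD_mk (p q : ℕ) (y : Fin (p + 2) → G ⧸ H) (c : normalRep H G' M q) :
    normalD H G' M p q (Chains.mk _ y c) =
      ∑ i : Fin (p + 2), (-1 : ℤ) ^ (i : ℕ) • Chains.mk _ (y ∘ i.succAbove) c :=
  chainsComplex_d_mk _ p y c

lemma normalD_contraction_zero (q : ℕ) (c : Chains (normalRep H G' M q) 0) :
    normalD H G' M 0 q (normalContraction H G' M 0 q c) =
      c - normalSection H G' M q (normalAugmentation H G' M q c) := by
  refine LinearMap.congr_fun (f := normalD H G' M 0 q ∘ₗ normalContraction H G' M 0 q)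
    (g := LinearMap.id - normalSection H G' M q ∘ₗ normalAugmentation H G' M q)
    (normalRep_chains_ext H G' M fun y x m => ?_) c
  rw [LinearMap.comp_apply, normalContraction_mk, normalD_mk, LinearMap.sub_apply,
    LinearMap.comp_apply, normalAugmentation_mk, normalSection_mk, Fin.sum_univ_two,
    LinearMap.id_apply, sub_eq_add_neg]
  have h : (Fin.cons (x 0 : G ⧸ H) y : Fin 2 → G ⧸ H) ∘ Fin.succAbove 1 = fun _ => (x 0 : G ⧸ H) :=
    funext fun i => by fin_cases i; rfl
  simp only [Fin.val_zero, pow_zero, one_smul, Fin.val_one, pow_one, neg_smul, h]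
  rfl

lemma normalD_contraction_succ (p q : ℕ) (c : Chains (normalRep H G' M q) (p + 1)) :
    normalD H G' M (p + 1) q (normalContraction H G' M (p + 1) q c) =
      c - normalContraction H G' M p q (normalD H G' M p q c) := by
  refine LinearMap.congr_fun (f := normalD H G' M (p + 1) q ∘ₗ normalContraction H G' M (p + 1) q)
    (g := LinearMap.id - normalContraction H G' M p q ∘ₗ normalD H G' M p q)
    (normalRep_chains_ext H G' M fun y x m => ?_) c
  rw [LinearMap.comp_apply, normalContraction_mk, normalD_mk, LinearMap.sub_apply,
    LinearMap.comp_apply, normalD_mk, Fin.sum_univ_succ, LinearMap.id_apply, sub_eq_add_neg,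
    map_sum, ← Finset.sum_neg_distrib]
  refine congrArg₂ _ ?_ (Finset.sum_congr rfl fun i _ => ?_)
  · simp only [Fin.val_zero, pow_zero, one_smul]
    rfl
  · rw [map_zsmul, normalContraction_mk, Fin.val_succ, pow_succ, mul_neg_one, neg_smul]
    congr 3
    funext j
    refine Fin.cases ?_ (fun j => ?_) j <;> simp

lemma normalAugmentation_section (q : ℕ) (c : RelChains M G' q) :
    normalAugmentation H G' M q (normalSection H G' M q c) = c := by
  refine LinearMap.congr_fun (f := normalAugmentation H G' M q ∘ₗ normalSection H G' M q)
    (g := LinearMap.id) (RelChains.lhom_ext fun x m => ?_) c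
  rw [LinearMap.comp_apply, normalSection_mk, normalAugmentation_mk, LinearMap.id_apply]

lemma normalAugmentation_normalD (q : ℕ) (c : Chains (normalRep H G' M q) 1) :
    normalAugmentation H G' M q (normalD H G' M 0 q c) = 0 := by
  refine LinearMap.congr_fun (f := normalAugmentation H G' M q ∘ₗ normalD H G' M 0 q)
    (g := 0) (normalRep_chains_ext H G' M fun y x m => ?_) c
  rw [LinearMap.comp_apply, normalD_mk, Fin.sum_univ_two, map_add, map_zsmul, map_zsmul,
    normalAugmentation_mk, normalAugmentation_mk]
  simp

lemma normalAugmentation_eq_zero_iff (q : ℕ) (c : Chains (normalRep H G' M q) 0) :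
    normalAugmentation H G' M q c = 0 ↔ ∃ w, normalD H G' M 0 q w = c := by
  constructor
  · intro h
    refine ⟨_, (normalD_contraction_zero H G' M q c).trans ?_⟩
    rw [h, map_zero, sub_zero]
  · rintro ⟨w, rfl⟩
    exact normalAugmentation_normalD H G' M q w

/-- The rows are exact in positive degrees. -/
lemma exists_normalD_eq (p q : ℕ) (c : Chains (normalRep H G' M q) (p + 1))
    (h : normalD H G' M p q c = 0) : ∃ w, normalD H G' M (p + 1) q w = c := by
  refine ⟨_, (normalD_contraction_succ H G' M p q c).trans ?_⟩
  rw [h, map_zero, sub_zero]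

lemma relComplex_d_normalAugmentation (q : ℕ) (c : Chains (normalRep H G' M (q + 1)) 0) :
    ((relComplex M G').d (q + 1) q).hom (normalAugmentation H G' M (q + 1) c) =
      normalAugmentation H G' M q (Chains.coeff (A := normalRep H G' M (q + 1))
        (B := normalRep H G' M q) ((normalComplex H G' M).d (q + 1) q).hom
        (normalComplex_d_rho H G' M q) 0 c) := by
  let D : RelChains M G' (q + 1) →ₗ[k] RelChains M G' q := ((relComplex M G').d (q + 1) q).hom
  refine LinearMap.congr_fun (f := D ∘ₗ normalAugmentation H G' M (q + 1))
    (g := normalAugmentation H G' M q ∘ₗ Chains.coeff (A := normalRep H G' M (q + 1))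
        (B := normalRep H G' M q) ((normalComplex H G' M).d (q + 1) q).hom
        (normalComplex_d_rho H G' M q) 0) (normalRep_chains_ext H G' M fun y x m => ?_) c
  rw [LinearMap.comp_apply, normalAugmentation_mk]
  refine (relComplex_d_mk q x m).trans (Eq.symm ?_)
  refine (congrArg (normalAugmentation H G' M q) (Chains.coeff_mk (A := normalRep H G' M (q + 1))
    (B := normalRep H G' M q) _ (normalComplex_d_rho H G' M q) y (mk H G' M x m))).trans ?_
  refine (congrArg (normalAugmentation H G' M q ∘ₗ Chains.lmk (normalRep H G' M q) y)
    (normalComplex_d_mk H G' M q x m)).trans ?_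
  refine (map_sum (normalAugmentation H G' M q ∘ₗ Chains.lmk (normalRep H G' M q) y) _ _).trans ?_
  refine Finset.sum_congr rfl fun i _ => (map_zsmul _ _ _).trans (congrArg _ ?_)
  exact normalAugmentation_mk H G' M y _ m

end NormalChains

/-! ### Comparison with the relative homology of `H` -/

lemma relSimplicialMap_app_mk {k : Type w} [CommRing k] {Γ Δ : Type u} [Group Γ] [Group Δ]
    {A : Rep.{v} k Γ} {B : Rep.{v} k Δ} {S : Subgroup Γ} {T : Subgroup Δ} (φ : Γ →* Δ)
    (f : A →ₗ[k] B) (hf : ∀ g a, f (A.ρ g a) = B.ρ (φ g) (f a)) (hS : ∀ x ∈ S, φ x ∈ T)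
    (n : SimplexCategoryᵒᵖ) (x : Fin (n.unop.len + 1) → Γ) (a : A) :
    ((relSimplicialMap φ f hf hS).app n).hom (RelChains.mk A S x a) =
      RelChains.mk B T (φ ∘ x) (f a) :=
  RelChains.push_mk φ f hf hS _ x a

section NormalHomology

open NormalChains

variable {k : Type w} [CommRing k] {G : Type u} [Group G] {H G' : Subgroup G} (M : Rep.{v} k G)

/-- The tuple `(x₀, …, xᵢ, xᵢ τ(xᵢ), …, xₙ τ(xₙ))`. -/
def twistPrism {n : ℕ} (τ : G → G) (i : Fin (n + 1)) (x : Fin (n + 1) → G) : Fin (n + 2) → G :=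
  fun j => x (i.predAbove j) * if j ≤ i.castSucc then 1 else τ (x (i.predAbove j))

lemma mul_mem_of_inLeftCoset {n : ℕ} {x : Fin (n + 1) → G} (hx : InLeftCoset G' x) {s t : G}
    (hs : s ∈ G') (ht : t ∈ G') (i j : Fin (n + 1)) : (x i * s)⁻¹ * (x j * t) ∈ G' := by
  have : (x i * s)⁻¹ * (x j * t) = s⁻¹ * ((x i)⁻¹ * x j) * t := by group
  rw [this]
  exact G'.mul_mem (G'.mul_mem (G'.inv_mem hs) (hx i j)) ht

section Twist

variable {τ : G → G} (hH : ∀ h ∈ H, ∀ x, τ (h * x) = τ x) (hG' : ∀ x, τ x ∈ G')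

/-- The map `(x₀, …, xₙ) ⊗ m ↦ (x₀ τ(x₀), …, xₙ τ(xₙ)) ⊗ m`, for a function `τ : H \ G → G'`. -/
def twist (n : ℕ) : NormalChains H G' M n →ₗ[k] NormalChains H G' M n :=
  NormalChains.map (fun x i => x i * τ (x i)) LinearMap.id
    (fun h hh x m => by
      have : (fun i => (h • x) i * τ ((h • x) i)) = h • fun i => x i * τ (x i) :=
        funext fun i => by simp [hH h hh, mul_assoc]
      rw [this]
      exact mk_smul hh _ m)
    fun x hx i j => mul_mem_of_inLeftCoset hx (hG' _) (hG' _) i j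

lemma twist_mk {n : ℕ} (x : Fin (n + 1) → G) (m : M) :
    twist M hH hG' n (mk H G' M x m) = mk H G' M (fun i => x i * τ (x i)) m :=
  map_mk ..

/-- `twist` as a map of simplicial modules. -/
def twistSimplicial : normalSimplicial H G' M ⟶ normalSimplicial H G' M where
  app n := ModuleCat.ofHom <| twist M hH hG' n.unop.len
  naturality _ _ α := ModuleCat.hom_ext <| lhom_ext fun x m =>
    (congrArg (twist M hH hG' _) (reindex_mk α.unop.toOrderHom x m)).trans <|
      (twist_mk M hH hG' _ m).trans
        ((congrArg (reindex H G' M α.unop.toOrderHom) (twist_mk M hH hG' x m)).trans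
          (reindex_mk _ _ _)).symm

/-- The prism operator of the homotopy between the identity and `twist`. -/
def twistPrismMap {n : ℕ} (i : Fin (n + 1)) :
    NormalChains H G' M n →ₗ[k] NormalChains H G' M (n + 1) :=
  NormalChains.map (twistPrism τ i) LinearMap.id
    (fun h hh x m => by
      have : twistPrism τ i (h • x) = h • twistPrism τ i x :=
        funext fun j => by simp [twistPrism, hH h hh, mul_assoc]
      rw [this]
      exact mk_smul hh _ m)
    fun x hx j j' => by
      have h (j) : (if j ≤ i.castSucc then 1 else τ (x (i.predAbove j))) ∈ G' := by
        split_ifs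
        exacts [G'.one_mem, hG' _]
      exact mul_mem_of_inLeftCoset hx (h j) (h j') _ _

lemma twistPrismMap_mk {n : ℕ} (i : Fin (n + 1)) (x : Fin (n + 1) → G) (m : M) :
    twistPrismMap M hH hG' i (mk H G' M x m) = mk H G' M (twistPrism τ i x) m :=
  map_mk ..

lemma reindex_comp_twistPrismMap {m n : ℕ} (i : Fin (m + 1)) (j : Fin (n + 1))
    (α : Fin (n + 2) → Fin (m + 2)) (β : Fin (n + 1) → Fin (m + 1))
    (h : ∀ t, i.predAbove (α t) = β (j.predAbove t) ∧ (α t ≤ i.castSucc ↔ t ≤ j.castSucc)) :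
    reindex H G' M α ∘ₗ twistPrismMap M hH hG' i = twistPrismMap M hH hG' j ∘ₗ reindex H G' M β :=
  lhom_ext fun x a => by
    rw [LinearMap.comp_apply, LinearMap.comp_apply, reindex_mk, twistPrismMap_mk,
      reindex_mk, twistPrismMap_mk]
    congr 1
    funext t
    simp only [twistPrism, Function.comp_apply, (h t).1, (h t).2]

/-- Translating each entry of a tuple from the right by an element of `G'` which depends only on its
coset modulo `H` is homotopic to the identity. -/
def twistHomotopy : SimplicialObject.Homotopy (𝟙 (normalSimplicial H G' M))
    (twistSimplicial M hH hG') where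
  h i := ModuleCat.ofHom (twistPrismMap M hH hG' i)
  h_zero_comp_δ_zero n := ModuleCat.hom_ext <| show
      reindex H G' M (Fin.succAbove 0) ∘ₗ twistPrismMap M hH hG' (0 : Fin (n + 1)) =
        twist M hH hG' n from
    lhom_ext fun x a => by
      rw [LinearMap.comp_apply, twistPrismMap_mk, reindex_mk, twist_mk]
      congr 1
  h_last_comp_δ_last n := ModuleCat.hom_ext <| show
      reindex H G' M (Fin.succAbove (Fin.last (n + 1))) ∘ₗ
        twistPrismMap M hH hG' (Fin.last n) = LinearMap.id from
    lhom_ext fun x a => by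
      rw [LinearMap.comp_apply, twistPrismMap_mk, reindex_mk, LinearMap.id_apply]
      congr 1
      funext t
      simp [twistPrism, Fin.le_last]
  h_succ_comp_δ_castSucc_of_lt {n} i j hij := ModuleCat.hom_ext <| show
      reindex H G' M (Fin.succAbove i.castSucc) ∘ₗ twistPrismMap M hH hG' j.succ =
        twistPrismMap M hH hG' j ∘ₗ reindex H G' M (Fin.succAbove i) from
    reindex_comp_twistPrismMap M hH hG' _ _ _ _ fun t => by
      simp only [Fin.le_def, Fin.val_castSucc] at hij
      simp only [Fin.ext_iff, Fin.le_def, val_predAbove, val_succAbove, Fin.val_castSucc,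
        Fin.val_succ]
      constructor <;> split_ifs <;> omega
  h_succ_comp_δ_castSucc_succ {n} j := ModuleCat.hom_ext <| show
      reindex H G' M (Fin.succAbove j.castSucc.succ) ∘ₗ twistPrismMap M hH hG' j.succ =
        reindex H G' M (Fin.succAbove j.castSucc.succ) ∘ₗ
          twistPrismMap M hH hG' j.castSucc from
    lhom_ext fun x a => by
      rw [LinearMap.comp_apply, LinearMap.comp_apply, twistPrismMap_mk, reindex_mk,
        twistPrismMap_mk, reindex_mk]
      congr 1
      funext t
      have h : j.succ.predAbove (j.castSucc.succ.succAbove t) =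
            j.castSucc.predAbove (j.castSucc.succ.succAbove t) ∧
          (j.castSucc.succ.succAbove t ≤ j.succ.castSucc ↔
            j.castSucc.succ.succAbove t ≤ j.castSucc.castSucc) := by
        simp only [Fin.ext_iff, Fin.le_def, val_predAbove, val_succAbove, Fin.val_castSucc,
          Fin.val_succ]
        constructor <;> split_ifs <;> omega
      simp only [twistPrism, Function.comp_apply, h.1, h.2]
  h_castSucc_comp_δ_succ_of_lt {n} i j hji := ModuleCat.hom_ext <| show
      reindex H G' M (Fin.succAbove i.succ) ∘ₗ twistPrismMap M hH hG' j.castSucc =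
        twistPrismMap M hH hG' j ∘ₗ reindex H G' M (Fin.succAbove i) from
    reindex_comp_twistPrismMap M hH hG' _ _ _ _ fun t => by
      simp only [Fin.lt_def, Fin.val_castSucc] at hji
      simp only [Fin.ext_iff, Fin.le_def, val_predAbove, val_succAbove, Fin.val_castSucc,
        Fin.val_succ]
      constructor <;> split_ifs <;> omega
  h_comp_σ_castSucc_of_le {n} i j hij := ModuleCat.hom_ext <| show
      reindex H G' M (Fin.predAbove i.castSucc) ∘ₗ twistPrismMap M hH hG' j =
        twistPrismMap M hH hG' j.succ ∘ₗ reindex H G' M (Fin.predAbove i) from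
    reindex_comp_twistPrismMap M hH hG' _ _ _ _ fun t => by
      simp only [Fin.le_def] at hij
      simp only [Fin.ext_iff, Fin.le_def, val_predAbove, Fin.val_castSucc, Fin.val_succ]
      constructor <;> split_ifs <;> omega
  h_comp_σ_succ_of_lt {n} i j hji := ModuleCat.hom_ext <| show
      reindex H G' M (Fin.predAbove i.succ) ∘ₗ twistPrismMap M hH hG' j =
        twistPrismMap M hH hG' j.castSucc ∘ₗ reindex H G' M (Fin.predAbove i) from
    reindex_comp_twistPrismMap M hH hG' _ _ _ _ fun t => by
      simp only [Fin.le_def] at hji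
      simp only [Fin.ext_iff, Fin.le_def, val_predAbove, Fin.val_castSucc, Fin.val_succ]
      constructor <;> split_ifs <;> omega

end Twist

/-- A choice, for each coset `H x`, of a representative `t x` in `G'`, with `t 1 = 1`. -/
structure CosetTransversal (H G' : Subgroup G) where
  /-- The representative of the coset of `x`. -/
  t : G → G
  mem : ∀ x, t x ∈ G'
  mul_inv_mem : ∀ x, x * (t x)⁻¹ ∈ H
  mul_left : ∀ h ∈ H, ∀ x, t (h * x) = t x
  eq_one : ∀ h ∈ H, t h = 1

lemma exists_mk_eq [H.Normal] (hQ : Function.Surjective (quotientComparison H G')) (c : G ⧸ H) :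
    ∃ g : G', ((g : G) : G ⧸ H) = c := by
  obtain ⟨g, hg⟩ := hQ c
  induction g using QuotientGroup.induction_on with
  | H g => exact ⟨g, hg⟩

lemma nonempty_cosetTransversal [H.Normal] (hQ : Function.Surjective (quotientComparison H G')) :
    Nonempty (CosetTransversal H G') := by
  choose s hs using exists_mk_eq hQ
  have h1 : ((s 1 : G) : G ⧸ H) = 1 := hs 1
  -- dividing by `s 1` normalizes the choice for the trivial coset
  have hmem (x : G) : (((s x : G) * (s 1 : G)⁻¹ : G) : G ⧸ H) = x := by
    rw [QuotientGroup.mk_mul, QuotientGroup.mk_inv, hs, h1, inv_one, mul_one]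
  refine ⟨⟨fun x => (s x : G) * (s 1 : G)⁻¹,
    fun x => G'.mul_mem (s x).2 (G'.inv_mem (s 1).2), fun x => ?_, fun h hh x => ?_,
    fun h hh => ?_⟩⟩
  · rw [← QuotientGroup.eq_one_iff, QuotientGroup.mk_mul, QuotientGroup.mk_inv, hmem,
      mul_inv_cancel]
  · rw [QuotientGroup.mk_mul, (QuotientGroup.eq_one_iff h).2 hh, one_mul]
  · rw [(QuotientGroup.eq_one_iff h).2 hh]
    exact mul_inv_cancel _

section Action

variable [H.Normal]

/-- The map of simplicial modules which induces `conjMap`. -/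
def conjSimplicial (g : G') : relSimplicial (Rep.res H.subtype M) (G'.subgroupOf H) ⟶
    relSimplicial (Rep.res H.subtype M) (G'.subgroupOf H) :=
  relSimplicialMap (MulAut.conjNormal (g : G)).toMonoidHom (M.ρ g)
    (fun h m => by
      change M.ρ g (M.ρ h m) = M.ρ (MulAut.conjNormal (g : G) h : H) (M.ρ g m)
      rw [MulAut.conjNormal_apply, ← Module.End.mul_apply, ← Module.End.mul_apply, ← map_mul,
        ← map_mul]
      congr 2
      group)
    fun x hx => by
      rw [Subgroup.mem_subgroupOf] at hx ⊢
      exact G'.mul_mem (G'.mul_mem g.2 hx) (G'.inv_mem g.2)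

lemma conjSimplicial_app_mk (g : G') (n : SimplexCategoryᵒᵖ) (x : Fin (n.unop.len + 1) → H)
    (m : M) :
    ((conjSimplicial M g).app n).hom
        (RelChains.mk (Rep.res H.subtype M) (G'.subgroupOf H) x m) =
      RelChains.mk (Rep.res H.subtype M) (G'.subgroupOf H)
        (fun i => MulAut.conjNormal (g : G) (x i)) (M.ρ g m) := by
  unfold conjSimplicial
  exact relSimplicialMap_app_mk (A := Rep.res H.subtype M) (B := Rep.res H.subtype M) ..

end Action

namespace CosetTransversal

variable (T : CosetTransversal H G')

/-- The component of `x` in `H`. -/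
def toH (x : G) : H := ⟨x * (T.t x)⁻¹, T.mul_inv_mem x⟩

lemma toH_mul {h : G} (hh : h ∈ H) (x : G) : T.toH (h * x) = ⟨h, hh⟩ * T.toH x :=
  Subtype.ext <| by
    change h * x * (T.t (h * x))⁻¹ = h * (x * (T.t x)⁻¹)
    rw [T.mul_left h hh, mul_assoc]

lemma toH_coe (h : H) : T.toH h = h :=
  Subtype.ext <| by
    change (h : G) * (T.t h)⁻¹ = h
    rw [T.eq_one h h.2, inv_one, mul_one]

/-- The retraction `x ⊗ m ↦ toH x ⊗ m` onto the relative chains of `H` modulo `H ∩ G'`. -/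
def retract (n : ℕ) :
    NormalChains H G' M n →ₗ[k] RelChains (Rep.res H.subtype M) (G'.subgroupOf H) n :=
  lift (fun x => RelChains.lmk (Rep.res H.subtype M) (G'.subgroupOf H) fun i => T.toH (x i))
    (fun h hh x m => by
      have : (fun i => T.toH ((h • x) i)) = (⟨h, hh⟩ : H) • fun i => T.toH (x i) :=
        funext fun i => T.toH_mul hh (x i)
      rw [this]
      exact RelChains.mk_smul (A := Rep.res H.subtype M) (⟨h, hh⟩ : H) (fun i => T.toH (x i)) m)
    fun _ hx m => RelChains.mk_eq_zero (A := Rep.res H.subtype M)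
      (fun i j => mul_mem_of_inLeftCoset hx (G'.inv_mem (T.mem _)) (G'.inv_mem (T.mem _)) i j) m

lemma retract_mk {n : ℕ} (x : Fin (n + 1) → G) (m : M) :
    T.retract M n (NormalChains.mk H G' M x m) =
      RelChains.mk (Rep.res H.subtype M) (G'.subgroupOf H) (fun i => T.toH (x i)) m :=
  lift_mk ..

/-- `retract` as a map of simplicial modules. -/
def retractSimplicial :
    normalSimplicial H G' M ⟶ relSimplicial (Rep.res H.subtype M) (G'.subgroupOf H) where
  app n := ModuleCat.ofHom <| T.retract M n.unop.len
  naturality _ _ α := ModuleCat.hom_ext <| lhom_ext fun x m =>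
    (congrArg (T.retract M _) (reindex_mk α.unop.toOrderHom x m)).trans <|
      (T.retract_mk M _ m).trans
        ((congrArg (RelChains.reindex _ _ α.unop.toOrderHom) (T.retract_mk M x m)).trans
          (RelChains.reindex_mk (A := Rep.res H.subtype M) _ _ m)).symm

end CosetTransversal

variable (H G')

/-- The inclusion of the relative chains of `H` modulo `H ∩ G'` in `NormalChains H G' M n`. -/
def inclusion (n : ℕ) :
    RelChains (Rep.res H.subtype M) (G'.subgroupOf H) n →ₗ[k] NormalChains H G' M n :=
  RelChains.lift (A := Rep.res H.subtype M) (fun x => lmk H G' M fun i => (x i : G))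
    (fun h _ m => mk_smul h.2 _ m)
    fun _ m hx => mk_eq_zero (fun i j => G'.mul_mem (G'.inv_mem (hx i)) (hx j)) m

lemma inclusion_mk {n : ℕ} (x : Fin (n + 1) → H) (m : M) :
    inclusion H G' M n (RelChains.mk (Rep.res H.subtype M) (G'.subgroupOf H) x m) =
      mk H G' M (fun i => (x i : G)) m :=
  RelChains.lift_mk (A := Rep.res H.subtype M) ..

/-- `inclusion` as a map of simplicial modules. -/
def inclusionSimplicial :
    relSimplicial (Rep.res H.subtype M) (G'.subgroupOf H) ⟶ normalSimplicial H G' M where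
  app n := ModuleCat.ofHom <| inclusion H G' M n.unop.len
  naturality _ _ α := ModuleCat.hom_ext <| RelChains.lhom_ext fun x m =>
    (congrArg (inclusion H G' M _) (RelChains.reindex_mk (A := Rep.res H.subtype M)
      α.unop.toOrderHom x m)).trans <| (inclusion_mk H G' M _ m).trans
        ((congrArg (reindex H G' M α.unop.toOrderHom) (inclusion_mk H G' M x m)).trans
          (reindex_mk _ _ _)).symm

variable {H G'}

/-- The homology of a simplicial module. -/
abbrev simplicialHomology (n : ℕ) : SimplicialObject (ModuleCat.{v} k) ⥤ ModuleCat.{v} k :=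
  AlgebraicTopology.alternatingFaceMapComplex _ ⋙ HomologicalComplex.homologyFunctor _ _ n

lemma simplicialHomology_map_twist {τ : G → G} (hH : ∀ h ∈ H, ∀ x, τ (h * x) = τ x)
    (hG' : ∀ x, τ x ∈ G') (n : ℕ) :
    (simplicialHomology n).map (twistSimplicial M hH hG') = 𝟙 _ :=
  ((twistHomotopy M hH hG').map_homology_eq n).symm.trans
    ((simplicialHomology n).map_id _)

namespace CosetTransversal

variable (T : CosetTransversal H G')

lemma inclusion_comp_retract : inclusionSimplicial H G' M ≫ T.retractSimplicial M = 𝟙 _ :=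
  NatTrans.ext <| funext fun n => ModuleCat.hom_ext <| RelChains.lhom_ext fun x m => by
    refine (congrArg (T.retract M n.unop.len) (inclusion_mk H G' M x m)).trans ?_
    refine (T.retract_mk M _ m).trans ?_
    simp only [toH_coe]
    rfl

lemma inv_mul_left (h : G) (hh : h ∈ H) (x : G) : (T.t (h * x))⁻¹ = (T.t x)⁻¹ := by
  rw [T.mul_left h hh]

lemma inv_mem (x : G) : (T.t x)⁻¹ ∈ G' := G'.inv_mem (T.mem x)

/-- The composition with the retraction is the translation by the elements `(t x)⁻¹`. -/
lemma retract_comp_inclusion : T.retractSimplicial M ≫ inclusionSimplicial H G' M =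
    twistSimplicial M (τ := fun x => (T.t x)⁻¹) T.inv_mul_left T.inv_mem :=
  NatTrans.ext <| funext fun n => ModuleCat.hom_ext <| lhom_ext fun x m => by
    refine (congrArg (inclusion H G' M n.unop.len) (T.retract_mk M x m)).trans ?_
    exact (inclusion_mk H G' M _ m).trans (twist_mk M (τ := fun x => (T.t x)⁻¹) T.inv_mul_left
      T.inv_mem x m).symm

/-- The maps `retract` and `inclusion` are inverse to each other in homology. -/
def homologyIso (n : ℕ) : (simplicialHomology n).obj (normalSimplicial H G' M) ≅
    (simplicialHomology n).obj
      (relSimplicial (Rep.res H.subtype M) (G'.subgroupOf H)) where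
  hom := (simplicialHomology n).map (T.retractSimplicial M)
  inv := (simplicialHomology n).map (inclusionSimplicial H G' M)
  hom_inv_id := by
    rw [← Functor.map_comp, retract_comp_inclusion, simplicialHomology_map_twist]
  inv_hom_id := by
    rw [← Functor.map_comp, inclusion_comp_retract]
    exact (simplicialHomology n).map_id _

section Action

variable [H.Normal]

/-- The isomorphism `homologyIso` is compatible with the actions of `G'`. -/
lemma act_comp_homologyIso (n : ℕ) (g : G') :
    (simplicialHomology n).map (normalSimplicialAct H G' M g) ≫ (T.homologyIso M n).hom =
      (T.homologyIso M n).hom ≫ conjMap H G' M n g := by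
  change _ = (T.homologyIso M n).hom ≫ (simplicialHomology n).map (conjSimplicial M g)
  rw [← Iso.inv_comp_eq, ← Category.assoc, ← Iso.eq_comp_inv]
  have hH : ∀ h ∈ H, ∀ x : G, (fun _ : G => (g : G)⁻¹) (h * x) = (fun _ : G => (g : G)⁻¹) x :=
    fun _ _ _ => rfl
  have hG' : ∀ x : G, (fun _ : G => (g : G)⁻¹) x ∈ G' := fun _ => G'.inv_mem g.2
  -- the tuples `g x` and `g x g⁻¹` differ by the right translation by `g⁻¹`
  have h : inclusionSimplicial H G' M ≫ normalSimplicialAct H G' M g ≫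
      twistSimplicial M hH hG' =
        conjSimplicial M g ≫ inclusionSimplicial H G' M :=
    NatTrans.ext <| funext fun n => ModuleCat.hom_ext <| RelChains.lhom_ext fun x m => by
      refine (congrArg (twist M hH hG' n.unop.len ∘ₗ act H G' M n.unop.len g)
        (inclusion_mk H G' M x m)).trans ?_
      refine (congrArg (twist M hH hG' n.unop.len) (act_mk (g : G) _ m)).trans ?_
      refine (twist_mk M hH hG' _ _).trans (Eq.symm ?_)
      refine (congrArg (inclusion H G' M n.unop.len) (conjSimplicial_app_mk M g n x m)).trans ?_
      refine (inclusion_mk H G' M _ _).trans ?_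
      rfl
  have h' := congrArg (simplicialHomology n).map h
  rw [Functor.map_comp, Functor.map_comp, Functor.map_comp, simplicialHomology_map_twist,
    Category.comp_id] at h'
  exact h'

end Action

/-- The class of a cycle in the relative homology of `H`. -/
def relClass (n : ℕ) :
    cycleModule (normalComplex H G' M) n →ₗ[k] relHomologyOfNormal H G' M n :=
  (T.homologyIso M n).hom.hom ∘ₗ homologyClass (normalComplex H G' M) n

lemma relClass_surjective (n : ℕ) : Function.Surjective (T.relClass M n) :=
  (T.homologyIso M n).toLinearEquiv.surjective.comp (homologyClass_surjective _ n)

lemma relClass_eq_zero_iff (n : ℕ) (z : cycleModule (normalComplex H G' M) n) :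
    T.relClass M n z = 0 ↔ ∃ b, ((normalComplex H G' M).d (n + 1) n).hom b = z :=
  (T.homologyIso M n).toLinearEquiv.map_eq_zero_iff.trans homologyClass_eq_zero_iff

lemma relClass_rho [H.Normal] (hQ : Function.Bijective (quotientComparison H G')) (n : ℕ)
    (c : G ⧸ H) (z : cycleModule (normalComplex H G' M) n) :
    T.relClass M n ((cycleRep (normalComplex H G' M) (normalQuotientRepresentation H G' M)
      (normalComplex_d_rho H G' M) n).ρ c z) = (relHomologyRep M hQ n).ρ c (T.relClass M n z) := by
  obtain ⟨g, rfl⟩ := exists_mk_eq hQ.2 c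
  refine Eq.trans ?_ (relHomologyRep_apply H G' M hQ n g _).symm
  refine Eq.trans ?_ (congrArg (fun f : (simplicialHomology n).obj (normalSimplicial H G' M) ⟶
      relHomologyOfNormal H G' M n => f.hom (homologyClass (normalComplex H G' M) n z))
    (T.act_comp_homologyIso M n g))
  refine congrArg (T.homologyIso M n).hom.hom ?_
  exact (homologyMap_homologyClass ((AlgebraicTopology.alternatingFaceMapComplex _).map
    (normalSimplicialAct H G' M g)) z.1 z.2 _).symm

end CosetTransversal

end NormalHomology

/-- The relative Lyndon/Hochschild–Serre spectral sequence, over an arbitrary ring. -/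
theorem exists_relative_spectralSequence {k : Type w} [CommRing k] {G : Type u} [Group G]
    (H G' : Subgroup G) [H.Normal] (M : Rep.{v} k G)
    (hQ : Function.Bijective (quotientComparison H G')) :
    ∃ E : E₂HomologicalSpectralSequence.{w, max w u v} k,
      (∀ (h₂ : (2 : ℤ) ≤ 2) (p q : ℕ),
        Nonempty ((E.page 2 h₂).X (p, q) ≅ groupHomology (relHomologyRep M hQ q) p)) ∧
      ConvergesTo E fun n => relHomology M G' n := by
  obtain ⟨T⟩ := nonempty_cosetTransversal hQ.2
  exact exists_hyperhomology_spectralSequence (normalComplex H G' M)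
    (normalQuotientRepresentation H G' M) (normalComplex_d_rho H G' M)
    (relHomologyRep M hQ) (T.relClass M) (T.relClass_surjective M) (T.relClass_eq_zero_iff M)
    (T.relClass_rho M hQ) (relComplex M G') (normalAugmentation H G' M)
    (fun q => Function.LeftInverse.surjective (normalAugmentation_section H G' M q))
    (normalAugmentation_eq_zero_iff H G' M) (relComplex_d_normalAugmentation H G' M)
    (exists_normalD_eq H G' M)

/-! ### Free coefficient modules with trivial action -/

section HomologyLift

variable {k : Type w} [CommRing k] {C : ChainComplex (ModuleCat.{v} k) ℕ} {n : ℕ} {N : Type v'}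
  [AddCommGroup N] [Module k N]

/-- The map on homology defined by a map on cycles which vanishes on boundaries. -/
def homologyLift (f : cycleModule C n →ₗ[k] N)
    (hf : ∀ b, f ⟨(C.d (n + 1) n).hom b, d_mem_cycleModule b⟩ = 0) : C.homology n →ₗ[k] N :=
  (LinearMap.ker (homologyClass C n)).liftQ f (fun z hz => by
      obtain ⟨b, hb⟩ := homologyClass_eq_zero_iff.1 hz
      rw [LinearMap.mem_ker, ← hf b]
      exact congrArg f (Subtype.ext hb.symm)) ∘ₗ
    (LinearMap.quotKerEquivOfSurjective _ (homologyClass_surjective C n)).symm.toLinearMap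

lemma homologyLift_homologyClass (f : cycleModule C n →ₗ[k] N)
    (hf : ∀ b, f ⟨(C.d (n + 1) n).hom b, d_mem_cycleModule b⟩ = 0) (z : cycleModule C n) :
    homologyLift f hf (homologyClass C n z) = f z := by
  rw [homologyLift, LinearMap.comp_apply]
  have h : (LinearMap.quotKerEquivOfSurjective _ (homologyClass_surjective C n)).symm
      (homologyClass C n z) = Submodule.Quotient.mk z := by
    rw [LinearEquiv.symm_apply_eq]
    rfl
  rw [LinearEquiv.coe_coe, h]
  rfl

end HomologyLift

section Coefficients

variable {k : Type w} [CommRing k] {Γ : Type u} [Group Γ] {A : Rep.{v} k Γ} {B : Rep.{v'} k Γ}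
  {S : Subgroup Γ}

/-- The map `x ⊗ a ↦ x ⊗ f a` on relative chains for an equivariant map `f`. -/
def RelChains.coeff (f : A →ₗ[k] B) (hf : ∀ g a, f (A.ρ g a) = B.ρ g (f a)) (n : ℕ) :
    RelChains A S n →ₗ[k] RelChains B S n :=
  RelChains.lift (fun x => RelChains.lmk B S x ∘ₗ f)
    (fun g x a => by
      rw [LinearMap.comp_apply, LinearMap.comp_apply, hf]
      exact RelChains.mk_smul g x (f a))
    fun _ a hx => RelChains.mk_eq_zero
      (fun i j => S.mul_mem (S.inv_mem (hx i)) (hx j)) (f a)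

lemma RelChains.coeff_mk (f : A →ₗ[k] B) (hf : ∀ g a, f (A.ρ g a) = B.ρ g (f a)) {n : ℕ}
    (x : Fin (n + 1) → Γ) (a : A) :
    RelChains.coeff f hf n (RelChains.mk A S x a) = RelChains.mk B S x (f a) :=
  RelChains.lift_mk ..

lemma relComplex_d_coeff (f : A →ₗ[k] B) (hf : ∀ g a, f (A.ρ g a) = B.ρ g (f a)) {n : ℕ}
    (c : RelChains A S (n + 1)) :
    ((relComplex B S).d (n + 1) n).hom (RelChains.coeff f hf (n + 1) c) =
      RelChains.coeff f hf n (((relComplex A S).d (n + 1) n).hom c : RelChains A S n) := by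
  let D₁ : RelChains A S (n + 1) →ₗ[k] RelChains A S n := ((relComplex A S).d (n + 1) n).hom
  let D₂ : RelChains B S (n + 1) →ₗ[k] RelChains B S n := ((relComplex B S).d (n + 1) n).hom
  have : D₂ ∘ₗ RelChains.coeff f hf (n + 1) = RelChains.coeff f hf n ∘ₗ D₁ :=
    RelChains.lhom_ext fun x a => by
      have h₁ : D₁ (RelChains.mk A S x a) = ∑ i : Fin (n + 2), (-1 : ℤ) ^ (i : ℕ) •
        RelChains.mk A S (x ∘ i.succAbove) a := relComplex_d_mk n x a
      have h₂ : D₂ (RelChains.mk B S x (f a)) = ∑ i : Fin (n + 2), (-1 : ℤ) ^ (i : ℕ) •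
        RelChains.mk B S (x ∘ i.succAbove) (f a) := relComplex_d_mk n x (f a)
      rw [LinearMap.comp_apply, LinearMap.comp_apply, RelChains.coeff_mk, h₁, h₂, map_sum]
      exact Finset.sum_congr rfl fun i _ => by rw [map_zsmul, RelChains.coeff_mk]
  exact LinearMap.congr_fun this c

variable (A S) in
/-- The relative cycles of degree `n`. -/
def relCycles (n : ℕ) : Submodule k (RelChains A S n) := cycleModule (relComplex A S) n

variable (A S) in
/-- The relative homology class of a relative cycle. -/
def relCycleClass (n : ℕ) : relCycles A S n →ₗ[k] relHomology A S n :=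
  homologyClass (relComplex A S) n

lemma relCycleClass_surjective (n : ℕ) : Function.Surjective (relCycleClass A S n) :=
  homologyClass_surjective (relComplex A S) n

/-- The map induced by `RelChains.coeff` on relative cycles. -/
def relCyclesCoeff (f : A →ₗ[k] B) (hf : ∀ g a, f (A.ρ g a) = B.ρ g (f a)) (n : ℕ) :
    relCycles A S n →ₗ[k] relCycles B S n :=
  (RelChains.coeff f hf n).restrict fun z hz => mem_cycleModule.2 <| by
    rintro m rfl
    refine (relComplex_d_coeff f hf z).trans ?_
    exact (congrArg (RelChains.coeff f hf m) (mem_cycleModule.1 hz m rfl)).trans (map_zero _)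

lemma relCyclesCoeff_coe (f : A →ₗ[k] B) (hf : ∀ g a, f (A.ρ g a) = B.ρ g (f a)) {n : ℕ}
    (z : relCycles A S n) :
    (relCyclesCoeff f hf n z : RelChains B S n) = RelChains.coeff f hf n z := rfl

/-- The map on relative homology induced by `RelChains.coeff`. In contrast to `relHomologyMap`, the
coefficient modules may live in different universes. -/
def relHomologyCoeff (f : A →ₗ[k] B) (hf : ∀ g a, f (A.ρ g a) = B.ρ g (f a)) (n : ℕ) :
    relHomology A S n →ₗ[k] relHomology B S n :=
  homologyLift (C := relComplex A S) (relCycleClass B S n ∘ₗ relCyclesCoeff f hf n)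
    fun b => homologyClass_eq_zero_iff.2 ⟨RelChains.coeff f hf (n + 1) b, relComplex_d_coeff f hf b⟩

lemma relHomologyCoeff_relCycleClass (f : A →ₗ[k] B) (hf : ∀ g a, f (A.ρ g a) = B.ρ g (f a))
    {n : ℕ} (z : relCycles A S n) :
    relHomologyCoeff f hf n (relCycleClass A S n z) =
      relCycleClass B S n (relCyclesCoeff f hf n z) :=
  homologyLift_homologyClass ..

/-- An identity between linear maps of relative homology may be checked on the classes of cycles. -/
lemma relHomology_ext {n : ℕ} {N : Type*} [AddCommGroup N] [Module k N]
    {f g : relHomology A S n →ₗ[k] N}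
    (h : ∀ z, f (relCycleClass A S n z) = g (relCycleClass A S n z)) : f = g := by
  ext c
  obtain ⟨z, rfl⟩ := relCycleClass_surjective n c
  exact h z

end Coefficients

section FreeCoefficients

variable {k : Type w} [CommRing k] {Γ : Type u} [Group Γ] {A : Rep.{v} k Γ} {B : Rep.{v'} k Γ}
  {S : Subgroup Γ} (hA : ∀ g a, A.ρ g a = a) (hB : ∀ g b, B.ρ g b = b)

lemma equivariant_of_trivial {A : Rep.{v} k Γ} {B : Rep.{v'} k Γ} (hA : ∀ g a, A.ρ g a = a)
    (hB : ∀ g b, B.ρ g b = b) (f : A →ₗ[k] B) (g : Γ) (a : A) : f (A.ρ g a) = B.ρ g (f a) := by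
  rw [hA, hB]

/-- Any linear map between modules with trivial action induces a map in relative homology, linearly
in the map of coefficients. -/
def relHomologyCoeffHom (S : Subgroup Γ) (n : ℕ) :
    (A →ₗ[k] B) →ₗ[k] relHomology A S n →ₗ[k] relHomology B S n where
  toFun f := relHomologyCoeff f (equivariant_of_trivial hA hB f) n
  map_add' f f' := relHomology_ext fun z => by
    rw [LinearMap.add_apply, relHomologyCoeff_relCycleClass, relHomologyCoeff_relCycleClass,
      relHomologyCoeff_relCycleClass, ← map_add]
    refine congrArg _ (Subtype.ext ?_)
    refine LinearMap.congr_fun (f := RelChains.coeff (f + f') (equivariant_of_trivial hA hB _) n)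
      (g := RelChains.coeff f (equivariant_of_trivial hA hB _) n +
        RelChains.coeff f' (equivariant_of_trivial hA hB _) n)
      (RelChains.lhom_ext fun x a => ?_) z.1
    rw [LinearMap.add_apply, RelChains.coeff_mk, RelChains.coeff_mk, RelChains.coeff_mk]
    exact map_add (RelChains.lmk B S x) _ _
  map_smul' c f := relHomology_ext fun z => by
    rw [RingHom.id_apply, LinearMap.smul_apply, relHomologyCoeff_relCycleClass,
      relHomologyCoeff_relCycleClass, ← map_smul]
    refine congrArg _ (Subtype.ext ?_)
    refine LinearMap.congr_fun (f := RelChains.coeff (c • f) (equivariant_of_trivial hA hB _) n)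
      (g := c • RelChains.coeff f (equivariant_of_trivial hA hB _) n)
      (RelChains.lhom_ext fun x a => ?_) z.1
    rw [LinearMap.smul_apply, RelChains.coeff_mk, RelChains.coeff_mk]
    exact map_smul (RelChains.lmk B S x) _ _

lemma relHomologyCoeffHom_relCycleClass {n : ℕ} (f : A →ₗ[k] B) (z : relCycles A S n) :
    relHomologyCoeffHom hA hB S n f (relCycleClass A S n z) =
      relCycleClass B S n (relCyclesCoeff f (equivariant_of_trivial hA hB f) n z) :=
  relHomologyCoeff_relCycleClass ..

lemma relHomologyCoeffHom_comp (n : ℕ) (f : A →ₗ[k] B) (f' : B →ₗ[k] A)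
    (ζ : relHomology A S n) :
    relHomologyCoeffHom hB hA S n f' (relHomologyCoeffHom hA hB S n f ζ) =
      relHomologyCoeffHom hA hA S n (f' ∘ₗ f) ζ := by
  obtain ⟨z, rfl⟩ := relCycleClass_surjective n ζ
  rw [relHomologyCoeffHom_relCycleClass, relHomologyCoeffHom_relCycleClass,
    relHomologyCoeffHom_relCycleClass]
  refine congrArg _ (Subtype.ext ?_)
  refine LinearMap.congr_fun (f := RelChains.coeff f' (equivariant_of_trivial hB hA _) n ∘ₗ
      RelChains.coeff f (equivariant_of_trivial hA hB _) n)
    (g := RelChains.coeff (f' ∘ₗ f) (equivariant_of_trivial hA hA _) n)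
    (RelChains.lhom_ext fun x a => ?_) z.1
  rw [LinearMap.comp_apply, RelChains.coeff_mk, RelChains.coeff_mk, RelChains.coeff_mk]
  rfl

lemma relHomologyCoeffHom_id (n : ℕ) : relHomologyCoeffHom hA hA S n LinearMap.id = LinearMap.id :=
  relHomology_ext fun z => by
    rw [relHomologyCoeffHom_relCycleClass]
    refine congrArg _ (Subtype.ext ?_)
    refine LinearMap.congr_fun
      (f := RelChains.coeff LinearMap.id (equivariant_of_trivial hA hA _) n) (g := LinearMap.id)
      (RelChains.lhom_ext fun x a => ?_) z.1
    rw [RelChains.coeff_mk]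
    rfl

variable {A : Rep.{w} k Γ} (hA : ∀ g a, A.ρ g a = a) (e : A ≃ₗ[k] k)

/-- For modules `A = k` and `B` with trivial action, the map `H_n(Γ, S; k) ⊗ B → H_n(Γ, S; B)` given
by `ζ ⊗ b ↦ (a ↦ a b)_* ζ`. -/
def relHomologyTensor (S : Subgroup Γ) (n : ℕ) : relHomology A S n ⊗[k] B →ₗ[k] relHomology B S n :=
  TensorProduct.lift
    ((relHomologyCoeffHom hA hB S n ∘ₗ LinearMap.lcomp k B e.toLinearMap ∘ₗ
      (LinearMap.ringLmapEquivSelf k k B).symm.toLinearMap).flip)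

lemma relHomologyTensor_tmul {n : ℕ}
    (ζ : relHomology A S n) (b : B) :
    relHomologyTensor hB hA e S n (ζ ⊗ₜ b) =
      relHomologyCoeffHom hA hB S n (LinearMap.toSpanSingleton k B b ∘ₗ e.toLinearMap) ζ := rfl

/-- The `i`-th component of an element of `H_n(Γ, S; k) ⊗ B` can be recovered from its image in
`H_n(Γ, S; B)`. -/
lemma equivFinsuppOfBasisRight_eq {ι : Type*} [DecidableEq ι] (b : Module.Basis ι k B) {n : ℕ}
    (w : relHomology A S n ⊗[k] B) (i : ι) :
    TensorProduct.equivFinsuppOfBasisRight b w i =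
      relHomologyCoeffHom hB hA S n (e.symm.toLinearMap ∘ₗ b.coord i)
        (relHomologyTensor hB hA e S n w) := by
  induction w with
  | zero => simp
  | add w w' h h' => rw [map_add, map_add, map_add, Finsupp.add_apply, h, h']
  | tmul ζ m =>
    rw [TensorProduct.equivFinsuppOfBasisRight_apply_tmul_apply, relHomologyTensor_tmul,
      relHomologyCoeffHom_comp]
    have h : (e.symm.toLinearMap ∘ₗ b.coord i) ∘ₗ LinearMap.toSpanSingleton k B m ∘ₗ e.toLinearMap =
        b.repr m i • LinearMap.id := by
      ext a
      apply e.injective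
      simp [mul_comm]
    rw [h, map_smul, relHomologyCoeffHom_id]
    rfl

/-- An element in the kernel has all its components equal to `0`. -/
lemma relHomologyTensor_injective [Module.Free k B] (n : ℕ) :
    Function.Injective (relHomologyTensor hB hA e S n) := by
  classical
  refine (injective_iff_map_eq_zero _).2 fun w hw => ?_
  refine (TensorProduct.equivFinsuppOfBasisRight (Module.Free.chooseBasis k B)).injective ?_
  ext i
  rw [equivFinsuppOfBasisRight_eq hB hA e, hw, map_zero, map_zero, Finsupp.zero_apply]

/-- The components of a relative chain with respect to a basis of the coefficient module. -/
def RelChains.components {ι : Type*} (b : Module.Basis ι k B) (n : ℕ) :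
    RelChains B S n →ₗ[k] (ι →₀ RelChains A S n) :=
  RelChains.lift
    (fun x => Finsupp.mapRange.linearMap (RelChains.lmk A S x ∘ₗ e.symm.toLinearMap) ∘ₗ
      b.repr.toLinearMap)
    (fun g x a => by
      ext i
      have := RelChains.mk_smul (S := S) g x (e.symm (b.repr a i))
      rw [hA] at this
      simpa [hB, RelChains.lmk_apply] using this)
    fun x a hx => by
      ext i
      simpa [RelChains.lmk_apply] using RelChains.mk_eq_zero
        (fun i j => S.mul_mem (S.inv_mem (hx i)) (hx j)) (e.symm (b.repr a i))

lemma RelChains.components_apply {ι : Type*} (b : Module.Basis ι k B) {n : ℕ}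
    (z : RelChains B S n) (i : ι) :
    RelChains.components hB hA e b n z i =
      RelChains.coeff (e.symm.toLinearMap ∘ₗ b.coord i) (equivariant_of_trivial hB hA _) n z := by
  refine LinearMap.congr_fun (f := Finsupp.lapply i ∘ₗ RelChains.components hB hA e b n)
    (g := RelChains.coeff (e.symm.toLinearMap ∘ₗ b.coord i)
      (equivariant_of_trivial hB hA _) n)
    (RelChains.lhom_ext fun x a => ?_) z
  rw [RelChains.coeff_mk, LinearMap.comp_apply, RelChains.components, RelChains.lift_mk]
  simp [RelChains.lmk_apply]

lemma RelChains.sum_components {ι : Type*} (b : Module.Basis ι k B) {n : ℕ}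
    (z : RelChains B S n) :
    (RelChains.components hB hA e b n z).sum (fun i z' =>
      RelChains.coeff (LinearMap.toSpanSingleton k B (b i) ∘ₗ e.toLinearMap)
        (equivariant_of_trivial hA hB _) n z') = z := by
  refine LinearMap.congr_fun (f := (Finsupp.lsum k fun i => RelChains.coeff
    (LinearMap.toSpanSingleton k B (b i) ∘ₗ e.toLinearMap) (equivariant_of_trivial hA hB _) n) ∘ₗ
      RelChains.components hB hA e b n) (g := LinearMap.id) (RelChains.lhom_ext fun x a => ?_) z
  rw [LinearMap.comp_apply, RelChains.components, RelChains.lift_mk, LinearMap.comp_apply,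
    Finsupp.mapRange.linearMap_apply, Finsupp.lsum_apply, Finsupp.sum_mapRange_index (by simp)]
  simp only [LinearMap.comp_apply, RelChains.lmk_apply, RelChains.coeff_mk, LinearEquiv.coe_coe,
    LinearEquiv.apply_symm_apply, LinearMap.toSpanSingleton_apply, LinearMap.id_apply]
  refine ((map_finsuppSum (RelChains.lmk B S x) (b.repr a) _).symm).trans ?_
  exact congrArg (RelChains.lmk B S x) (b.linearCombination_repr a)

/-- A cycle is the sum of its components, which are cycles with coefficients in `A`, multiplied by
the elements of the basis. -/
lemma relHomologyTensor_surjective [Module.Free k B] (n : ℕ) :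
    Function.Surjective (relHomologyTensor hB hA e S n) := by
  intro c
  obtain ⟨z, rfl⟩ := relCycleClass_surjective n c
  let b := Module.Free.chooseBasis k B
  let s := (RelChains.components hB hA e b n (z : RelChains B S n)).support
  refine ⟨∑ i ∈ s, relCycleClass A S n (relCyclesCoeff (e.symm.toLinearMap ∘ₗ b.coord i)
    (equivariant_of_trivial hB hA _) n z) ⊗ₜ b i, ?_⟩
  rw [map_sum]
  simp only [relHomologyTensor_tmul, relHomologyCoeffHom_relCycleClass]
  rw [← map_sum]
  refine congrArg _ (Subtype.ext ?_)
  refine Eq.trans ?_ (RelChains.sum_components hB hA e b (z : RelChains B S n))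
  rw [Submodule.coe_sum, Finsupp.sum]
  refine Finset.sum_congr rfl fun i _ => ?_
  rw [relCyclesCoeff_coe, relCyclesCoeff_coe, RelChains.components_apply]

end FreeCoefficients

/-! ### Equivariance of the coefficient map -/

section Equivariance

variable {k : Type w} [CommRing k] {G : Type u} [Group G] {H G' : Subgroup G}
  {M : Rep.{v} k G}

variable (G') in
/-- The map `H_n(H, H'; k) ⊗ M → H_n(H, H'; M)`, when `H` acts trivially on `M`. -/
def normalTensor (hM : ∀ h ∈ H, ∀ m : M, M.ρ h m = m) (n : ℕ) :
    relHomologyOfNormal H G' (Rep.trivial k G k) n ⊗[k] M →ₗ[k] relHomologyOfNormal H G' M n :=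
  relHomologyTensor (A := Rep.res H.subtype (Rep.trivial k G k)) (B := Rep.res H.subtype M)
    (fun h m => hM h h.2 m) (fun _ _ => rfl) (LinearEquiv.refl k k) (G'.subgroupOf H) n

lemma normalTensor_bijective (hM : ∀ h ∈ H, ∀ m : M, M.ρ h m = m) [hf : Module.Free k M] (n : ℕ) :
    Function.Bijective (normalTensor G' hM n) :=
  have : Module.Free k (Rep.res H.subtype M) := hf
  ⟨relHomologyTensor_injective _ _ _ n, relHomologyTensor_surjective _ _ _ n⟩

variable [H.Normal]

/-- `conjMap` may be computed on cycles. -/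
lemma conjMap_relCycleClass (n : ℕ) (g : G')
    (z : relCycles (Rep.res H.subtype M) (G'.subgroupOf H) n)
    (z' : relCycles (Rep.res H.subtype M) (G'.subgroupOf H) n)
    (h : ((conjSimplicial M g).app (Opposite.op (SimplexCategory.mk n))).hom z.1 = z'.1) :
    (conjMap H G' M n g).hom (relCycleClass _ _ n z) = relCycleClass _ _ n z' := by
  have hz := map_mem_cycleModule ((AlgebraicTopology.alternatingFaceMapComplex _).map
    (conjSimplicial (H := H) M g)) z.2
  refine (homologyMap_homologyClass ((AlgebraicTopology.alternatingFaceMapComplex _).map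
    (conjSimplicial (H := H) M g)) z.1 z.2 hz).trans ?_
  exact congrArg (homologyClass _ n) (Subtype.ext h)

/-- Change of coefficients along `f` followed by conjugation by `g` is conjugation by `g` followed
by change of coefficients along `f' = g f g⁻¹`. -/
lemma coeff_comp_conj {A : Rep.{v'} k G} (n : ℕ) (g : G') (f f' : A →ₗ[k] M)
    (hf : ∀ h a, f ((Rep.res H.subtype A).ρ h a) = (Rep.res H.subtype M).ρ h (f a))
    (hf' : ∀ h a, f' ((Rep.res H.subtype A).ρ h a) = (Rep.res H.subtype M).ρ h (f' a))
    (hg : ∀ a, f' (A.ρ g a) = M.ρ g (f a))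
    (z : RelChains (Rep.res H.subtype A) (G'.subgroupOf H) n) :
    RelChains.coeff (A := Rep.res H.subtype A) (B := Rep.res H.subtype M) f' hf' n
        (((conjSimplicial A g).app (Opposite.op (SimplexCategory.mk n))).hom z) =
      ((conjSimplicial M g).app (Opposite.op (SimplexCategory.mk n))).hom
        (RelChains.coeff (A := Rep.res H.subtype A) (B := Rep.res H.subtype M) f hf n z) := by
  let c₁ : RelChains (Rep.res H.subtype A) (G'.subgroupOf H) n →ₗ[k]
      RelChains (Rep.res H.subtype A) (G'.subgroupOf H) n :=
    ((conjSimplicial A g).app (Opposite.op (SimplexCategory.mk n))).hom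
  let c₂ : RelChains (Rep.res H.subtype M) (G'.subgroupOf H) n →ₗ[k]
      RelChains (Rep.res H.subtype M) (G'.subgroupOf H) n :=
    ((conjSimplicial M g).app (Opposite.op (SimplexCategory.mk n))).hom
  have : RelChains.coeff (A := Rep.res H.subtype A) (B := Rep.res H.subtype M) f' hf' n ∘ₗ c₁ =
      c₂ ∘ₗ RelChains.coeff (A := Rep.res H.subtype A) (B := Rep.res H.subtype M) f hf n :=
    RelChains.lhom_ext fun x a => by
      refine (congrArg
        (RelChains.coeff (A := Rep.res H.subtype A) (B := Rep.res H.subtype M) f' hf' n)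
        (conjSimplicial_app_mk A g (Opposite.op (SimplexCategory.mk n)) x a)).trans ?_
      refine (RelChains.coeff_mk (A := Rep.res H.subtype A) (B := Rep.res H.subtype M) f' hf' _
        _).trans (Eq.symm ?_)
      refine (congrArg c₂ (RelChains.coeff_mk (A := Rep.res H.subtype A)
        (B := Rep.res H.subtype M) f hf x a)).trans ?_
      refine (conjSimplicial_app_mk M g (Opposite.op (SimplexCategory.mk n)) x (f a)).trans ?_
      exact congrArg _ (hg a).symm
  exact LinearMap.congr_fun this z

/-- The map `H_n(H, H'; k) ⊗ M → H_n(H, H'; M)` is equivariant for the actions of `G'`. -/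
lemma normalTensor_conj (hM : ∀ h ∈ H, ∀ m : M, M.ρ h m = m) (n : ℕ) (g : G')
    (ζ : relHomologyOfNormal H G' (Rep.trivial k G k) n) (m : M) :
    normalTensor G' hM n ((conjMap H G' (Rep.trivial k G k) n g).hom ζ ⊗ₜ M.ρ g m) =
      (conjMap H G' M n g).hom (normalTensor G' hM n (ζ ⊗ₜ m)) := by
  have hA : ∀ (h : H) (a : Rep.res H.subtype (Rep.trivial k G k)),
    (Rep.res H.subtype (Rep.trivial k G k)).ρ h a = a := fun _ _ => rfl
  have hB : ∀ (h : H) (b : Rep.res H.subtype M), (Rep.res H.subtype M).ρ h b = b :=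
    fun h b => hM h h.2 b
  obtain ⟨z, rfl⟩ := relCycleClass_surjective (A := Rep.res H.subtype (Rep.trivial k G k))
    (S := G'.subgroupOf H) n ζ
  have hz := map_mem_cycleModule ((AlgebraicTopology.alternatingFaceMapComplex _).map
    (conjSimplicial (H := H) (Rep.trivial k G k) g)) z.2
  let z' : relCycles (Rep.res H.subtype (Rep.trivial k G k)) (G'.subgroupOf H) n := ⟨_, hz⟩
  let f (b : M) : Rep.trivial k G k →ₗ[k] M := LinearMap.toSpanSingleton k M b
  have h₁ : normalTensor G' hM n
      (relCycleClass (Rep.res H.subtype (Rep.trivial k G k)) (G'.subgroupOf H) n z ⊗ₜ m) =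
        relCycleClass (Rep.res H.subtype M) (G'.subgroupOf H) n (relCyclesCoeff
          (A := Rep.res H.subtype (Rep.trivial k G k)) (B := Rep.res H.subtype M) (f m)
          (equivariant_of_trivial hA hB _) n z) :=
    relHomologyCoeffHom_relCycleClass hA hB _ z
  have h₂ : normalTensor G' hM n
      (relCycleClass (Rep.res H.subtype (Rep.trivial k G k)) (G'.subgroupOf H) n z' ⊗ₜ M.ρ g m) =
        relCycleClass (Rep.res H.subtype M) (G'.subgroupOf H) n (relCyclesCoeff
          (A := Rep.res H.subtype (Rep.trivial k G k)) (B := Rep.res H.subtype M) (f (M.ρ g m))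
          (equivariant_of_trivial hA hB _) n z') :=
    relHomologyCoeffHom_relCycleClass hA hB _ z'
  refine (congrArg (fun ξ => normalTensor G' hM n (ξ ⊗ₜ M.ρ g m))
    (conjMap_relCycleClass n g z z' rfl)).trans (h₂.trans (Eq.symm ?_))
  refine (congrArg (conjMap H G' M n g).hom h₁).trans ?_
  refine conjMap_relCycleClass n g _ _ ?_
  exact (coeff_comp_conj (A := Rep.trivial k G k) n g (f m) (f (M.ρ g m))
    (equivariant_of_trivial hA hB _) (equivariant_of_trivial hA hB _)
    (fun a => ((M.ρ g).map_smul a m).symm) z.1).symm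

/-- The map `H_n(H, H'; k) ⊗ M → H_n(H, H'; M)` is equivariant for the actions of `G / H`. -/
lemma normalTensor_rho (hM : ∀ h ∈ H, ∀ m : M, M.ρ h m = m)
    (hQ : Function.Bijective (quotientComparison H G')) (n : ℕ) (c : G ⧸ H)
    (w : tensorRep (relHomologyRep (Rep.trivial k G k) hQ n) (quotientRep M hM)) :
    normalTensor G' hM n
        ((tensorRep (relHomologyRep (Rep.trivial k G k) hQ n) (quotientRep M hM)).ρ c w) =
      (relHomologyRep M hQ n).ρ c (normalTensor G' hM n w) := by
  obtain ⟨g, rfl⟩ := exists_mk_eq hQ.2 c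
  refine Eq.trans ?_ (relHomologyRep_apply H G' M hQ n g _).symm
  let τ : relHomologyOfNormal H G' (Rep.trivial k G k) n ⊗[k] M →ₗ[k]
      relHomologyOfNormal H G' (Rep.trivial k G k) n ⊗[k] M :=
    (tensorRep (relHomologyRep (Rep.trivial k G k) hQ n) (quotientRep M hM)).ρ ((g : G) : G ⧸ H)
  have : normalTensor G' hM n ∘ₗ τ = (conjMap H G' M n g).hom ∘ₗ normalTensor G' hM n :=
    TensorProduct.ext' fun ζ m => Eq.trans (congrArg
      (fun ξ : relHomologyOfNormal H G' (Rep.trivial k G k) n =>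
        normalTensor G' hM n (ξ ⊗ₜ M.ρ g m))
      (relHomologyRep_apply H G' (Rep.trivial k G k) hQ n g ζ)) (normalTensor_conj hM n g ζ m)
  exact LinearMap.congr_fun this w

end Equivariance

/-- If `H` acts trivially on the free module `M`, the homology of `G / H` with coefficients in
`H_n(H, H'; M)` may be computed from `H_n(H, H'; k) ⊗ M`. -/
lemma nonempty_groupHomology_tensorRep_iso {k : Type w} [CommRing k] {G : Type u} [Group G]
    {H G' : Subgroup G} [H.Normal] (M : Rep.{v} k G) (hM : ∀ h ∈ H, ∀ m : M, M.ρ h m = m)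
    [Module.Free k M] (hQ : Function.Bijective (quotientComparison H G')) (p q : ℕ) :
    Nonempty (groupHomology
      (tensorRep (relHomologyRep (Rep.trivial k G k) hQ q) (quotientRep M hM)) p ≅
        groupHomology (relHomologyRep M hQ q) p) :=
  nonempty_groupHomology_iso (A := tensorRep (relHomologyRep (Rep.trivial k G k) hQ q)
    (quotientRep M hM)) (B := relHomologyRep M hQ q) (normalTensor G' hM q)
    (normalTensor_rho hM hQ q) (normalTensor_bijective hM q) p

end RelativeLHS
end

theorem mainTheorem5 {G : Type u} [Group G] (H G' : Subgroup G) [H.Normal] (M : Rep.{v} ℤ G)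
    (hQ : Function.Bijective (RelativeLHS.quotientComparison H G')) :
    ∃ E : RelativeLHS.E₂HomologicalSpectralSequence.{0, max u v} ℤ,
      (∀ p q : ℕ, Nonempty ((E.page 2).X (p, q) ≅
        RelativeLHS.groupHomology (RelativeLHS.relHomologyRep M hQ q) p)) ∧
      RelativeLHS.ConvergesTo E (fun n => RelativeLHS.relHomology M G' n) ∧
      (∀ hM : ∀ h ∈ H, ∀ m : M, M.ρ h m = m, Module.Free ℤ M →
        ∀ p q : ℕ, Nonempty ((E.page 2).X (p, q) ≅
          RelativeLHS.groupHomology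
            (RelativeLHS.tensorRep (RelativeLHS.relHomologyRep (Rep.trivial ℤ G ℤ) hQ q)
              (RelativeLHS.quotientRep M hM)) p)) := by
  obtain ⟨E, hE, hconv⟩ := RelativeLHS.exists_relative_spectralSequence H G' M hQ
  refine ⟨E, hE le_rfl, hconv, fun hM hfree p q => ?_⟩
  -- all `ℤ`-module structures on `M` agree
  have : @Module.Free ℤ M _ _ M.hV2 := by
    convert hfree
    exact Subsingleton.elim _ _
  obtain ⟨e⟩ := hE le_rfl p q
  obtain ⟨e'⟩ := RelativeLHS.nonempty_groupHomology_tensorRep_iso M hM hQ p q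
  exact ⟨e ≪≫ e'.symm⟩
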